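/- **Setting.** Let $q\ge 1$ and let $m\ge 4$ be even; put $M=m$, $N=mq$. The lattice $\mathbb Z/N\mathbb Z$ (periodic boundary conditions) is divided into the cells $C_k=\{kq,\dots,kq+q-1\}$, $k\in\mathbb Z/m\mathbb Z$. Spins $\sigma(x)\in\{\pm1\}$ are independent under the prior $P_N$, with $P_x(+1)\in(0,1)$ the same for all sites of a cell; $\sigma^k=\sigma|_{C_k}$, $\eta(k)=\sum_{x\in C_k}\sigma(x)\in\{-q,-q+2,\dots,q\}$, $\mathbf F\sigma=\eta$, and $P_k(\cdot\mid\eta(k))$ is the conditional prior on $C_k$. Let $\beta>0$ and $H_N=H_N^s+H_N^l$, where $H^s_N=\sum_{X\ne\emptyset}U_X$ with $U$ translation invariant of range $S$ ($U_X$ depends only on $\sigma|_X$, and $U_X=0$ if $\mathrm{diam}\,X>S$), $\|U\|=\sum_{X\ni 0}\|U_X\|_\infty$, and $H^l_N=-\frac12\sum_x\sum_{y\neq x}J(x-y)\sigma(x)\sigma(y)$ with $J(x-y)=\frac1L V(|x-y|/L)$, $|x-y|$ the periodic distance, $V\in C^1([0,\infty))$, $V(r)=0$ for $r>1$, $\|\nabla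 V\|_\infty=\sup_{r\ge0}|V'(r)|$. Assume $S<q<L$. Put $$e^{-\beta\bar H_M(\eta)}=\mathbb E[e^{-\beta H_N}\mid\eta],\qquad \delta=\frac{\beta S\|U\|}{q}+\frac{q\beta\|\nabla V\|_\infty}{L}.$$ Let $H^s_k=\sum_{\emptyset\ne X\subset C_k}U_X$, let $W_{k,k+1}$ be the sum of the $U_X$ over the $X$ meeting both $C_k$ and $C_{k+1}$, and $$Z_k(\eta(k);\sigma^{k-1},\sigma^{k+1})=\int e^{-\beta(W_{k-1,k}+H^s_k+W_{k,k+1})}P_k(d\sigma^k\mid\eta(k)),$$ where an argument $0$ in place of $\sigma^{k\mp1}$ means that the corresponding $W$ is dropped. Let $Z_{k-1,k,k+1}(\eta(k-1),\eta(k),\eta(k+1))$ be the integral of $e^{-\beta(H^s_{k-1}+W_{k-1,k}+H^s_k+W_{k,k+1}+H^s_{k+1})}$ against $P_{k-1}P_kP_{k+1}$. Define $\bar H^{(0)}=\bar H^{l,(0)}+\bar H^{s,(0)}$, $\bar H^{l,(0)}(\eta)=\mathbb E[H_N^l\mid\eta]$, and $$\bar H^{s,(0)}(\eta)=-\frac1\beta\sum_{k\text{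 even}}\log Z_{k-1,k,k+1}(\eta(k-1),\eta(k),\eta(k+1))+\frac1\beta\sum_{k\text{ odd}}\log Z_k(\eta(k);0,0).$$ Finally let $$f^s_{k-1,k+1}=\frac{Z_k(\eta(k);\sigma^{k-1},\sigma^{k+1})Z_k(\eta(k);0,0)}{Z_k(\eta(k);0,\sigma^{k+1})Z_k(\eta(k);\sigma^{k-1},0)}-1,\qquad f^l_{jk}=e^{\frac\beta2\sum_{x\in C_j}\sum_{y\in C_k,y\ne x}(J(x-y)-\bar J(j,k))\sigma(x)\sigma(y)(2-\delta_{jk})}-1,$$ where $\bar J(j,k)$ is the mean of $J(x-y)$ over $x\in C_j$, $y\in C_k$, $y\ne x$, and $\delta_{jk}$ is the Kronecker symbol. **Expansion terms.** Let $\nu(\cdot\mid\eta)$ be the reference probability measure in which the even cells are independent, with densities $e^{-\beta H^s_k}Z_{k+1}(\eta(k+1);\sigma^k,0)Z_{k-1}(\eta(k-1);0,\sigma^k)/Z_{k-1,k,k+1}$ relative to $P_k(\cdot\mid\eta(k))$, and, given these, the odd cells are independent with densities $e^{-\beta(H^s_k+W_{k-1,k}+W_{k,k+1})}/Z_k(\eta(k);\sigma^{k-1},\sigma^{k+1})$.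 A bond is either an odd $k$, with factor $f^s_{k-1,k+1}$ and support $\{k-1,k+1\}$, or a pair $j\le k$, with factor $f^l_{jk}$ and support $c(j)\cup c(k)$, where $c(i)=\{i\}$ for $i$ even and $c(i)=\{i-1,i,i+1\}$ for $i$ odd. A polymer $R$ is a nonempty set of $|R|$ bonds connected through intersecting supports; its activity $w(R)=w(R;\eta)$ is the $\nu(\cdot\mid\eta)$-integral of the product of its factors; polymers are compatible if the unions of the supports of their bonds are disjoint. Let $\Xi(w)=\sum_G\prod_{R\in G}w(R)$ over families $G$ of pairwise compatible polymers, let $c_I$ be the Taylor coefficients of $\log\Xi$ at $w=0$ ($I$ a multi-index on the set of polymers), and $$\bar H^{(j)}(\eta)=-\frac1\beta\sum_{I:\ \sum_R I_R|R|=j}c_I\prod_R w(R;\eta)^{I_R}\qquad(j\ge1).$$ **Theorem 3.1.** In the setting above, $\bar H^{l,(0)}(\eta)=-\frac12\sum_k\sum_{l\ne k}\bar J(k,l)\eta(k)\eta(l)-\frac12\sum_k\bar J(k,k)(\eta(k)^2-q)$ for all $\eta$ (the terms $\bar J(k,k)(\eta(k)^2-q)$ being read as $0$ if $q=1$), and: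 1. There is an absolute constant $C$ such that, for all $\eta$, $$\beta\,|\bar H_M(\eta)-\bar H^{(0)}(\eta)|\le C\,N\,\delta ,$$ and the specific relative entropy of the approximate coarse-grained Gibbs measure $\bar\mu^{(0)}(\eta)\propto e^{-\beta\bar H^{(0)}(\eta)}(P_N\circ\mathbf F^{-1})(\eta)$ with respect to the exact one satisfies $\frac1N\mathcal R(\bar\mu^{(0)}\mid\mu_{N,\beta}\circ\mathbf F^{-1})\le C\,\delta$, where $\mu_{N,\beta}\propto e^{-\beta H_N}P_N$. 2. There are absolute constants $\delta_0,\delta_1,C>0$ such that if $$\sup_{k\text{ odd}}\ \sup_{\sigma^{k-1},\sigma^{k+1},\eta(k)}|f^s_{k-1,k+1}|\le\delta_0,\qquad \sup_{j,k}\ \sup_{\sigma^j,\sigma^k}|f^l_{jk}|\le\delta_1\,\frac qL ,$$ then, for all $\eta$, $\bar H_M(\eta)=\bar H^{(0)}(\eta)+\sum_{j\ge1}\bar H^{(j)}(\eta)$ with a convergent series, and for every $p\ge0$ $$\beta\,\Bigl|\bar H_M(\eta)-\sum_{j=0}^{p}\bar H^{(j)}(\eta)\Bigr|\le M\,(C\,q\,\delta)^{p+1}.$$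 In particular the remainder of $\beta\bar H_M$ is $M\cdot O(\delta^{p+1})$ for fixed $q$, uniformly in $N$. -/

import Mathlib

open scoped BigOperators

noncomputable section

namespace CoarseGrain

/-- Spin values `+1`, `-1`. -/
abbrev Spin := ℤˣ

/-- Microscopic configurations on one coarse cell of `q` consecutive lattice sites. -/
abbrev Cell (q : ℕ) := Fin q → Spin

/-- Microscopic configurations on the periodic lattice `ℤ / (m q)`, listed cell by cell:
`σ k i` is the spin at the site `k q + i`. -/
abbrev Config (m q : ℕ) := ZMod m → Cell q

/-- The data of a one-dimensional model with `m` coarse cells of `q` sites each. The laws that the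
data satisfy are collected in `Model.Admissible` below. -/
structure Model (m q : ℕ) where
  /-- range of the short-range potential -/
  S : ℕ
  /-- range of the long-range potential -/
  L : ℝ
  /-- inverse temperature -/
  β : ℝ
  /-- short-range potential: `U X` is a function of the spins in the finite set `X` -/
  U : Finset ℤ → (ℤ → Spin) → ℝ
  /-- profile of the long-range potential -/
  V : ℝ → ℝ
  /-- prior probability of the spin `+1` at the sites of a given cell -/
  prior : ZMod m → ℝ

/-- The standing assumptions. -/
structure Model.Admissible {m q : ℕ} (D : Model m q) : Prop where
  /-- cells alternate between even and odd around the periodic lattice -/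
  even_m : Even m
  four_le_m : 4 ≤ m
  beta_pos : 0 < D.β
  S_lt_q : D.S < q
  q_lt_L : (q : ℝ) < D.L
  /-- `U X` depends only on the spins in `X` -/
  U_local : ∀ (X : Finset ℤ) (σ τ : ℤ → Spin), (∀ x ∈ X, σ x = τ x) → D.U X σ = D.U X τ
  /-- translation invariance -/
  U_translation : ∀ (X : Finset ℤ) (y : ℤ) (σ : ℤ → Spin),
    D.U (X.image (fun x => x + y)) σ = D.U X (fun x => σ (x + y))
  /-- `U X` vanishes if the diameter of `X` exceeds `S` -/
  U_range : ∀ X : Finset ℤ, (∃ x ∈ X, ∃ y ∈ X, (D.S : ℤ) < y - x) → ∀ σ, D.U X σ = 0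
  V_contDiff : ContDiffOn ℝ 1 D.V (Set.Ici 0)
  V_support : ∀ r : ℝ, 1 < r → D.V r = 0
  prior_pos : ∀ k, 0 < D.prior k
  prior_lt_one : ∀ k, D.prior k < 1

/-- The supremum norm of `U X`. -/
def potentialSup (u : (ℤ → Spin) → ℝ) : ℝ := ⨆ σ : ℤ → Spin, |u σ|

/-- The coarse spin of a cell: the sum of its spins. -/
def cellSum {q : ℕ} (τ : Cell q) : ℤ := ∑ i, (τ i : ℤ)

/-- The coarse-graining map `F`. -/
def coarsen {m q : ℕ} (σ : Config m q) : ZMod m → ℤ := fun k => cellSum (σ k)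

/-- The coarse single-cell values `-q, -q+2, ..., q`. -/
def coarseSpins (q : ℕ) : Finset ℤ := (Finset.range (q + 1)).image (fun j : ℕ => 2 * (j : ℤ) - q)

/-- The coarse configuration space. -/
def coarseConfigs (m q : ℕ) [NeZero m] : Finset (ZMod m → ℤ) :=
  Fintype.piFinset (fun _ => coarseSpins q)

/-- A configuration of the periodic lattice as a periodic function on `ℤ`. -/
def periodicExt {m q : ℕ} [NeZero q] (σ : Config m q) : ℤ → Spin :=
  fun x => σ ((x / (q : ℤ) : ℤ) : ZMod m) (Fin.ofNat q (x % (q : ℤ)).toNat)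

/-- Two cell configurations side by side, on the sites `0, ..., q-1` and `q, ..., 2q-1`
(the values elsewhere are irrelevant). -/
def paste {q : ℕ} [NeZero q] (τ τ' : Cell q) : ℤ → Spin :=
  fun x => if x < (q : ℤ) then τ (Fin.ofNat q (x % (q : ℤ)).toNat)
    else τ' (Fin.ofNat q (x % (q : ℤ)).toNat)

/-- The lattice distance of two sites of the periodic lattice `ℤ / (m q)`. -/
def siteDist {m q : ℕ} (x y : ZMod m × Fin q) : ℕ :=
  (((x.1.val * q + x.2.val : ℕ) : ZMod (m * q))
    - ((y.1.val * q + y.2.val : ℕ) : ZMod (m * q))).valMinAbs.natAbs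

/-- The product prior on a cell: independent spins, each equal to `+1` with probability `r`. -/
def cellPrior {q : ℕ} (r : ℝ) (τ : Cell q) : ℝ := ∏ i, (if τ i = 1 then r else 1 - r)

/-- The conditional prior on a cell, given that the sum of its spins is `s`. -/
def cellCond {q : ℕ} (r : ℝ) (s : ℤ) (τ : Cell q) : ℝ :=
  if cellSum τ = s then
    cellPrior r τ / ∑ τ' : Cell q, (if cellSum τ' = s then cellPrior r τ' else 0)
  else 0

/-- The relative entropy of the probability weight `μ` with respect to `ν` on a finite set. -/
def relEntropy {α : Type*} (s : Finset α) (μ ν : α → ℝ) : ℝ :=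
  ∑ a ∈ s, μ a * Real.log (μ a / ν a)

/-- Bonds: one for each short-range factor (odd cells `k`), and one for each long-range factor
(pairs of cells `j ≤ k`). -/
abbrev Bond (m : ℕ) :=
  {k : ZMod m // Odd k.val} ⊕ {e : ZMod m × ZMod m // e.1.val ≤ e.2.val}

/-- A cell together with the cells on which its reference measure is conditioned. -/
def corridor {m : ℕ} (k : ZMod m) : Finset (ZMod m) :=
  if Odd k.val then {k - 1, k, k + 1} else {k}

/-- The support of a bond. -/
def bondSupport {m : ℕ} : Bond m → Finset (ZMod m)
  | Sum.inl k => {k.1 - 1, k.1 + 1}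
  | Sum.inr e => corridor e.1.1 ∪ corridor e.1.2

/-- A polymer is a nonempty connected set of bonds: any two of its bonds are joined by a chain of
bonds of the set, consecutive ones having intersecting supports. -/
def IsPolymer {m : ℕ} (R : Finset (Bond m)) : Prop :=
  R.Nonempty ∧ ∀ b ∈ R, ∀ b' ∈ R, Relation.ReflTransGen
    (fun x y => x ∈ R ∧ y ∈ R ∧ ¬ Disjoint (bondSupport x) (bondSupport y)) b b'

/-- The type of polymers. -/
abbrev Polymer (m : ℕ) := {R : Finset (Bond m) // IsPolymer R}

instance instFintypePolymer (m : ℕ) [NeZero m] : Fintype (Polymer m) := Fintype.ofFinite _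

/-- The set of cells covered by a polymer. -/
def polymerSupport {m : ℕ} (R : Polymer m) : Finset (ZMod m) := R.1.biUnion bondSupport

open Classical in
/-- The partition function of the hard-core polymer gas, as a polynomial in the activities: the sum
over all families of pairwise compatible (disjointly supported) polymers of the product of the
activities. -/
def polymerZ (m : ℕ) [NeZero m] : MvPolynomial (Polymer m) ℝ :=
  ∑ G : Finset (Polymer m) with
      (∀ R ∈ G, ∀ R' ∈ G, R ≠ R' → Disjoint (polymerSupport R) (polymerSupport R')),
    ∏ R ∈ G, MvPolynomial.X R

/-- The cluster coefficient `c_I`: the Taylor coefficient, at activities zero, of the logarithm of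
the polymer partition function. As `polymerZ - 1` has no constant term, only the powers up to the
degree of `I` contribute to `log (1 + x) = x - x ^ 2 / 2 + ...`. -/
def clusterCoeff {m : ℕ} [NeZero m] (I : Polymer m → ℕ) : ℝ :=
  ∑ n ∈ Finset.Icc 1 (∑ R, I R), (-1 : ℝ) ^ (n + 1) / n *
    MvPolynomial.coeff (Finsupp.equivFunOnFinite.symm I) ((polymerZ m - 1) ^ n)

/-- The multi-indices of order `j`: the total number of bonds, with multiplicity, is `j`
(so that every entry is at most `j`). -/
def multiIndices (m : ℕ) [NeZero m] (j : ℕ) : Finset (Polymer m → ℕ) :=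
  (Fintype.piFinset (fun _ : Polymer m => Finset.range (j + 1))).filter
    (fun I => ∑ R, I R * R.1.card = j)

namespace Model

variable {m q : ℕ} [NeZero m] [NeZero q] (D : Model m q)

/-- `‖U‖`: the sum of `‖U X‖_∞` over the sets `X` of diameter at most `S` that contain the origin
(sets of larger diameter contribute `0`). -/
def normU : ℝ :=
  ∑ X ∈ (Finset.Icc (-(D.S : ℤ)) D.S).powerset with (0 : ℤ) ∈ X, potentialSup (D.U X)

/-- `‖∇V‖_∞`, the supremum of `|V'|` on `[0, ∞)`. -/
def gradV : ℝ := ⨆ r : Set.Ici (0 : ℝ), |derivWithin D.V (Set.Ici 0) r|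

/-- The two-body potential `J(x - y) = V(|x - y| / L) / L`. -/
def J (x y : ZMod m × Fin q) : ℝ := 1 / D.L * D.V (1 / D.L * (siteDist x y : ℝ))

/-- The short-range Hamiltonian with periodic boundary conditions: every nonempty set of diameter
at most `S` on the periodic lattice is counted once, through its leftmost site `x`. -/
def Hs (σ : Config m q) : ℝ :=
  ∑ x ∈ Finset.Ico (0 : ℤ) (m * q), ∑ X ∈ (Finset.Icc x (x + D.S)).powerset with x ∈ X,
    D.U X (periodicExt σ)

/-- The long-range Hamiltonian. -/
def Hl (σ : Config m q) : ℝ :=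
  -(1 / 2) * ∑ x : ZMod m × Fin q, ∑ y : ZMod m × Fin q with y ≠ x,
    D.J x y * (σ x.1 x.2 : ℤ) * (σ y.1 y.2 : ℤ)

/-- The microscopic Hamiltonian. -/
def H (σ : Config m q) : ℝ := D.Hs σ + D.Hl σ

/-- The product prior. -/
def P (σ : Config m q) : ℝ := ∏ k, cellPrior (D.prior k) (σ k)

/-- The microscopic Gibbs measure. -/
def gibbs (σ : Config m q) : ℝ :=
  Real.exp (-D.β * D.H σ) * D.P σ / ∑ σ' : Config m q, Real.exp (-D.β * D.H σ') * D.P σ'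

/-- The image of the Gibbs measure under the coarse-graining map: the exact coarse-grained Gibbs
measure. -/
def coarseGibbs (η : ZMod m → ℤ) : ℝ := ∑ σ : Config m q with coarsen σ = η, D.gibbs σ

/-- The coarse-grained prior. -/
def coarseP (η : ZMod m → ℤ) : ℝ := ∑ σ : Config m q with coarsen σ = η, D.P σ

/-- The conditional expectation `E[g | η]` under the prior. -/
def condE (g : Config m q → ℝ) (η : ZMod m → ℤ) : ℝ :=
  (∑ σ : Config m q with coarsen σ = η, D.P σ * g σ) / D.coarseP η

/-- The exact coarse-grained Hamiltonian. -/
def barH (η : ZMod m → ℤ) : ℝ :=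
  -(1 / D.β) * Real.log (D.condE (fun σ => Real.exp (-D.β * D.H σ)) η)

/-- The long-range part of the zeroth-order approximation. -/
def barHl0 (η : ZMod m → ℤ) : ℝ := D.condE D.Hl η

/-- The cell average of the two-body potential. -/
def barJ (k l : ZMod m) : ℝ :=
  if k = l then
    1 / ((q : ℝ) * (q - 1)) * ∑ i : Fin q, ∑ j : Fin q with j ≠ i, D.J (k, i) (k, j)
  else 1 / (q : ℝ) ^ 2 * ∑ i : Fin q, ∑ j : Fin q, D.J (k, i) (l, j)

/-- Energy of a cell with free boundary conditions (the same for every cell, by translation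
invariance). -/
def cellEnergy (τ : Cell q) : ℝ :=
  ∑ X ∈ (Finset.Ico (0 : ℤ) q).powerset with X.Nonempty, D.U X (paste τ τ)

/-- Interaction energy `W` of two adjacent cells with configurations `τ` (left) and `τ'` (right):
the sum over the sets `X` that meet both cells. -/
def pairEnergy (τ τ' : Cell q) : ℝ :=
  ∑ X ∈ (Finset.Ico (0 : ℤ) (2 * q)).powerset with
      ((∃ x ∈ X, x < (q : ℤ)) ∧ ∃ x ∈ X, (q : ℤ) ≤ x),
    D.U X (paste τ τ')

/-- Interaction with the left neighbour; `none` stands for a free boundary. -/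
def leftEnergy (a : Option (Cell q)) (τ : Cell q) : ℝ := a.elim 0 (fun a' => D.pairEnergy a' τ)

/-- Interaction with the right neighbour; `none` stands for a free boundary. -/
def rightEnergy (τ : Cell q) (b : Option (Cell q)) : ℝ := b.elim 0 (fun b' => D.pairEnergy τ b')

/-- One-cell partition function `Z_k(s; a, b)` with boundary conditions `a` on the left and `b` on
the right. -/
def Z1 (k : ZMod m) (s : ℤ) (a b : Option (Cell q)) : ℝ :=
  ∑ τ : Cell q, cellCond (D.prior k) s τ *
    Real.exp (-D.β * (D.leftEnergy a τ + D.rightEnergy τ b + D.cellEnergy τ))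

/-- Three-cell partition function with free boundary conditions on the cells `k-1, k, k+1`. -/
def Z3 (k : ZMod m) (s₁ s₂ s₃ : ℤ) : ℝ :=
  ∑ τ₁ : Cell q, ∑ τ₂ : Cell q, ∑ τ₃ : Cell q,
    cellCond (D.prior (k - 1)) s₁ τ₁ * cellCond (D.prior k) s₂ τ₂ *
      cellCond (D.prior (k + 1)) s₃ τ₃ *
    Real.exp (-D.β * (D.cellEnergy τ₁ + D.pairEnergy τ₁ τ₂ + D.cellEnergy τ₂ +
      D.pairEnergy τ₂ τ₃ + D.cellEnergy τ₃))

/-- One-body potential. -/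
def U1 (k : ZMod m) (s : ℤ) : ℝ := -(1 / D.β) * Real.log (D.Z1 k s none none)

/-- Three-body potential. -/
def U3 (k : ZMod m) (s₁ s₂ s₃ : ℤ) : ℝ := -(1 / D.β) * Real.log (D.Z3 k s₁ s₂ s₃)

/-- The short-range part of the zeroth-order approximation: three-body terms around the even cells;
each odd cell is shared by two of them, so its one-body term is subtracted once. -/
def barHs0 (η : ZMod m → ℤ) : ℝ :=
  (∑ k : ZMod m with Even k.val, D.U3 k (η (k - 1)) (η k) (η (k + 1)))
    - ∑ k : ZMod m with Odd k.val, D.U1 k (η k)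

/-- The zeroth-order approximation. -/
def barH0 (η : ZMod m → ℤ) : ℝ := D.barHl0 η + D.barHs0 η

/-- The approximate coarse-grained Gibbs measure. -/
def coarseGibbs0 (η : ZMod m → ℤ) : ℝ :=
  Real.exp (-D.β * D.barH0 η) * D.coarseP η /
    ∑ η' ∈ coarseConfigs m q, Real.exp (-D.β * D.barH0 η') * D.coarseP η'

/-- The short-range smallness function `f^s_{k-1,k+1}(s; a, b)`. -/
def fs (k : ZMod m) (s : ℤ) (a b : Cell q) : ℝ :=
  D.Z1 k s (some a) (some b) * D.Z1 k s none none /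
    (D.Z1 k s none (some b) * D.Z1 k s (some a) none) - 1

/-- The long-range smallness function `f^l_{jk}`; it depends on `σ` through the cells `j`, `k`. -/
def fl (j k : ZMod m) (σ : Config m q) : ℝ :=
  Real.exp (D.β / 2 * ∑ x : Fin q, ∑ y : Fin q with (k, y) ≠ (j, x),
    (D.J (j, x) (k, y) - D.barJ j k) * (σ j x : ℤ) * (σ k y : ℤ)
      * (2 - if j = k then 1 else 0)) - 1

/-- The factor `f` attached to a bond. -/
def bondFactor (η : ZMod m → ℤ) (σ : Config m q) : Bond m → ℝ
  | Sum.inl k => D.fs k.1 (η k.1) (σ (k.1 - 1)) (σ (k.1 + 1))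
  | Sum.inr e => D.fl e.1.1 e.1.2 σ

/-- The reference measure `ν(σ | η)`: first the even cells, then the odd cells given the even
ones. -/
def refMeasure (η : ZMod m → ℤ) (σ : Config m q) : ℝ :=
  (∏ k : ZMod m with Odd k.val,
    Real.exp (-D.β * (D.cellEnergy (σ k) + D.pairEnergy (σ (k - 1)) (σ k)
        + D.pairEnergy (σ k) (σ (k + 1))))
      / D.Z1 k (η k) (some (σ (k - 1))) (some (σ (k + 1)))
      * cellCond (D.prior k) (η k) (σ k)) *
  ∏ k : ZMod m with Even k.val,
    Real.exp (-D.β * D.cellEnergy (σ k))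
      * D.Z1 (k + 1) (η (k + 1)) (some (σ k)) none
      * D.Z1 (k - 1) (η (k - 1)) none (some (σ k))
      / D.Z3 k (η (k - 1)) (η k) (η (k + 1))
      * cellCond (D.prior k) (η k) (σ k)

/-- The activity of a polymer. -/
def activity (η : ZMod m → ℤ) (R : Polymer m) : ℝ :=
  ∑ σ : Config m q, D.refMeasure η σ * ∏ b ∈ R.1, D.bondFactor η σ b

/-- The correction `H^(j)`: the terms of order `j` in the bond factors of the cluster expansion
`log Ξ = ∑_I c_I ∏_R w(R) ^ I_R`. -/
def correction (j : ℕ) (η : ZMod m → ℤ) : ℝ :=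
  -(1 / D.β) * ∑ I ∈ multiIndices m j, clusterCoeff I * ∏ R, D.activity η R ^ I R

/-- `δ`, the sum of the short-range and the long-range small parameter. -/
def delta : ℝ := D.β * D.S * D.normU / q + q * D.β * D.gradV / D.L

end Model

end CoarseGrain

end

/-! Everything rests on an exact identity (`density_identity`): for fixed `η`, the conditional prior
times `exp (-β H)` equals the constant `exp (-β H⁽⁰⁾(η))` times the density of the reference measure
`ν` times the product of `1 + f_b` over all bonds. On the short-range side it is a cancellation of
one-cell and three-cell partition functions, once each interaction of adjacent cells is charged to
its odd cell. On the long-range side `H^l` is a mean-field function of `η` plus fluctuations. The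
conditional prior is invariant under permutations of sites inside a cell, so its two-point function
is the same for all pairs of distinct sites of two given cells; as `J - J̄` sums to zero over such
pairs, the fluctuations have conditional mean zero. This gives the explicit formula for the
long-range part. Consequently `β (H̄ - H⁽⁰⁾) = -log Ξ`, where `Ξ` is the `ν`-mean of `∏ (1 + f_b)`
(`barH_sub_barH0`).

For the zeroth-order bounds no expansion is needed. The product is pointwise `exp x` with `|x| ≤ 5 N
δ`: cell interactions are boundary terms, and `J` oscillates by at most `2 q ‖∇V‖ / L²` over a pair
of cells, of which about `L / q` per cell are in range. Since `ν` is a probability measure, `log Ξ`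
obeys the same bound. Weights within a factor `exp t` of each other, once normalized, have relative
entropy at most `2 t`.

For the expansion, write `Ξ = ∑_B φ(B)` over sets of bonds, with `φ(B)` the `ν`-mean of `∏_{b ∈ B}
f_b`. The supports are closed under adding the cells on which an odd cell is conditioned, so `φ`
factorizes over sets with disjoint supports (`factorizes_bondWeight`). Decomposition into connected
components turns the sum over `B` into the polymer partition function (`polymerPoly_eq`).

Convergence is proved on bonds rather than on polymers. With `z ^ |B|` inserted, `Ξ(z)` is a
polynomial. An induction that adds one bond at a time, in the manner of Dobrushin, shows that `Ξ`
has no zeros for `|z| < r`, where `r` is of order `1 / ε` and `ε` is the size of the factors, and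
provides an analytic logarithm bounded by `m` there (`setSum_bound`, `exists_log`). Its Taylor
coefficients are those of the formal logarithm, which are the sums of cluster terms of given order
(`iteratedDeriv_eq_logCoeff`, `sum_clusterCoeff`). Cauchy's estimates and a geometric series then
give a remainder of `m (const · ε) ^ (p + 1)`, and a priori bounds allow `ε` of order `q δ`. -/

namespace CoarseGrain

/-! ### Sums over subsets with local weights: nonvanishing and an analytic logarithm. -/

section SetExpansion

variable {ι : Type*} [DecidableEq ι]

/-- The sum of the weights `φ (A ∪ B)` over the subsets `B` of `Λ`. -/
noncomputable def setSum (φ : Finset ι → ℂ) (Λ A : Finset ι) : ℂ := ∑ B ∈ Λ.powerset, φ (A ∪ B)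

theorem setSum_insert (φ : Finset ι → ℂ) {Λ : Finset ι} {b : ι} (hb : b ∉ Λ) (A : Finset ι) :
    setSum φ (insert b Λ) A = setSum φ Λ A + setSum φ Λ (insert b A) := by
  unfold setSum
  rw [Finset.sum_powerset_insert hb]
  congr 1
  refine Finset.sum_congr rfl fun B _ => ?_
  congr 1
  ext x
  simp only [Finset.mem_union, Finset.mem_insert]
  tauto

/-- A weight on finite sets that factorizes over non-adjacent sets and is dominated by a product of
small one-element weights. -/
structure IsLocalWeight (adj : ι → ι → Prop) (y : ι → ℝ) (φ : Finset ι → ℂ) : Prop where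
  empty : φ ∅ = 1
  union : ∀ A B, (∀ a ∈ A, ∀ b ∈ B, ¬ adj a b) → φ (A ∪ B) = φ A * φ B
  norm_le : ∀ A, ‖φ A‖ ≤ ∏ b ∈ A, y b
  refl : ∀ b, adj b b
  nonneg : ∀ b, 0 ≤ y b

/-- The arithmetic that closes the induction of `setSum_bound`. After `exp (9 x) ≥ 1 + 9 x` it
remains to see `2 t + 9 x t ≤ 9 x`, and for `t ≥ 0` the left side is at most `3 t`. -/
theorem one_add_le_one_sub_mul_exp {x t : ℝ} (h0 : 0 ≤ x) (h1 : x ≤ 1 / 9) (ht : t ≤ 3 * x) :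
    1 + t ≤ (1 - t) * Real.exp (9 * x) := by
  have h2 := Real.add_one_le_exp (9 * x)
  have h3 : (1 - t) * (9 * x + 1) ≤ (1 - t) * Real.exp (9 * x) :=
    mul_le_mul_of_nonneg_left h2 (by linarith)
  nlinarith

open Classical in
/-- The total weight of the elements of `Λ` adjacent to `A`. -/
noncomputable def adjWeight (adj : ι → ι → Prop) (y : ι → ℝ) (Λ A : Finset ι) : ℝ :=
  ∑ b ∈ Λ with ∃ a ∈ A, adj a b, y b

-- Nonvanishing and the ratio bound support each other in one induction on `Λ`. Forcing `A` costs
-- its one-element weights, and the exponential pays only for the elements of `Λ` adjacent to `A`: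
-- these can be split off one by one, and once none is left `φ` factorizes. The numbers fit because
-- `9 * (1 / 9) = 1` and `exp 1 ≤ 3`.
open Classical in
theorem IsLocalWeight.setSum_bound {adj : ι → ι → Prop} {y : ι → ℝ} {φ : Finset ι → ℂ}
    (h : IsLocalWeight adj y φ) (hsmall : ∀ b Λ, adjWeight adj y Λ {b} ≤ 1 / 9) (n : ℕ) :
    ∀ Λ : Finset ι, Λ.card = n → setSum φ Λ ∅ ≠ 0 ∧ ∀ A, Disjoint A Λ →
      ‖setSum φ Λ A‖ ≤ (∏ b ∈ A, y b) * Real.exp (9 * adjWeight adj y Λ A) * ‖setSum φ Λ ∅‖ := by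
  have hy (b : ι) : y b ≤ 1 / 9 := by
    have := hsmall b {b}
    simpa [adjWeight, Finset.filter_singleton, h.refl] using this
  induction n with
  | zero =>
    intro Λ hΛ
    obtain rfl := Finset.card_eq_zero.1 hΛ
    simp only [setSum, Finset.powerset_empty, Finset.sum_singleton, Finset.union_empty, h.empty]
    refine ⟨one_ne_zero, fun A _ => ?_⟩
    simpa [adjWeight] using h.norm_le A
  | succ n ih =>
    intro Λ hΛ
    -- Restoring `b` perturbs the sum by a relative amount of at most `exp 1 * y b ≤ 1 / 3`. Hence
    -- the sum stays nonzero and is comparable with the sum without `b`.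
    have key : ∀ b ∈ Λ, setSum φ Λ ∅ = setSum φ (Λ.erase b) ∅ + setSum φ (Λ.erase b) {b} ∧
        ‖setSum φ (Λ.erase b) {b}‖ ≤ y b * Real.exp 1 * ‖setSum φ (Λ.erase b) ∅‖ := by
      intro b hb
      constructor
      · conv_lhs => rw [← Finset.insert_erase hb]
        rw [setSum_insert φ (Finset.notMem_erase b Λ)]
        rfl
      · have := (ih (Λ.erase b) (by rw [Finset.card_erase_of_mem hb, hΛ]; rfl)).2 {b} (by simp)
        rw [Finset.prod_singleton] at this
        refine this.trans ?_
        have h1 : 9 * adjWeight adj y (Λ.erase b) {b} ≤ 1 := by linarith [hsmall b (Λ.erase b)]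
        have := h.nonneg b
        gcongr
    have he : Real.exp 1 ≤ 3 := by linarith [Real.exp_one_lt_d9]
    have lower : ∀ b ∈ Λ, (1 - y b * Real.exp 1) * ‖setSum φ (Λ.erase b) ∅‖ ≤ ‖setSum φ Λ ∅‖ := by
      intro b hb
      obtain ⟨h1, h2⟩ := key b hb
      have h3 := norm_sub_le_norm_add (setSum φ (Λ.erase b) ∅) (setSum φ (Λ.erase b) {b})
      rw [← h1] at h3
      linarith
    refine ⟨?_, fun A hA => ?_⟩
    · obtain ⟨b, hb⟩ := Finset.card_pos.1 (by omega : 0 < Λ.card)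
      have h1 := (ih (Λ.erase b) (by rw [Finset.card_erase_of_mem hb, hΛ]; rfl)).1
      have h2 : 0 < 1 - y b * Real.exp 1 := by nlinarith [hy b, h.nonneg b]
      exact norm_pos_iff.1 ((mul_pos h2 (norm_pos_iff.2 h1)).trans_le (lower b hb))
    -- If some `b` in `Λ` is adjacent to `A`, remove it and apply the induction hypothesis to `A`
    -- and to `insert b A`. The weight `y b` leaves the adjacency weight of `A`, and the factor `exp
    -- (9 * y b)` so released absorbs both the extra term and the change of denominator.
    · by_cases hN : ∃ b ∈ Λ, ∃ a ∈ A, adj a b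
      · obtain ⟨b, hb, a, ha, hab⟩ := hN
        have hbA : b ∉ A := fun hbA => Finset.disjoint_left.1 hA hbA hb
        obtain ⟨ih1, ih2⟩ := ih (Λ.erase b) (by rw [Finset.card_erase_of_mem hb, hΛ]; rfl)
        have b1 := ih2 A (hA.mono_right (Finset.erase_subset _ _))
        have b2 := ih2 (insert b A) (by
          rw [Finset.disjoint_insert_left]
          exact ⟨Finset.notMem_erase b Λ, hA.mono_right (Finset.erase_subset _ _)⟩)
        rw [Finset.prod_insert hbA] at b2
        have w1 : adjWeight adj y Λ A = adjWeight adj y (Λ.erase b) A + y b := by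
          unfold adjWeight
          rw [Finset.filter_erase, Finset.sum_erase_add]
          exact Finset.mem_filter.2 ⟨hb, a, ha, hab⟩
        have w2 : adjWeight adj y (Λ.erase b) (insert b A)
            ≤ adjWeight adj y (Λ.erase b) A + adjWeight adj y (Λ.erase b) {b} := by
          unfold adjWeight
          rw [← Finset.sum_union_inter]
          refine le_trans (Finset.sum_le_sum_of_subset_of_nonneg ?_ fun _ _ _ => h.nonneg _)
            (le_add_of_nonneg_right (Finset.sum_nonneg fun _ _ => h.nonneg _))
          intro x hx
          simp only [Finset.mem_filter, Finset.mem_union, Finset.mem_insert,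
            Finset.mem_singleton, exists_eq_left, exists_eq_or_imp] at hx ⊢
          exact hx.2.elim (fun h' => Or.inr ⟨hx.1, h'⟩) fun h' => Or.inl ⟨hx.1, h'⟩
        have w3 := hsmall b (Λ.erase b)
        set P := ∏ b ∈ A, y b with hP
        have hP0 : 0 ≤ P := Finset.prod_nonneg fun _ _ => h.nonneg _
        set E := Real.exp (9 * adjWeight adj y (Λ.erase b) A) with hE
        have b3 : Real.exp (9 * adjWeight adj y (Λ.erase b) (insert b A)) ≤ E * Real.exp 1 := by
          rw [hE, ← Real.exp_add]
          exact Real.exp_le_exp.2 (by linarith)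
        have hsplit : setSum φ Λ A
            = setSum φ (Λ.erase b) A + setSum φ (Λ.erase b) (insert b A) := by
          conv_lhs => rw [← Finset.insert_erase hb]
          exact setSum_insert φ (Finset.notMem_erase b Λ) A
        have hE2 : Real.exp (9 * adjWeight adj y Λ A) = E * Real.exp (9 * y b) := by
          rw [hE, ← Real.exp_add, w1]; ring_nf
        have hyb := h.nonneg b
        have hX := norm_nonneg (setSum φ (Λ.erase b) ∅)
        have hE0 : 0 ≤ E := (Real.exp_pos _).le
        have hb2 : ‖setSum φ (Λ.erase b) (insert b A)‖
            ≤ y b * P * (E * Real.exp 1) * ‖setSum φ (Λ.erase b) ∅‖ :=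
          b2.trans (by gcongr)
        have hstep := one_add_le_one_sub_mul_exp hyb (hy b) (t := y b * Real.exp 1) (by nlinarith)
        have hPE : 0 ≤ P * E * ‖setSum φ (Λ.erase b) ∅‖ := by positivity
        calc ‖setSum φ Λ A‖ ≤ P * E * ‖setSum φ (Λ.erase b) ∅‖
              + y b * P * (E * Real.exp 1) * ‖setSum φ (Λ.erase b) ∅‖ := by
              rw [hsplit]; exact (norm_add_le _ _).trans (add_le_add b1 hb2)
          _ = P * E * ‖setSum φ (Λ.erase b) ∅‖ * (1 + y b * Real.exp 1) := by ring
          _ ≤ P * E * ‖setSum φ (Λ.erase b) ∅‖ *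
                ((1 - y b * Real.exp 1) * Real.exp (9 * y b)) :=
              mul_le_mul_of_nonneg_left hstep hPE
          _ = P * (E * Real.exp (9 * y b)) *
                ((1 - y b * Real.exp 1) * ‖setSum φ (Λ.erase b) ∅‖) := by ring
          _ ≤ P * (E * Real.exp (9 * y b)) * ‖setSum φ Λ ∅‖ :=
              mul_le_mul_of_nonneg_left (lower b hb) (by positivity)
          _ = _ := by rw [hE2]
      · have hfac : setSum φ Λ A = φ A * setSum φ Λ ∅ := by
          unfold setSum
          rw [Finset.mul_sum]
          refine Finset.sum_congr rfl fun B hB => ?_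
          rw [Finset.empty_union]
          refine h.union A B fun a ha b hb hab => hN ⟨b, ?_, a, ha, hab⟩
          exact Finset.mem_powerset.1 hB hb
        rw [hfac, norm_mul]
        have h1 : 1 ≤ Real.exp (9 * adjWeight adj y Λ A) := by
          rw [Real.one_le_exp_iff]
          exact mul_nonneg (by norm_num) (Finset.sum_nonneg fun _ _ => h.nonneg _)
        have h2 : 0 ≤ ∏ b ∈ A, y b := Finset.prod_nonneg fun _ _ => h.nonneg _
        refine mul_le_mul_of_nonneg_right ?_ (norm_nonneg _)
        exact (h.norm_le A).trans (le_mul_of_one_le_right h2 h1)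

theorem IsLocalWeight.setSum_ne_zero {adj : ι → ι → Prop} {y : ι → ℝ} {φ : Finset ι → ℂ}
    (h : IsLocalWeight adj y φ) (hsmall : ∀ b Λ, adjWeight adj y Λ {b} ≤ 1 / 9) (Λ : Finset ι) :
    setSum φ Λ ∅ ≠ 0 :=
  (h.setSum_bound hsmall _ Λ rfl).1

theorem IsLocalWeight.norm_ratio_le {adj : ι → ι → Prop} {y : ι → ℝ} {φ : Finset ι → ℂ}
    (h : IsLocalWeight adj y φ) (hsmall : ∀ b Λ, adjWeight adj y Λ {b} ≤ 1 / 9)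
    {Λ : Finset ι} {b : ι} (hb : b ∉ Λ) :
    ‖setSum φ Λ {b} / setSum φ Λ ∅‖ ≤ 3 * y b := by
  have h1 := (h.setSum_bound hsmall _ Λ rfl).2 {b} (by simpa using hb)
  rw [norm_div, div_le_iff₀ (norm_pos_iff.2 (h.setSum_ne_zero hsmall Λ))]
  refine h1.trans (mul_le_mul_of_nonneg_right ?_ (norm_nonneg _))
  rw [Finset.prod_singleton, mul_comm]
  refine mul_le_mul_of_nonneg_right ?_ (h.nonneg b)
  have h2 : Real.exp (9 * adjWeight adj y Λ {b}) ≤ Real.exp 1 :=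
    Real.exp_le_exp.2 (by linarith [hsmall b Λ])
  linarith [Real.exp_one_lt_d9]

theorem IsLocalWeight.le_one_ninth {adj : ι → ι → Prop} {y : ι → ℝ} {φ : Finset ι → ℂ}
    (h : IsLocalWeight adj y φ) (hsmall : ∀ b Λ, adjWeight adj y Λ {b} ≤ 1 / 9) (b : ι) :
    y b ≤ 1 / 9 := by
  classical
  have := hsmall b {b}
  simpa [adjWeight, Finset.filter_singleton, h.refl] using this

/-- The weight with a factor `z` for every element. -/
noncomputable def scaleWeight (φ : Finset ι → ℂ) (z : ℂ) : Finset ι → ℂ :=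
  fun A => z ^ A.card * φ A

/-- A complex coupling `z` per element only rescales the one-element weights, so smallness at radius
`r` controls the whole disc at once. -/
theorem IsLocalWeight.scale {adj : ι → ι → Prop} {y : ι → ℝ} {φ : Finset ι → ℂ}
    (h : IsLocalWeight adj y φ) {r : ℝ} {z : ℂ} (hz : ‖z‖ ≤ r) :
    IsLocalWeight adj (fun b => r * y b) (scaleWeight φ z) where
  empty := by simp [scaleWeight, h.empty]
  union A B hAB := by
    have hd : Disjoint A B :=
      Finset.disjoint_left.2 fun x hx hx' => hAB x hx x hx' (h.refl x)
    simp only [scaleWeight]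
    rw [h.union A B hAB, Finset.card_union_of_disjoint hd, pow_add]
    ring
  norm_le A := by
    simp only [scaleWeight, norm_mul, norm_pow]
    rw [Finset.prod_mul_distrib, Finset.prod_const]
    exact mul_le_mul (pow_le_pow_left₀ (norm_nonneg z) hz _) (h.norm_le A) (norm_nonneg _)
      (pow_nonneg ((norm_nonneg z).trans hz) _)
  refl := h.refl
  nonneg b := mul_nonneg ((norm_nonneg z).trans hz) (h.nonneg b)

theorem differentiable_setSum_scaleWeight (φ : Finset ι → ℂ) (Λ A : Finset ι) :
    Differentiable ℂ fun z => setSum (scaleWeight φ z) Λ A := by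
  unfold setSum scaleWeight
  fun_prop

/-- An analytic logarithm of the sum over subsets, with a bound proportional to the total
weight. -/
theorem IsLocalWeight.exists_log {adj : ι → ι → Prop} {y : ι → ℝ} {φ : Finset ι → ℂ}
    (h : IsLocalWeight adj y φ) {r : ℝ} (hr : 0 < r)
    (hsmall : ∀ b Λ, adjWeight adj (fun b => r * y b) Λ {b} ≤ 1 / 9) (Λ : Finset ι) :
    ∃ F : ℂ → ℂ, DifferentiableOn ℂ F (Metric.ball 0 r) ∧ F 0 = 0 ∧
      ∀ z ∈ Metric.ball (0 : ℂ) r, Complex.exp (F z) = setSum (scaleWeight φ z) Λ ∅ ∧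
        ‖F z‖ ≤ ∑ b ∈ Λ, 9 / 2 * (r * y b) := by
  induction Λ using Finset.induction_on with
  | empty =>
    refine ⟨fun _ => 0, differentiableOn_const _, rfl, fun z _ => ?_⟩
    simp [setSum, scaleWeight, h.empty]
  | insert b Λ hb ih =>
    obtain ⟨F, hF, hF0, hFz⟩ := ih
    -- Adding `b` multiplies the sum by `1 + ρ` with `‖ρ‖ ≤ 1 / 3`. The logarithm is therefore built
    -- as a sum of principal logarithms, and no choice of branch arises.
    set ρ : ℂ → ℂ := fun z => setSum (scaleWeight φ z) Λ {b} / setSum (scaleWeight φ z) Λ ∅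
    have hloc {z : ℂ} (hz : z ∈ Metric.ball (0 : ℂ) r) :=
      h.scale (r := r) (z := z) (by simpa using (mem_ball_zero_iff.1 hz).le)
    have hρ : ∀ z ∈ Metric.ball (0 : ℂ) r, ‖ρ z‖ ≤ 3 * (r * y b) := fun z hz =>
      (hloc hz).norm_ratio_le hsmall hb
    have hyb : r * y b ≤ 1 / 9 := (hloc (Metric.mem_ball_self hr)).le_one_ninth hsmall b
    have hne : ∀ z ∈ Metric.ball (0 : ℂ) r, setSum (scaleWeight φ z) Λ ∅ ≠ 0 := fun z hz =>
      (hloc hz).setSum_ne_zero hsmall Λ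
    have hslit : ∀ z ∈ Metric.ball (0 : ℂ) r, 1 + ρ z ∈ Complex.slitPlane := fun z hz =>
      Complex.mem_slitPlane_of_norm_lt_one (by linarith [hρ z hz])
    refine ⟨fun z => F z + Complex.log (1 + ρ z), ?_, ?_, fun z hz => ⟨?_, ?_⟩⟩
    · refine hF.add (DifferentiableOn.clog ?_ hslit)
      refine DifferentiableOn.const_add _ (DifferentiableOn.fun_div ?_ ?_ hne)
      · exact (differentiable_setSum_scaleWeight φ Λ {b}).differentiableOn
      · exact (differentiable_setSum_scaleWeight φ Λ ∅).differentiableOn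
    · have : ρ 0 = 0 := by
        have : setSum (scaleWeight φ 0) Λ {b} = 0 := by
          refine Finset.sum_eq_zero fun B _ => ?_
          simp [scaleWeight]
        simp [ρ, this]
      simp [hF0, this]
    · rw [Complex.exp_add, (hFz z hz).1, Complex.exp_log (Complex.slitPlane_ne_zero (hslit z hz)),
        setSum_insert _ hb, mul_add, mul_one, mul_div_cancel₀ _ (hne z hz)]
      rfl
    · rw [Finset.sum_insert hb, add_comm]
      refine (norm_add_le _ _).trans (add_le_add (hFz z hz).2 ?_) |>.trans (by rw [add_comm])
      -- The constant `9 / 2` is `3 / 2`, from `‖log (1 + w)‖ ≤ 3 / 2 * ‖w‖`, times the `3` of the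
      -- ratio bound.
      refine (Complex.norm_log_one_add_half_le_self (by linarith [hρ z hz])).trans ?_
      linarith [hρ z hz]

end SetExpansion

/-! ### The formal logarithm of a polynomial against its analytic logarithm; remainder estimates. -/

section FormalLogarithm

open Polynomial Filter Topology

/-- The truncation of the formal logarithm of a polynomial with constant coefficient `1`. -/
noncomputable def logTrunc (P : ℝ[X]) (j : ℕ) : ℝ[X] :=
  ∑ n ∈ Finset.Icc 1 j, C ((-1 : ℝ) ^ (n + 1) / n) * (P - 1) ^ n

/-- The `j`-th coefficient of the formal logarithm of a polynomial with constant
coefficient `1`. -/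
noncomputable def logCoeff (P : ℝ[X]) (j : ℕ) : ℝ := (logTrunc P j).coeff j

theorem aeval_logTrunc (P : ℝ[X]) (j : ℕ) (z : ℂ) :
    aeval z (logTrunc P j) = Complex.logTaylor (j + 1) (aeval z P - 1) := by
  unfold logTrunc Complex.logTaylor
  -- The term `n = 0` of `Complex.logTaylor` is a division by zero, hence `0`; this matches a sum
  -- starting at `1`.
  rw [Finset.range_eq_Ico, Finset.sum_eq_sum_Ico_succ_bot (Nat.succ_pos j)]
  simp only [map_sum, map_mul, aeval_C, map_pow, map_sub, map_one]
  rw [show Finset.Icc 1 j = Finset.Ico (0 + 1) (j + 1) by ext; simp]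
  simp only [Nat.cast_zero, div_zero, zero_add]
  refine Finset.sum_congr rfl fun n _ => ?_
  simp only [Complex.coe_algebraMap]
  push_cast
  ring

theorem iteratedDeriv_aeval (Q : ℝ[X]) (j : ℕ) :
    iteratedDeriv j (fun z : ℂ => aeval z Q) 0 = (j.factorial : ℂ) * (Q.coeff j : ℂ) := by
  have h : ∀ (j : ℕ), iteratedDeriv j (fun z : ℂ => aeval z Q)
      = fun z : ℂ => aeval z (derivative^[j] Q) := by
    intro j
    induction j with
    | zero => simp [iteratedDeriv_zero]
    | succ j ih =>
      rw [iteratedDeriv_succ, ih]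
      funext z
      rw [Polynomial.deriv_aeval, Function.iterate_succ_apply']
  rw [h]
  simp only [aeval_def, eval₂_at_zero, coeff_iterate_derivative, zero_add,
    Nat.descFactorial_self]
  simp

/-- If `exp F` is a polynomial with `F 0 = 0`, the Taylor coefficients of `F` are those of the formal
logarithm. -/
theorem iteratedDeriv_eq_logCoeff {P : ℝ[X]} {F : ℂ → ℂ} {r : ℝ} (hr : 0 < r)
    (hF : DifferentiableOn ℂ F (Metric.ball 0 r)) (hF0 : F 0 = 0)
    (hexp : ∀ z ∈ Metric.ball (0 : ℂ) r, Complex.exp (F z) = aeval z P) (j : ℕ) :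
    iteratedDeriv j F 0 = (j.factorial : ℂ) * (logCoeff P j : ℂ) := by
  set Q := logTrunc P j with hQ
  have hball : Metric.ball (0 : ℂ) r ∈ 𝓝 (0 : ℂ) := Metric.ball_mem_nhds _ hr
  have hFan : AnalyticAt ℂ F 0 := hF.analyticAt hball
  have hQan : AnalyticAt ℂ (fun z : ℂ => aeval z Q) 0 :=
    Q.differentiable_aeval.analyticAt 0
  have hP0 : P.coeff 0 = 1 := by
    have := hexp 0 (Metric.mem_ball_self hr)
    rw [hF0, Complex.exp_zero, aeval_def, eval₂_at_zero] at this
    simpa using (Complex.ofReal_injective (by simpa using this.symm))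
  -- Divisibility gives `P - 1 = O(z)`. Cutting the logarithmic series after the power `j` thus
  -- costs only `O(z ^ (j + 1))`, which cannot affect the coefficient of order `j`.
  obtain ⟨P₁, hP₁⟩ : X ∣ P - 1 := by
    rw [X_dvd_iff]; simp [hP0]
  have hcontF : Tendsto (fun z => ‖F z‖) (𝓝 0) (𝓝 0) := by
    have := hFan.continuousAt.norm.tendsto
    simpa [hF0] using this
  have hP₁c : Tendsto (fun z : ℂ => ‖aeval z P₁‖) (𝓝 0) (𝓝 ‖aeval (0 : ℂ) P₁‖) :=
    (P₁.continuous_aeval (A := ℂ)).norm.tendsto 0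
  have hPc : Tendsto (fun z : ℂ => ‖aeval z P - 1‖) (𝓝 0) (𝓝 0) := by
    have : Continuous fun z : ℂ => ‖aeval z P - 1‖ :=
      ((P.continuous_aeval (A := ℂ)).sub continuous_const).norm
    have h := this.tendsto 0
    have h0 : aeval (0 : ℂ) P = 1 := by
      rw [← hexp 0 (Metric.mem_ball_self hr), hF0, Complex.exp_zero]
    simpa [h0] using h
  set B := ‖aeval (0 : ℂ) P₁‖ + 1 with hB
  have hev : ∀ᶠ z : ℂ in 𝓝 0, ‖F z - aeval z Q‖ ≤ 2 * B ^ (j + 1) * ‖z‖ ^ (j + 1) := by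
    filter_upwards [hball, hcontF.eventually_lt_const (show (0 : ℝ) < 1 by norm_num),
      hP₁c.eventually_lt_const (show ‖aeval (0 : ℂ) P₁‖ < B by linarith),
      hPc.eventually_lt_const (show (0 : ℝ) < 1 / 2 by norm_num)] with z h1 h2 h3 h4
    -- Near `0` one has `‖F z‖ < 1 < π`, so `F` is the principal logarithm of `P` there.
    have hlog : F z = Complex.log (1 + (aeval z P - 1)) := by
      rw [add_sub_cancel, ← hexp z h1, Complex.log_exp]
      · linarith [abs_le.1 (Complex.abs_im_le_norm (F z)), Real.pi_gt_three]
      · linarith [abs_le.1 (Complex.abs_im_le_norm (F z)), Real.pi_gt_three]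
    rw [hQ, aeval_logTrunc, hlog]
    refine (Complex.norm_log_sub_logTaylor_le j (by linarith)).trans ?_
    have hw : ‖aeval z P - 1‖ ≤ B * ‖z‖ := by
      have : aeval z P - 1 = z * aeval z P₁ := by
        have := congrArg (aeval z) hP₁
        simpa using this
      rw [this, norm_mul, mul_comm]
      gcongr
    have hinv : (1 - ‖aeval z P - 1‖)⁻¹ ≤ 2 := by
      rw [inv_le_comm₀ (by linarith) (by norm_num)]; linarith
    have hB0 : 0 ≤ B := by positivity
    have hinv0 : 0 ≤ (1 - ‖aeval z P - 1‖)⁻¹ := inv_nonneg.2 (by linarith)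
    calc ‖aeval z P - 1‖ ^ (j + 1) * (1 - ‖aeval z P - 1‖)⁻¹ / (j + 1)
        ≤ ‖aeval z P - 1‖ ^ (j + 1) * (1 - ‖aeval z P - 1‖)⁻¹ := by
          apply div_le_self
          · exact mul_nonneg (by positivity) (inv_nonneg.2 (by linarith))
          · linarith [(Nat.cast_nonneg j : (0 : ℝ) ≤ j)]
      _ ≤ (B * ‖z‖) ^ (j + 1) * 2 := by gcongr
      _ = _ := by rw [mul_pow]; ring
  obtain ⟨ε, hε, hεb⟩ := Metric.eventually_nhds_iff_ball.1 hev
  -- Cauchy's estimate on a circle of radius `ρ` bounds this derivative by a constant times `ρ ^ (j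
  -- + 1) / ρ ^ j = ρ`, and `ρ` tends to `0`.
  have hdiff : iteratedDeriv j (fun z => F z - aeval z Q) 0 = 0 := by
    have hest : ∀ ρ : ℝ, 0 < ρ → ρ < min ε r →
        ‖iteratedDeriv j (fun z => F z - aeval z Q) 0‖
          ≤ j.factorial * (2 * B ^ (j + 1)) * ρ := by
      intro ρ hρ hρ2
      have hd : DiffContOnCl ℂ (fun z => F z - aeval z Q) (Metric.ball 0 ρ) := by
        refine DifferentiableOn.diffContOnCl ?_
        rw [closure_ball _ hρ.ne']
        refine DifferentiableOn.sub (hF.mono ?_) ?_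
        · exact Metric.closedBall_subset_ball (hρ2.trans_le (min_le_right _ _))
        · exact (Q.differentiable_aeval).differentiableOn
      have := Complex.norm_iteratedDeriv_le_of_forall_mem_sphere_norm_le
        (C := 2 * B ^ (j + 1) * ρ ^ (j + 1)) j hρ hd (fun z hz => by
          have hzn : ‖z‖ = ρ := by simpa using hz
          have := hεb z (by
            rw [mem_ball_zero_iff, hzn]; exact hρ2.trans_le (min_le_left _ _))
          rwa [hzn] at this)
      refine this.trans (le_of_eq ?_)
      rw [pow_succ ρ j]
      field_simp
    refine norm_le_zero_iff.1 ?_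
    have hlim : Tendsto (fun ρ : ℝ => j.factorial * (2 * B ^ (j + 1)) * ρ) (𝓝[>] 0)
        (𝓝 (j.factorial * (2 * B ^ (j + 1)) * 0)) :=
      (Continuous.tendsto (by fun_prop) 0).mono_left nhdsWithin_le_nhds
    rw [mul_zero] at hlim
    refine ge_of_tendsto hlim ?_
    filter_upwards [Ioo_mem_nhdsGT (show (0 : ℝ) < min ε r from lt_min hε hr)] with ρ hρ
    exact hest ρ hρ.1 hρ.2
  have hsub := iteratedDeriv_fun_sub (n := j) hFan.contDiffAt hQan.contDiffAt
  rw [hdiff, iteratedDeriv_aeval] at hsub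
  rw [← sub_eq_zero, logCoeff]
  exact hsub.symm

/-- Convergence of the formal logarithm at `1`, with Cauchy bounds for the coefficients. -/
theorem logCoeff_bound_and_hasSum {P : ℝ[X]} {F : ℂ → ℂ} {r K : ℝ} (hr : 1 < r)
    (hF : DifferentiableOn ℂ F (Metric.ball 0 r)) (hF0 : F 0 = 0)
    (hexp : ∀ z ∈ Metric.ball (0 : ℂ) r, Complex.exp (F z) = aeval z P)
    (hK : ∀ z ∈ Metric.ball (0 : ℂ) r, ‖F z‖ ≤ K) :
    (∀ j, |logCoeff P j| ≤ K / r ^ j) ∧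
      HasSum (fun j => logCoeff P (j + 1)) (Real.log (P.eval 1)) := by
  have hr0 : 0 < r := by linarith
  have hd := iteratedDeriv_eq_logCoeff hr0 hF hF0 hexp
  constructor
  · intro j
    have hest : ∀ ρ : ℝ, 0 < ρ → ρ < r → |logCoeff P j| ≤ K / ρ ^ j := by
      intro ρ hρ hρr
      have hdc : DiffContOnCl ℂ F (Metric.ball 0 ρ) := by
        refine DifferentiableOn.diffContOnCl ?_
        rw [closure_ball _ hρ.ne']
        exact hF.mono (Metric.closedBall_subset_ball hρr)
      have := Complex.norm_iteratedDeriv_le_of_forall_mem_sphere_norm_le (C := K) j hρ hdc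
        (fun z hz => hK z (by
          have hzn : ‖z‖ = ρ := by simpa using hz
          rwa [mem_ball_zero_iff, hzn]))
      rw [hd, norm_mul, Complex.norm_natCast, Complex.norm_real, Real.norm_eq_abs, mul_div_assoc]
        at this
      exact le_of_mul_le_mul_left this (by positivity)
    -- `F` is controlled only on the open disc, so Cauchy's estimate is used for `ρ < r` and passed
    -- to the limit.
    have hlim : Tendsto (fun ρ : ℝ => K / ρ ^ j) (𝓝[<] r) (𝓝 (K / r ^ j)) := by
      refine Tendsto.mono_left ?_ nhdsWithin_le_nhds
      exact ContinuousAt.tendsto (by fun_prop (disch := positivity))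
    refine ge_of_tendsto hlim ?_
    filter_upwards [Ioo_mem_nhdsLT hr0] with ρ hρ
    exact hest ρ hρ.1 hρ.2
  · have h1 : (1 : ℂ) ∈ Metric.ball (0 : ℂ) r := by simpa using hr
    have hs := Complex.hasSum_taylorSeries_on_ball hF h1
    have hs' : HasSum (fun j => ((logCoeff P j : ℝ) : ℂ)) (F 1) := by
      refine hs.congr_fun ?_
      intro n
      rw [hd]
      have : (n.factorial : ℂ) ≠ 0 := by exact_mod_cast n.factorial_ne_zero
      simp [this]
    have hre : HasSum (fun j => logCoeff P j) (F 1).re := by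
      simpa using Complex.hasSum_re hs'
    -- The coefficients are real, so `F 1` is real and equals the real logarithm of `P.eval 1`.
    have hF1 : F 1 = ((F 1).re : ℂ) := hs'.unique (Complex.hasSum_ofReal.2 hre)
    have hval : Real.log (P.eval 1) = (F 1).re := by
      have h2 := hexp 1 h1
      rw [hF1, ← Complex.ofReal_exp] at h2
      have h3 : aeval (1 : ℂ) P = ((P.eval 1 : ℝ) : ℂ) := by
        have := Polynomial.aeval_algebraMap_apply ℂ (1 : ℝ) P
        simpa using this
      rw [h3] at h2
      rw [← Complex.ofReal_injective h2, Real.log_exp]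
    rw [hval]
    -- The coefficient of order `0` is an empty sum, so the series may start at order `1`.
    simpa [logCoeff, logTrunc] using (hasSum_nat_add_iff' 1).2 hre

/-- Comparison with a geometric series of ratio `1 / r ≤ 1 / 2`. Its factor `(1 - 1 / r)⁻¹ ≤ 2` is
absorbed as `2 ≤ 2 ^ (p + 1)`, whence the power of `2 / r`. -/
theorem tail_bound {a : ℕ → ℝ} {s K r : ℝ} (hr : 2 ≤ r) (hK : 0 ≤ K)
    (ha : ∀ j, |a j| ≤ K / r ^ j) (hs : HasSum (fun j => a (j + 1)) s) (p : ℕ) :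
    |s - ∑ j ∈ Finset.Icc 1 p, a j| ≤ K * (2 / r) ^ (p + 1) := by
  have hr0 : 0 < r := by linarith
  have h1 : HasSum (fun j => a (j + p + 1)) (s - ∑ j ∈ Finset.Icc 1 p, a j) := by
    have h := (hasSum_nat_add_iff' p).2 hs
    have h2 : ∑ j ∈ Finset.Icc 1 p, a j = ∑ i ∈ Finset.range p, a (i + 1) := by
      rw [Finset.range_eq_Ico, Finset.sum_Ico_add' a 0 p 1]
      exact Finset.sum_congr (by ext; simp) fun _ _ => rfl
    rw [h2]
    exact h
  have hg : HasSum (fun j : ℕ => K * (1 / r) ^ (p + 1) * (1 / r) ^ j)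
      (K * (1 / r) ^ (p + 1) * (1 - 1 / r)⁻¹) :=
    (hasSum_geometric_of_lt_one (by positivity)
      (by rw [div_lt_one hr0]; linarith)).mul_left _
  have hle : ∀ j, ‖a (j + p + 1)‖ ≤ K * (1 / r) ^ (p + 1) * (1 / r) ^ j := by
    intro j
    refine (ha _).trans (le_of_eq ?_)
    rw [mul_assoc, ← pow_add, one_div, inv_pow, div_eq_mul_inv]
    ring_nf
  have h3 := tsum_of_norm_bounded hg hle
  rw [h1.tsum_eq, Real.norm_eq_abs] at h3
  refine h3.trans ?_
  have h4 : (1 - 1 / r)⁻¹ ≤ 2 := by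
    have : 1 / r ≤ 1 / 2 := one_div_le_one_div_of_le (by norm_num) hr
    rw [inv_le_comm₀ (by linarith) (by norm_num)]; linarith
  calc K * (1 / r) ^ (p + 1) * (1 - 1 / r)⁻¹ ≤ K * (1 / r) ^ (p + 1) * 2 := by gcongr
    _ ≤ K * (1 / r) ^ (p + 1) * 2 ^ (p + 1) := by
        gcongr
        exact le_self_pow₀ (by norm_num) (by omega)
    _ = _ := by rw [mul_assoc, ← mul_pow]; congr 2; ring

end FormalLogarithm

/-! ### From sets of bonds to families of compatible polymers, and cluster coefficients. -/

section Polymers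

open Polynomial

variable {m : ℕ}

/-- Two bonds are adjacent if their supports intersect. -/
def bondAdj (b b' : Bond m) : Prop := ¬ Disjoint (bondSupport b) (bondSupport b')

theorem corridor_nonempty (k : ZMod m) : k ∈ corridor k := by
  unfold corridor; split_ifs <;> simp

theorem bondSupport_nonempty (b : Bond m) : (bondSupport b).Nonempty := by
  rcases b with k | e
  · exact ⟨_, Finset.mem_insert_self _ _⟩
  · exact ⟨e.1.1, Finset.mem_union_left _ (corridor_nonempty _)⟩

theorem bondAdj_refl (b : Bond m) : bondAdj b b := by
  simp [bondAdj, (bondSupport_nonempty b).ne_empty]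

/-- Adjacency inside a set of bonds. -/
def adjIn (R : Finset (Bond m)) (x y : Bond m) : Prop :=
  x ∈ R ∧ y ∈ R ∧ ¬ Disjoint (bondSupport x) (bondSupport y)

theorem adjIn_symm {R : Finset (Bond m)} {x y : Bond m} (h : adjIn R x y) : adjIn R y x :=
  ⟨h.2.1, h.1, fun h' => h.2.2 h'.symm⟩

theorem chain_symm {R : Finset (Bond m)} {x y : Bond m}
    (h : Relation.ReflTransGen (adjIn R) x y) : Relation.ReflTransGen (adjIn R) y x := by
  induction h with
  | refl => exact .refl
  | tail _ h2 ih => exact .head (adjIn_symm h2) ih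

/-- Pairwise compatibility of a family of polymers. -/
def Compatible (G : Finset (Polymer m)) : Prop :=
  ∀ R ∈ G, ∀ R' ∈ G, R ≠ R' → Disjoint (polymerSupport R) (polymerSupport R')

theorem Compatible.eq_of_adj {G : Finset (Polymer m)} (hG : Compatible G) {R R' : Polymer m}
    (hR : R ∈ G) (hR' : R' ∈ G) {x y : Bond m} (hx : x ∈ R.1) (hy : y ∈ R'.1)
    (hxy : bondAdj x y) : R = R' := by
  by_contra hne
  refine hxy ((hG R hR R' hR' hne).mono ?_ ?_)
  · exact Finset.subset_biUnion_of_mem bondSupport hx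
  · exact Finset.subset_biUnion_of_mem bondSupport hy

/-- The set of all bonds of a family of polymers. -/
def bondUnion (G : Finset (Polymer m)) : Finset (Bond m) := G.biUnion fun R => R.1

/-- Adjacent bonds cannot belong to two different members of a compatible family, so a chain inside
the union never leaves the polymer where it starts. -/
theorem mem_of_chain {G : Finset (Polymer m)} (hG : Compatible G) {R' : Polymer m} (hR' : R' ∈ G)
    {A : Finset (Bond m)} (hA : A ⊆ bondUnion G) {x y : Bond m} (hx : x ∈ R'.1)
    (h : Relation.ReflTransGen (adjIn A) x y) : y ∈ R'.1 := by
  induction h with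
  | refl => exact hx
  | tail _ h2 ih =>
    obtain ⟨R'', hR'', hy⟩ := Finset.mem_biUnion.1 (hA h2.2.1)
    rw [hG.eq_of_adj hR' hR'' ih hy h2.2.2]
    exact hy

/-- The members of a compatible family are the connected components of its union, so the union
determines the family. -/
theorem bondUnion_injOn {G G' : Finset (Polymer m)} (hG : Compatible G) (hG' : Compatible G')
    (h : bondUnion G = bondUnion G') : G ⊆ G' := by
  intro R hR
  obtain ⟨b, hb⟩ := R.2.1
  have hbU : b ∈ bondUnion G' := h ▸ Finset.mem_biUnion.2 ⟨R, hR, hb⟩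
  obtain ⟨R', hR', hb'⟩ := Finset.mem_biUnion.1 hbU
  have hsub : R.1 ⊆ bondUnion G := Finset.subset_biUnion_of_mem (fun R : Polymer m => R.1) hR
  have hsub' : R'.1 ⊆ bondUnion G' := Finset.subset_biUnion_of_mem (fun R : Polymer m => R.1) hR'
  have : R = R' := by
    apply Subtype.ext
    apply Finset.Subset.antisymm
    · intro x hx
      exact mem_of_chain hG' hR' (h ▸ hsub) hb' (R.2.2 b hb x hx)
    · intro x hx
      exact mem_of_chain hG hR (h.symm ▸ hsub') hb (R'.2.2 b hb' x hx)
  rwa [this]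

open Classical in
/-- The connected component of a bond in a set of bonds. -/
noncomputable def component (B : Finset (Bond m)) (b : Bond m) : Finset (Bond m) :=
  B.filter fun b' => Relation.ReflTransGen (adjIn B) b b'

/-- A chain in `B` starting at `b` visits only bonds reachable from `b`, so it is already a chain in
the component. -/
theorem isPolymer_component {B : Finset (Bond m)} {b : Bond m} (hb : b ∈ B) :
    IsPolymer (component B b) := by
  classical
  refine ⟨⟨b, Finset.mem_filter.2 ⟨hb, .refl⟩⟩, ?_⟩
  have key : ∀ x, Relation.ReflTransGen (adjIn B) b x →
      Relation.ReflTransGen (adjIn (component B b)) b x := by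
    intro x hx
    induction hx with
    | refl => exact .refl
    | @tail y z hy hz ih =>
      exact ih.tail ⟨Finset.mem_filter.2 ⟨hz.1, hy⟩, Finset.mem_filter.2 ⟨hz.2.1, hy.tail hz⟩,
        hz.2.2⟩
  intro x hx y hy
  exact (chain_symm (key x (Finset.mem_filter.1 hx).2)).trans (key y (Finset.mem_filter.1 hy).2)

/-- The family of connected components: if bonds of two components had intersecting supports, the
components would coincide. -/
theorem exists_bondUnion_eq [NeZero m] (B : Finset (Bond m)) :
    ∃ G : Finset (Polymer m), Compatible G ∧ bondUnion G = B := by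
  classical
  refine ⟨Finset.univ.filter fun R : Polymer m => ∃ b ∈ B, R.1 = component B b, ?_, ?_⟩
  · intro R hR R' hR' hne
    obtain ⟨b, hb, hRb⟩ := (Finset.mem_filter.1 hR).2
    obtain ⟨b', hb', hRb'⟩ := (Finset.mem_filter.1 hR').2
    rw [polymerSupport, polymerSupport, Finset.disjoint_biUnion_left]
    intro x hx
    rw [Finset.disjoint_biUnion_right]
    intro y hy
    by_contra hxy
    apply hne
    apply Subtype.ext
    rw [hRb] at hx ⊢
    rw [hRb'] at hy ⊢
    obtain ⟨hxB, hbx⟩ := Finset.mem_filter.1 hx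
    obtain ⟨hyB, hby⟩ := Finset.mem_filter.1 hy
    have hbb : Relation.ReflTransGen (adjIn B) b b' := (hbx.tail ⟨hxB, hyB, hxy⟩).trans (chain_symm hby)
    ext z
    simp only [component, Finset.mem_filter]
    exact and_congr_right fun _ => ⟨fun h => (chain_symm hbb).trans h, fun h => hbb.trans h⟩
  · ext x
    simp only [bondUnion, Finset.mem_biUnion, Finset.mem_filter, Finset.mem_univ, true_and]
    constructor
    · rintro ⟨R, ⟨b, _, hR⟩, hx⟩
      rw [hR] at hx
      exact (Finset.mem_filter.1 hx).1
    · intro hx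
      exact ⟨⟨component B x, isPolymer_component hx⟩, ⟨x, hx, rfl⟩,
        Finset.mem_filter.2 ⟨hx, .refl⟩⟩

/-- A weight on sets of bonds that factorizes over sets with disjoint supports. -/
structure Factorizes (φ : Finset (Bond m) → ℝ) : Prop where
  empty : φ ∅ = 1
  union : ∀ A B, (∀ a ∈ A, ∀ b ∈ B, ¬ bondAdj a b) → φ (A ∪ B) = φ A * φ B

theorem prod_polymers {φ : Finset (Bond m) → ℝ} (hφ : Factorizes φ) (G : Finset (Polymer m)) :
    Compatible G → ∏ R ∈ G, (C (φ R.1) * X ^ R.1.card)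
      = C (φ (bondUnion G)) * (X : ℝ[X]) ^ (bondUnion G).card := by
  classical
  induction G using Finset.induction_on with
  | empty => intro _; simp [bondUnion, hφ.empty]
  | insert R G hR ih =>
    intro hG
    have hG' : Compatible G := fun S hS S' hS' => hG S (Finset.mem_insert_of_mem hS) S'
      (Finset.mem_insert_of_mem hS')
    have hadj : ∀ a ∈ R.1, ∀ b ∈ bondUnion G, ¬ bondAdj a b := by
      intro a ha b hb hab
      obtain ⟨R', hR', hbR⟩ := Finset.mem_biUnion.1 hb
      have := hG.eq_of_adj (Finset.mem_insert_self R G) (Finset.mem_insert_of_mem hR') ha hbR hab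
      exact hR (this ▸ hR')
    have hd : Disjoint R.1 (bondUnion G) :=
      Finset.disjoint_left.2 fun x hx hx' => hadj x hx x hx' (bondAdj_refl x)
    have hU : bondUnion (insert R G) = R.1 ∪ bondUnion G := by
      simp [bondUnion, Finset.biUnion_insert]
    rw [Finset.prod_insert hR, ih hG', hU, hφ.union _ _ hadj, Finset.card_union_of_disjoint hd,
      pow_add, C_mul]
    ring

variable [NeZero m]

/-- The polymer partition function with activities `X ^ |R| * φ R`, as a polynomial in `X`. -/
noncomputable def polymerPoly (φ : Finset (Bond m) → ℝ) : ℝ[X] :=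
  MvPolynomial.aeval (fun R : Polymer m => C (φ R.1) * (X : ℝ[X]) ^ R.1.card) (polymerZ m)

/-- The polymer partition function is a sum over all sets of bonds. -/
theorem polymerPoly_eq {φ : Finset (Bond m) → ℝ} (hφ : Factorizes φ) :
    polymerPoly φ = ∑ B : Finset (Bond m), C (φ B) * (X : ℝ[X]) ^ B.card := by
  classical
  unfold polymerPoly polymerZ
  simp only [map_sum, map_prod, MvPolynomial.aeval_X]
  refine Finset.sum_bij (fun G _ => bondUnion G) (fun _ _ => Finset.mem_univ _) ?_ ?_ ?_
  · intro G hG G' hG' h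
    have h1 : Compatible G := (Finset.mem_filter.1 hG).2
    have h2 : Compatible G' := (Finset.mem_filter.1 hG').2
    exact Finset.Subset.antisymm (bondUnion_injOn h1 h2 h) (bondUnion_injOn h2 h1 h.symm)
  · intro B _
    obtain ⟨G, hG, hB⟩ := exists_bondUnion_eq B
    exact ⟨G, Finset.mem_filter.2 ⟨Finset.mem_univ _, hG⟩, hB⟩
  · intro G hG
    exact prod_polymers hφ G (Finset.mem_filter.1 hG).2

/-- Substituting `φ R * X ^ |R|` makes the power of `X` count bonds with multiplicity. The entries
of a contributing multi-index stay below `j + 1` because every polymer has a bond. -/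
theorem coeff_aeval_polymer (φ : Finset (Bond m) → ℝ) (Q : MvPolynomial (Polymer m) ℝ) (j : ℕ) :
    (MvPolynomial.aeval (fun R : Polymer m => C (φ R.1) * (X : ℝ[X]) ^ R.1.card) Q).coeff j
      = ∑ I ∈ multiIndices m j, Q.coeff (Finsupp.equivFunOnFinite.symm I) *
          ∏ R : Polymer m, φ R.1 ^ I R := by
  classical
  have hmon : ∀ d : Polymer m →₀ ℕ,
      ∏ R : Polymer m, (C (φ R.1) * (X : ℝ[X]) ^ R.1.card) ^ d R
        = C (∏ R : Polymer m, φ R.1 ^ d R) * X ^ (∑ R : Polymer m, d R * R.1.card) := by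
    intro d
    rw [← Finset.prod_pow_eq_pow_sum, map_prod, ← Finset.prod_mul_distrib]
    refine Finset.prod_congr rfl fun R _ => ?_
    rw [mul_pow, ← pow_mul, C_pow, mul_comm (d R)]
  rw [MvPolynomial.aeval_def, MvPolynomial.eval₂_eq', finsetSum_coeff]
  simp only [hmon, algebraMap_eq, ← mul_assoc, ← C_mul, coeff_C_mul, coeff_X_pow, mul_ite, mul_one,
    mul_zero]
  rw [← Finset.sum_filter]
  refine Finset.sum_bij_ne_zero (fun d _ _ => (d : Polymer m → ℕ)) ?_ ?_ ?_ ?_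
  · intro d hd _
    have hd2 := (Finset.mem_filter.1 hd).2
    refine Finset.mem_filter.2 ⟨Fintype.mem_piFinset.2 fun R => Finset.mem_range.2 ?_, hd2.symm⟩
    have h1 : d R * R.1.card ≤ j := by
      rw [hd2]
      exact Finset.single_le_sum (f := fun R : Polymer m => d R * R.1.card)
        (fun _ _ => Nat.zero_le _) (Finset.mem_univ R)
    have h2 : 1 ≤ R.1.card := Finset.card_pos.2 R.2.1
    nlinarith
  · intro d _ _ d' _ _ h
    exact DFunLike.coe_injective h
  · intro I hI hne
    refine ⟨Finsupp.equivFunOnFinite.symm I, ?_, ?_, ?_⟩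
    · refine Finset.mem_filter.2 ⟨?_, ?_⟩
      · rw [MvPolynomial.mem_support_iff]
        exact left_ne_zero_of_mul hne
      · simpa using (Finset.mem_filter.1 hI).2.symm
    · simpa using hne
    · simp
  · intro d _ _
    congr 2
    ext; simp

theorem constantCoeff_polymerZ : MvPolynomial.constantCoeff (polymerZ m - 1) = 0 := by
  classical
  unfold polymerZ
  rw [map_sub, map_sum, map_one, Finset.sum_eq_single ∅]
  · simp
  · intro G _ hG
    obtain ⟨R, hR⟩ := Finset.nonempty_iff_ne_empty.2 hG
    rw [map_prod]
    exact Finset.prod_eq_zero hR (by simp)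
  · intro h
    exact absurd (Finset.mem_filter.2 ⟨Finset.mem_univ _, by simp⟩) h

/-- Each of the `n` factors contributes degree at least one. This makes the truncations of the
logarithm immaterial. -/
theorem coeff_pow_eq_zero_of_constantCoeff {σ : Type*} {Q : MvPolynomial σ ℝ}
    (hQ : MvPolynomial.constantCoeff Q = 0) (n : ℕ) :
    ∀ d : σ →₀ ℕ, d.degree < n → (Q ^ n).coeff d = 0 := by
  classical
  induction n with
  | zero => intro d hd; omega
  | succ n ih =>
    intro d hd
    rw [pow_succ, MvPolynomial.coeff_mul]
    refine Finset.sum_eq_zero fun x hx => ?_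
    have hx' : x.1 + x.2 = d := Finset.HasAntidiagonal.mem_antidiagonal.1 hx
    by_cases h2 : x.2 = 0
    · rw [h2, ← MvPolynomial.constantCoeff_eq, hQ, mul_zero]
    · have h3 : 0 < x.2.degree := Nat.pos_of_ne_zero fun h => h2 (Finsupp.degree_eq_zero_iff _ |>.1 h)
      have h4 : x.1.degree + x.2.degree = d.degree := by
        rw [← hx', map_add]
      rw [ih x.1 (by omega), zero_mul]

/-- The cluster coefficients give the coefficients of the formal logarithm of the one-variable
partition function. -/
theorem sum_clusterCoeff (φ : Finset (Bond m) → ℝ) (j : ℕ) :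
    ∑ I ∈ multiIndices m j, clusterCoeff I * ∏ R : Polymer m, φ R.1 ^ I R
      = logCoeff (polymerPoly φ) j := by
  unfold logCoeff logTrunc polymerPoly
  rw [finsetSum_coeff]
  have h1 : ∀ n : ℕ, (C ((-1 : ℝ) ^ (n + 1) / n) * (MvPolynomial.aeval
      (fun R : Polymer m => C (φ R.1) * (X : ℝ[X]) ^ R.1.card) (polymerZ m) - 1) ^ n).coeff j
      = ∑ I ∈ multiIndices m j, (-1 : ℝ) ^ (n + 1) / n *
        ((polymerZ m - 1) ^ n).coeff (Finsupp.equivFunOnFinite.symm I) *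
          ∏ R : Polymer m, φ R.1 ^ I R := by
    intro n
    rw [coeff_C_mul, ← map_one (MvPolynomial.aeval (R := ℝ)
      (fun R : Polymer m => C (φ R.1) * (X : ℝ[X]) ^ R.1.card)), ← map_sub, ← map_pow,
      coeff_aeval_polymer, Finset.mul_sum]
    exact Finset.sum_congr rfl fun I _ => by ring
  simp only [h1]
  rw [Finset.sum_comm]
  refine Finset.sum_congr rfl fun I hI => ?_
  rw [clusterCoeff, Finset.sum_mul]
  -- `clusterCoeff` stops at the degree of `I` and `logTrunc` at `j`, which may be larger; the
  -- additional powers have no coefficient at `I`.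
  have hle : ∑ R, I R ≤ j := by
    rw [← (Finset.mem_filter.1 hI).2]
    refine Finset.sum_le_sum fun R _ => Nat.le_mul_of_pos_right _ (Finset.card_pos.2 R.2.1)
  refine Finset.sum_subset (Finset.Icc_subset_Icc_right hle) fun n hn hn' => ?_
  rw [coeff_pow_eq_zero_of_constantCoeff constantCoeff_polymerZ]
  · simp
  · simp only [Finset.mem_Icc, not_and, not_le] at hn hn'
    have := hn' hn.1
    rwa [Finsupp.degree_eq_sum]

end Polymers

/-! ### Two-layer product measures and independence over closed disjoint sets of coordinates. -/

section LayeredMeasure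

variable {ι α : Type*} [Fintype ι] [DecidableEq ι] [Fintype α]

/-- The average of a function over all configurations. -/
noncomputable def avg (F : (ι → α) → ℝ) : ℝ := (∑ σ, F σ) / Fintype.card (ι → α)

/-- Sums of functions of disjoint sets of coordinates factorize. -/
theorem sum_mul_sum_of_dependsOn {F G : (ι → α) → ℝ} {A B : Finset ι}
    (hF : DependsOn F (A : Set ι)) (hG : DependsOn G (B : Set ι)) (hAB : Disjoint A B) :
    (∑ σ, F σ) * ∑ σ, G σ = Fintype.card (ι → α) * ∑ σ, F σ * G σ := by
  -- Two configurations exchange their coordinates outside `A`. After the exchange `F` and `G` are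
  -- evaluated at the same one of the two, and the other is summed freely.
  let s : (ι → α) × (ι → α) → (ι → α) × (ι → α) :=
    fun p => (A.piecewise p.1 p.2, A.piecewise p.2 p.1)
  have hs : Function.Involutive s := by
    rintro ⟨a, b⟩
    simp only [s, Prod.mk.injEq]
    constructor <;> (funext i; by_cases hi : i ∈ A <;> simp [hi])
  rw [Finset.sum_mul_sum, ← Finset.sum_product', Finset.univ_product_univ,
    ← Equiv.sum_comp (hs.toPerm s)]
  have : ∀ p : (ι → α) × (ι → α),
      F (hs.toPerm s p).1 * G (hs.toPerm s p).2 = F p.1 * G p.1 := by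
    rintro ⟨a, b⟩
    rw [Function.Involutive.coe_toPerm]
    congr 1
    · refine hF fun i hi => ?_
      have : i ∈ A := hi
      simp [s, this]
    · refine hG fun i hi => ?_
      have : i ∉ A := fun h => Finset.disjoint_left.1 hAB h hi
      simp [s, this]
  rw [Finset.sum_congr rfl fun p _ => this p, Fintype.sum_prod_type]
  simp [Finset.mul_sum]

theorem avg_mul_of_dependsOn [Nonempty α] {F G : (ι → α) → ℝ} {A B : Finset ι}
    (hF : DependsOn F (A : Set ι)) (hG : DependsOn G (B : Set ι)) (hAB : Disjoint A B) :
    avg (fun σ => F σ * G σ) = avg F * avg G := by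
  have hc : (Fintype.card (ι → α) : ℝ) ≠ 0 := by exact_mod_cast Fintype.card_ne_zero
  unfold avg
  rw [div_mul_div_comm, sum_mul_sum_of_dependsOn hF hG hAB]
  field_simp

/-- Exchanging the coordinate `k` with the extra variable is an involution, which leaves a free sum
over the extra variable. -/
theorem sum_sum_update (H : (ι → α) → ℝ) (k : ι) :
    ∑ σ, ∑ τ, H (Function.update σ k τ) = Fintype.card α * ∑ σ, H σ := by
  let s : (ι → α) × α → (ι → α) × α := fun p => (Function.update p.1 k p.2, p.1 k)
  have hs : Function.Involutive s := by
    rintro ⟨a, b⟩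
    simp [s]
  rw [← Fintype.sum_prod_type' (f := fun σ τ => H (Function.update σ k τ))]
  have h := Equiv.sum_comp (hs.toPerm s) (fun p : (ι → α) × α => H p.1)
  rw [Fintype.sum_prod_type (f := fun p : (ι → α) × α => H p.1)] at h
  refine h.trans ?_
  simp [Finset.mul_sum]

theorem avg_mul_update {F g : (ι → α) → ℝ} {k : ι}
    (hF : ∀ σ τ, F (Function.update σ k τ) = F σ)
    (hg : ∀ σ, ∑ τ, g (Function.update σ k τ) = 1) :
    avg (fun σ => F σ * (Fintype.card α * g σ)) = avg F := by
  unfold avg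
  congr 1
  have h := sum_sum_update (fun σ => F σ * g σ) k
  simp only [hF, ← Finset.mul_sum, hg, mul_one] at h
  rw [h, Finset.mul_sum]
  exact Finset.sum_congr rfl fun σ _ => by ring

/-- Conditional densities on a two-layer set of coordinates: a coordinate outside `O` has a density
of its own, and a coordinate in `O` has a density that depends on coordinates outside `O`. -/
structure IsLayered (nb : ι → Finset ι) (O : Finset ι) (g : ι → (ι → α) → ℝ) : Prop where
  dependsOn : ∀ k, DependsOn (g k) (nb k : Set ι)
  sum_eq_one : ∀ k σ, ∑ τ, g k (Function.update σ k τ) = 1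
  nb_upper : ∀ k, ∀ l ∈ nb k, l ∈ O → l = k
  nb_lower : ∀ k, k ∉ O → nb k = {k}

/-- Expectation with respect to the layered density. -/
noncomputable def layeredE (g : ι → (ι → α) → ℝ) (F : (ι → α) → ℝ) : ℝ := ∑ σ, (∏ k, g k σ) * F σ

theorem layeredE_eq_avg [Nonempty α] (g : ι → (ι → α) → ℝ) (F : (ι → α) → ℝ) :
    layeredE g F = avg (fun σ => F σ * ∏ k, (Fintype.card α * g k σ)) := by
  have hc : (Fintype.card α : ℝ) ≠ 0 := by exact_mod_cast Fintype.card_ne_zero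
  unfold layeredE avg
  rw [eq_div_iff (by exact_mod_cast Fintype.card_ne_zero), Finset.sum_mul]
  refine Finset.sum_congr rfl fun σ _ => ?_
  dsimp only
  rw [Finset.prod_mul_distrib, Finset.prod_const, Fintype.card_fun, Finset.card_univ]
  push_cast
  ring

variable {nb : ι → Finset ι} {O : Finset ι} {g : ι → (ι → α) → ℝ}

/-- A coordinate on which neither `F` nor any other remaining density depends can be integrated out,
and its conditional density then contributes `1`; `T` is removed in this way element by element. -/
theorem IsLayered.avg_sdiff (h : IsLayered nb O g) {F : (ι → α) → ℝ} {A K : Finset ι}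
    (hF : DependsOn F (A : Set ι)) (T : Finset ι) : T ⊆ K → Disjoint T A →
    (∀ k ∈ T, ∀ l ∈ K, l ≠ k → k ∉ nb l) →
    avg (fun σ => F σ * ∏ k ∈ K, (Fintype.card α * g k σ))
      = avg (fun σ => F σ * ∏ k ∈ K \ T, (Fintype.card α * g k σ)) := by
  induction T using Finset.induction_on with
  | empty => intros; simp
  | insert k T hk ih =>
    intro hTK hTA hT
    rw [Finset.disjoint_insert_left] at hTA
    rw [ih ((Finset.subset_insert _ _).trans hTK) hTA.2
      fun x hx => hT x (Finset.mem_insert_of_mem hx)]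
    have hkK : k ∈ K \ T := Finset.mem_sdiff.2 ⟨hTK (Finset.mem_insert_self _ _), hk⟩
    have hd : K \ insert k T = (K \ T).erase k := by
      ext x; simp; tauto
    rw [hd, ← avg_mul_update (k := k) (g := g k)
      (F := fun σ => F σ * ∏ l ∈ (K \ T).erase k, (Fintype.card α * g l σ)) _ (h.sum_eq_one k)]
    · congr 1
      funext σ
      rw [← Finset.mul_prod_erase _ _ hkK]
      ring
    · intro σ τ
      congr 1
      · refine hF fun i hi => ?_
        rw [Function.update_of_ne]
        rintro rfl
        exact hTA.1 hi
      · refine Finset.prod_congr rfl fun l hl => ?_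
        congr 1
        refine h.dependsOn l fun i hi => ?_
        rw [Function.update_of_ne]
        rintro rfl
        exact hT i (Finset.mem_insert_self _ _) l
          (Finset.mem_sdiff.1 (Finset.mem_of_mem_erase hl)).1 (Finset.ne_of_mem_erase hl) hi

variable [Nonempty α]

theorem IsLayered.layeredE_eq (h : IsLayered nb O g) {F : (ι → α) → ℝ} {A : Finset ι}
    (hF : DependsOn F (A : Set ι)) (hA : ∀ k ∈ A, nb k ⊆ A) :
    layeredE g F = avg (fun σ => F σ * ∏ k ∈ A, (Fintype.card α * g k σ)) := by
  -- The order matters. Coordinates in `O` condition no other and go first; a coordinate outside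
  -- both `O` and `A` is then free, because the densities left over from `O` lie in `A`, which is
  -- closed under `nb`.
  rw [layeredE_eq_avg, h.avg_sdiff (K := Finset.univ) hF (O \ A) (Finset.subset_univ _)
    Finset.sdiff_disjoint, h.avg_sdiff hF (Oᶜ \ A) _ Finset.sdiff_disjoint]
  · congr 3
    funext σ
    congr 2
    ext x; simp
  · intro k hk l hl hlk hkl
    simp only [Finset.mem_sdiff, Finset.mem_compl, Finset.mem_univ, true_and, not_and,
      not_not] at hk hl
    by_cases hlO : l ∈ O
    · exact hk.2 (hA l (hl hlO) hkl)
    · rw [h.nb_lower l hlO, Finset.mem_singleton] at hkl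
      exact hlk hkl.symm
  · intro x
    simp only [Finset.mem_sdiff, Finset.mem_compl, Finset.mem_univ, true_and]
    tauto
  · intro k hk l _ hlk hkl
    exact hlk (h.nb_upper l k hkl (Finset.mem_sdiff.1 hk).1).symm

/-- On a closed set the marginal is the product of the densities of that set and involves only its
coordinates, so disjoint closed sets are independent. -/
theorem IsLayered.layeredE_mul (h : IsLayered nb O g) {F G : (ι → α) → ℝ} {A B : Finset ι}
    (hF : DependsOn F (A : Set ι)) (hG : DependsOn G (B : Set ι)) (hA : ∀ k ∈ A, nb k ⊆ A)
    (hB : ∀ k ∈ B, nb k ⊆ B) (hAB : Disjoint A B) :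
    layeredE g (fun σ => F σ * G σ) = layeredE g F * layeredE g G := by
  have hdep : ∀ {A : Finset ι} {F : (ι → α) → ℝ}, DependsOn F (A : Set ι) →
      (∀ k ∈ A, nb k ⊆ A) →
      DependsOn (fun σ => F σ * ∏ k ∈ A, (Fintype.card α * g k σ)) (A : Set ι) := by
    intro A F hF hA σ τ hστ
    dsimp only
    rw [hF hστ]
    congr 1
    refine Finset.prod_congr rfl fun k hk => ?_
    rw [h.dependsOn k fun i hi => hστ i (hA k hk hi)]
  rw [h.layeredE_eq hF hA, h.layeredE_eq hG hB,
    ← avg_mul_of_dependsOn (hdep hF hA) (hdep hG hB) hAB,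
    h.layeredE_eq (A := A ∪ B) (F := fun σ => F σ * G σ)]
  · congr 1
    funext σ
    rw [Finset.prod_union hAB]
    ring
  · intro σ τ hστ
    dsimp only
    rw [hF fun i hi => hστ i (by simp at hi ⊢; exact Or.inl hi),
      hG fun i hi => hστ i (by simp at hi ⊢; exact Or.inr hi)]
  · intro k hk
    rcases Finset.mem_union.1 hk with hk | hk
    · exact (hA k hk).trans Finset.subset_union_left
    · exact (hB k hk).trans Finset.subset_union_right

theorem IsLayered.layeredE_one (h : IsLayered nb O g) : layeredE g (fun _ => 1) = 1 := by
  rw [h.layeredE_eq (A := ∅) (fun _ _ _ => rfl) (by simp)]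
  have hc : (Fintype.card (ι → α) : ℝ) ≠ 0 := by exact_mod_cast Fintype.card_ne_zero
  simp only [avg, Finset.prod_empty, mul_one, Finset.sum_const, Finset.card_univ, nsmul_eq_mul]
  exact div_self hc

end LayeredMeasure

/-! ### The conditional prior and the reference measure on cells; factorization of bond weights. -/

section Cells

set_option linter.unusedSectionVars false

variable {m q : ℕ}

/-- Evenness of `m` is what keeps the alternation of parities intact across the seam of the cycle.
-/
theorem odd_val_add_one (hm : Even m) (h4 : 4 ≤ m) (k : ZMod m) :
    Odd (k + 1).val ↔ ¬ Odd k.val := by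
  have : NeZero m := ⟨by omega⟩
  have : Fact (1 < m) := ⟨by omega⟩
  rw [ZMod.val_add, ZMod.val_one, Nat.odd_iff, Nat.odd_iff,
    Nat.mod_mod_of_dvd _ (even_iff_two_dvd.1 hm)]
  omega

theorem odd_val_sub_one (hm : Even m) (h4 : 4 ≤ m) (k : ZMod m) :
    Odd (k - 1).val ↔ ¬ Odd k.val := by
  have := odd_val_add_one hm h4 (k - 1)
  rw [sub_add_cancel] at this
  tauto

theorem cellPrior_pos {r : ℝ} (h0 : 0 < r) (h1 : r < 1) (τ : Cell q) : 0 < cellPrior r τ :=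
  Finset.prod_pos fun i _ => by split_ifs <;> linarith

theorem exists_cellSum_eq {s : ℤ} (hs : s ∈ coarseSpins q) : ∃ τ : Cell q, cellSum τ = s := by
  obtain ⟨j, hj, rfl⟩ := Finset.mem_image.1 hs
  have hj' : j ≤ q := by simpa [Nat.lt_succ_iff] using hj
  refine ⟨fun i => if i.val < j then 1 else -1, ?_⟩
  have : ∀ i : Fin q, (((if i.val < j then 1 else -1 : Spin) : Spin) : ℤ)
      = 2 * (if i.val < j then 1 else 0) - 1 := by
    intro i; split_ifs <;> simp
  unfold cellSum
  simp only [this, Finset.sum_sub_distrib, ← Finset.mul_sum, Finset.sum_boole]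
  have hc : (Finset.univ.filter fun i : Fin q => i.val < j).card = j := by
    rw [Fin.card_filter_val_lt, min_eq_right hj']
  simp [hc]

theorem cellSum_mem (τ : Cell q) : cellSum τ ∈ coarseSpins q := by
  refine Finset.mem_image.2 ⟨(Finset.univ.filter fun i => τ i = 1).card, ?_, ?_⟩
  · rw [Finset.mem_range, Nat.lt_succ_iff]
    exact (Finset.card_le_univ _).trans (by simp)
  · have : ∀ i : Fin q, ((τ i : Spin) : ℤ) = 2 * (if τ i = 1 then 1 else 0) - 1 := by
      intro i
      rcases Int.units_eq_one_or (τ i) with h | h <;> simp [h]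
    unfold cellSum
    simp only [this, Finset.sum_sub_distrib, ← Finset.mul_sum, Finset.sum_boole]
    simp

/-- The prior weight of a value of the cell sum. -/
noncomputable def cellWeight (q : ℕ) (r : ℝ) (s : ℤ) : ℝ :=
  ∑ τ' : Cell q, (if cellSum τ' = s then cellPrior r τ' else 0)

theorem cellWeight_pos {r : ℝ} (h0 : 0 < r) (h1 : r < 1) {s : ℤ} (hs : s ∈ coarseSpins q) :
    0 < cellWeight q r s := by
  obtain ⟨τ, hτ⟩ := exists_cellSum_eq hs
  refine Finset.sum_pos' (fun τ _ => ?_) ⟨τ, Finset.mem_univ _, ?_⟩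
  · split_ifs
    exacts [(cellPrior_pos h0 h1 τ).le, le_rfl]
  · rw [if_pos hτ]; exact cellPrior_pos h0 h1 τ

theorem cellCond_eq (r : ℝ) (s : ℤ) (τ : Cell q) :
    cellCond r s τ = (if cellSum τ = s then cellPrior r τ else 0) / cellWeight q r s := by
  unfold cellCond cellWeight
  split_ifs <;> simp

theorem cellCond_nonneg {r : ℝ} (h0 : 0 < r) (h1 : r < 1) (s : ℤ) (τ : Cell q) :
    0 ≤ cellCond r s τ := by
  rw [cellCond_eq]
  refine div_nonneg ?_ (Finset.sum_nonneg fun τ _ => ?_) <;> split_ifs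
  exacts [(cellPrior_pos h0 h1 τ).le, le_rfl, (cellPrior_pos h0 h1 _).le, le_rfl]

theorem cellCond_of_ne {r : ℝ} {s : ℤ} {τ : Cell q} (h : cellSum τ ≠ s) : cellCond r s τ = 0 :=
  if_neg h

/-- Raising the exponents by at most `a` raises a weighted sum of exponentials by at most a factor
`exp a`. -/
theorem sum_mul_exp_le {α : Type*} [Fintype α] {p u v : α → ℝ} (hp : ∀ x, 0 ≤ p x) {a : ℝ}
    (h : ∀ x, u x ≤ v x + a) :
    ∑ x, p x * Real.exp (u x) ≤ Real.exp a * ∑ x, p x * Real.exp (v x) := by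
  rw [Finset.mul_sum]
  refine Finset.sum_le_sum fun x _ => ?_
  have : Real.exp (u x) ≤ Real.exp a * Real.exp (v x) := by
    rw [← Real.exp_add]; exact Real.exp_le_exp.2 (by linarith [h x])
  nlinarith [hp x, mul_le_mul_of_nonneg_left this (hp x)]

theorem sum_cellCond_mul_pos {r : ℝ} (h0 : 0 < r) (h1 : r < 1) {s : ℤ} (hs : s ∈ coarseSpins q)
    {f : Cell q → ℝ} (hf : ∀ τ, 0 < f τ) : 0 < ∑ τ : Cell q, cellCond r s τ * f τ := by
  obtain ⟨τ, hτ⟩ := exists_cellSum_eq hs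
  refine Finset.sum_pos' (fun τ _ => mul_nonneg (cellCond_nonneg h0 h1 s τ) (hf τ).le)
    ⟨τ, Finset.mem_univ _, mul_pos ?_ (hf τ)⟩
  rw [cellCond_eq, if_pos hτ]
  exact div_pos (cellPrior_pos h0 h1 τ) (cellWeight_pos h0 h1 hs)

namespace Model

variable [NeZero m] [NeZero q] {D : Model m q}

/-- The conditional prior given the coarse configuration. -/
noncomputable def condPrior (D : Model m q) (η : ZMod m → ℤ) (σ : Config m q) : ℝ :=
  ∏ k, cellCond (D.prior k) (η k) (σ k)

theorem condPrior_of_ne {η : ZMod m → ℤ} {σ : Config m q} (h : coarsen σ ≠ η) :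
    D.condPrior η σ = 0 := by
  obtain ⟨k, hk⟩ := Function.ne_iff.1 h
  exact Finset.prod_eq_zero (Finset.mem_univ k) (cellCond_of_ne hk)

theorem mem_coarseSpins {η : ZMod m → ℤ} (hη : η ∈ coarseConfigs m q) (k : ZMod m) :
    η k ∈ coarseSpins q := Fintype.mem_piFinset.1 hη k

theorem coarsen_mem (σ : Config m q) : coarsen σ ∈ coarseConfigs m q :=
  Fintype.mem_piFinset.2 fun k => cellSum_mem (σ k)

theorem coarseP_eq (D : Model m q) (η : ZMod m → ℤ) :
    D.coarseP η = ∏ k, cellWeight q (D.prior k) (η k) := by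
  unfold coarseP P cellWeight
  rw [Finset.prod_univ_sum, Fintype.piFinset_univ, Finset.sum_filter]
  refine Finset.sum_congr rfl fun σ _ => ?_
  split_ifs with h
  · refine Finset.prod_congr rfl fun k _ => ?_
    rw [if_pos]; rw [← h]; rfl
  · obtain ⟨k, hk⟩ := Function.ne_iff.1 h
    exact (Finset.prod_eq_zero (Finset.mem_univ k) (if_neg hk)).symm

theorem coarseP_pos (hD : D.Admissible) {η : ZMod m → ℤ} (hη : η ∈ coarseConfigs m q) :
    0 < D.coarseP η := by
  rw [coarseP_eq]
  exact Finset.prod_pos fun k _ =>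
    cellWeight_pos (hD.prior_pos k) (hD.prior_lt_one k) (mem_coarseSpins hη k)

theorem condPrior_eq (D : Model m q) (η : ZMod m → ℤ) (σ : Config m q) :
    D.condPrior η σ = (if coarsen σ = η then D.P σ else 0) / D.coarseP η := by
  split_ifs with h
  · rw [coarseP_eq, P, ← Finset.prod_div_distrib]
    refine Finset.prod_congr rfl fun k _ => ?_
    rw [cellCond_eq, if_pos]; rw [← h]; rfl
  · rw [condPrior_of_ne h, zero_div]

theorem condE_eq (D : Model m q) (g : Config m q → ℝ) (η : ZMod m → ℤ) :
    D.condE g η = ∑ σ, D.condPrior η σ * g σ := by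
  unfold condE
  rw [Finset.sum_filter, Finset.sum_div]
  refine Finset.sum_congr rfl fun σ _ => ?_
  rw [condPrior_eq]
  split_ifs <;> simp [div_mul_eq_mul_div]

theorem sum_condPrior (hD : D.Admissible) {η : ZMod m → ℤ} (hη : η ∈ coarseConfigs m q) :
    ∑ σ, D.condPrior η σ = 1 := by
  have := condE_eq D (fun _ => 1) η
  simp only [mul_one] at this
  rw [← this]
  unfold condE
  simp only [mul_one]
  exact div_self (coarseP_pos hD hη).ne'

theorem Z1_pos (hD : D.Admissible) (k : ZMod m) {s : ℤ} (hs : s ∈ coarseSpins q)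
    (a b : Option (Cell q)) : 0 < D.Z1 k s a b :=
  sum_cellCond_mul_pos (hD.prior_pos k) (hD.prior_lt_one k) hs fun _ => Real.exp_pos _

/-- Given the middle cell the outer two are independent and sum to one-cell partition functions.
This identifies `Z3` as the normalization of an even cell in the reference measure. -/
theorem Z3_eq (D : Model m q) (k : ZMod m) (s₁ s₂ s₃ : ℤ) :
    D.Z3 k s₁ s₂ s₃ = ∑ τ : Cell q, cellCond (D.prior k) s₂ τ *
      (Real.exp (-D.β * D.cellEnergy τ) * D.Z1 (k + 1) s₃ (some τ) none
        * D.Z1 (k - 1) s₁ none (some τ)) := by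
  unfold Z3 Z1
  rw [Finset.sum_comm]
  refine Finset.sum_congr rfl fun τ _ => ?_
  rw [mul_assoc, Finset.sum_mul_sum, Finset.mul_sum, Finset.mul_sum, Finset.sum_comm]
  refine Finset.sum_congr rfl fun τ₁ _ => ?_
  rw [Finset.mul_sum, Finset.mul_sum]
  refine Finset.sum_congr rfl fun τ₃ _ => ?_
  simp only [leftEnergy, rightEnergy, Option.elim]
  rw [show -D.β * (D.cellEnergy τ₃ + D.pairEnergy τ₃ τ + D.cellEnergy τ + D.pairEnergy τ τ₁ +
      D.cellEnergy τ₁) = -D.β * D.cellEnergy τ + (-D.β * (D.pairEnergy τ τ₁ + 0 + D.cellEnergy τ₁)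
      + -D.β * (0 + D.pairEnergy τ₃ τ + D.cellEnergy τ₃)) by ring, Real.exp_add, Real.exp_add]
  ring

theorem Z3_pos (hD : D.Admissible) (k : ZMod m) {s₁ s₂ s₃ : ℤ} (h₁ : s₁ ∈ coarseSpins q)
    (h₂ : s₂ ∈ coarseSpins q) (h₃ : s₃ ∈ coarseSpins q) : 0 < D.Z3 k s₁ s₂ s₃ := by
  rw [Z3_eq]
  exact sum_cellCond_mul_pos (hD.prior_pos k) (hD.prior_lt_one k) h₂ fun τ =>
    mul_pos (mul_pos (Real.exp_pos _) (Z1_pos hD _ h₃ _ _)) (Z1_pos hD _ h₁ _ _)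

open Classical in
/-- The density of one cell in the reference measure. -/
noncomputable def stepDensity (D : Model m q) (η : ZMod m → ℤ) (k : ZMod m) (σ : Config m q) : ℝ :=
  if Odd k.val then
    Real.exp (-D.β * (D.cellEnergy (σ k) + D.pairEnergy (σ (k - 1)) (σ k)
        + D.pairEnergy (σ k) (σ (k + 1))))
      / D.Z1 k (η k) (some (σ (k - 1))) (some (σ (k + 1)))
      * cellCond (D.prior k) (η k) (σ k)
  else
    Real.exp (-D.β * D.cellEnergy (σ k))
      * D.Z1 (k + 1) (η (k + 1)) (some (σ k)) none
      * D.Z1 (k - 1) (η (k - 1)) none (some (σ k))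
      / D.Z3 k (η (k - 1)) (η k) (η (k + 1))
      * cellCond (D.prior k) (η k) (σ k)

theorem refMeasure_eq_prod (D : Model m q) (η : ZMod m → ℤ) (σ : Config m q) :
    D.refMeasure η σ = ∏ k, D.stepDensity η k σ := by
  classical
  unfold refMeasure
  rw [← Finset.prod_filter_mul_prod_filter_not Finset.univ (fun k : ZMod m => Odd k.val)]
  congr 1
  · refine Finset.prod_congr rfl fun k hk => ?_
    rw [stepDensity, if_pos (Finset.mem_filter.1 hk).2]
  · refine Finset.prod_congr (by ext k; simp) fun k hk => ?_
    rw [stepDensity, if_neg (Finset.mem_filter.1 hk).2]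

theorem add_one_ne (hD : D.Admissible) (k : ZMod m) : k + 1 ≠ k := fun h => by
  have := odd_val_add_one hD.even_m hD.four_le_m k
  rw [h] at this; tauto

theorem sub_one_ne (hD : D.Admissible) (k : ZMod m) : k - 1 ≠ k := fun h => by
  have := odd_val_sub_one hD.even_m hD.four_le_m k
  rw [h] at this; tauto

-- Odd cells form the layer `O`, conditioned on their even neighbours. An even cell sees its odd
-- neighbours only through `Z1`, in which their spins are already summed, so its density depends on
-- that cell alone.
open Classical in
theorem isLayered_stepDensity (hD : D.Admissible) {η : ZMod m → ℤ} (hη : η ∈ coarseConfigs m q) :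
    IsLayered (corridor (m := m)) (Finset.univ.filter fun k => Odd k.val) (D.stepDensity η) where
  dependsOn k σ τ h := by
    have hk : σ k = τ k := h k (corridor_nonempty k)
    unfold stepDensity
    split_ifs with ho
    · have h1 : σ (k - 1) = τ (k - 1) := h _ (by simp [corridor, ho])
      have h2 : σ (k + 1) = τ (k + 1) := h _ (by simp [corridor, ho])
      rw [hk, h1, h2]
    · rw [hk]
  sum_eq_one k σ := by
    unfold stepDensity
    split_ifs with ho
    · simp only [Function.update_self, Function.update_of_ne (add_one_ne hD k),
        Function.update_of_ne (sub_one_ne hD k)]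
      have hZ := (Z1_pos hD k (mem_coarseSpins hη k) (some (σ (k - 1))) (some (σ (k + 1)))).ne'
      simp only [div_mul_eq_mul_div, ← Finset.sum_div]
      rw [div_eq_one_iff_eq hZ, Z1]
      refine Finset.sum_congr rfl fun τ _ => ?_
      simp only [leftEnergy, rightEnergy, Option.elim]
      rw [mul_comm]
      congr 3
      ring
    · simp only [Function.update_self]
      have hZ := (Z3_pos hD k (mem_coarseSpins hη (k - 1)) (mem_coarseSpins hη k)
        (mem_coarseSpins hη (k + 1))).ne'
      simp only [div_mul_eq_mul_div, ← Finset.sum_div]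
      rw [div_eq_one_iff_eq hZ, Z3_eq]
      exact Finset.sum_congr rfl fun τ _ => mul_comm _ _
  nb_upper k l hl ho := by
    have ho' : Odd l.val := (Finset.mem_filter.1 ho).2
    unfold corridor at hl
    split_ifs at hl with hk
    · simp only [Finset.mem_insert, Finset.mem_singleton] at hl
      rcases hl with rfl | rfl | rfl
      · exact absurd hk ((odd_val_sub_one hD.even_m hD.four_le_m k).1 ho')
      · rfl
      · exact absurd hk ((odd_val_add_one hD.even_m hD.four_le_m k).1 ho')
    · simpa using hl
  nb_lower k hk := by
    have : ¬ Odd k.val := by simpa using hk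
    simp [corridor, this]

theorem stepDensity_nonneg (hD : D.Admissible) {η : ZMod m → ℤ} (hη : η ∈ coarseConfigs m q)
    (k : ZMod m) (σ : Config m q) : 0 ≤ D.stepDensity η k σ := by
  have h1 := cellCond_nonneg (hD.prior_pos k) (hD.prior_lt_one k) (η k) (σ k)
  unfold stepDensity
  split_ifs
  · have := Z1_pos hD k (mem_coarseSpins hη k) (some (σ (k - 1))) (some (σ (k + 1)))
    positivity
  · have := Z3_pos hD k (mem_coarseSpins hη (k - 1)) (mem_coarseSpins hη k)
      (mem_coarseSpins hη (k + 1))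
    have := Z1_pos hD (k + 1) (mem_coarseSpins hη (k + 1)) (some (σ k)) none
    have := Z1_pos hD (k - 1) (mem_coarseSpins hη (k - 1)) none (some (σ k))
    positivity

theorem refMeasure_nonneg (hD : D.Admissible) {η : ZMod m → ℤ} (hη : η ∈ coarseConfigs m q)
    (σ : Config m q) : 0 ≤ D.refMeasure η σ := by
  rw [refMeasure_eq_prod]
  exact Finset.prod_nonneg fun k _ => stepDensity_nonneg hD hη k σ

theorem sum_refMeasure (hD : D.Admissible) {η : ZMod m → ℤ} (hη : η ∈ coarseConfigs m q) :
    ∑ σ, D.refMeasure η σ = 1 := by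
  have := (isLayered_stepDensity hD hη).layeredE_one
  simpa [layeredE, refMeasure_eq_prod] using this

/-- The weight of a set of bonds: the mean of the product of its factors. -/
noncomputable def bondWeight (D : Model m q) (η : ZMod m → ℤ) (B : Finset (Bond m)) : ℝ :=
  ∑ σ : Config m q, D.refMeasure η σ * ∏ b ∈ B, D.bondFactor η σ b

theorem bondWeight_eq (D : Model m q) (η : ZMod m → ℤ) (B : Finset (Bond m)) :
    D.bondWeight η B = layeredE (D.stepDensity η) fun σ => ∏ b ∈ B, D.bondFactor η σ b := by
  simp only [bondWeight, layeredE, refMeasure_eq_prod]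

theorem dependsOn_bondFactor (D : Model m q) (η : ZMod m → ℤ) (b : Bond m) :
    DependsOn (fun σ => D.bondFactor η σ b) (bondSupport b : Set (ZMod m)) := by
  intro σ τ h
  rcases b with k | e
  · have h1 : σ (k.1 - 1) = τ (k.1 - 1) := h _ (by simp [bondSupport])
    have h2 : σ (k.1 + 1) = τ (k.1 + 1) := h _ (by simp [bondSupport])
    simp only [bondFactor]
    rw [h1, h2]
  · have h1 : σ e.1.1 = τ e.1.1 := h _ (by
      simp only [bondSupport, Finset.coe_union]
      exact Or.inl (corridor_nonempty _))
    have h2 : σ e.1.2 = τ e.1.2 := h _ (by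
      simp only [bondSupport, Finset.coe_union]
      exact Or.inr (corridor_nonempty _))
    simp only [bondFactor, fl]
    rw [h1, h2]

/-- A short-range support consists of two even cells, on which nothing is conditioned; a long-range
support contains the corridors by design. This closedness is what independence under the layered
measure requires. -/
theorem corridor_subset_bondSupport (hD : D.Admissible) {b : Bond m} {k : ZMod m}
    (hk : k ∈ bondSupport b) : corridor k ⊆ bondSupport b := by
  have hself : ∀ l : ZMod m, ¬ Odd l.val → corridor l = {l} := fun l hl => by
    simp [corridor, hl]
  have hc : ∀ j l : ZMod m, l ∈ corridor j → corridor l ⊆ corridor j := by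
    intro j l hl
    by_cases ho : Odd l.val
    · have : l = j := by
        by_cases hj : Odd j.val
        · simp only [corridor, hj, if_true, Finset.mem_insert, Finset.mem_singleton] at hl
          rcases hl with rfl | rfl | rfl
          · exact absurd hj ((odd_val_sub_one hD.even_m hD.four_le_m j).1 ho)
          · rfl
          · exact absurd hj ((odd_val_add_one hD.even_m hD.four_le_m j).1 ho)
        · rw [hself j hj] at hl; simpa using hl
      rw [this]
    · rw [hself l ho]; simpa using hl
  rcases b with j | e
  · have : ¬ Odd k.val := by
      simp only [bondSupport, Finset.mem_insert, Finset.mem_singleton] at hk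
      rcases hk with rfl | rfl
      · rw [odd_val_sub_one hD.even_m hD.four_le_m]; exact not_not.2 j.2
      · rw [odd_val_add_one hD.even_m hD.four_le_m]; exact not_not.2 j.2
    rw [hself k this]
    simpa using hk
  · simp only [bondSupport, Finset.mem_union] at hk ⊢
    rcases hk with hk | hk
    · exact (hc _ _ hk).trans Finset.subset_union_left
    · exact (hc _ _ hk).trans Finset.subset_union_right

/-- The two products of factors depend on disjoint closed sets of cells, which are independent under
the reference measure. -/
theorem factorizes_bondWeight (hD : D.Admissible) {η : ZMod m → ℤ} (hη : η ∈ coarseConfigs m q) :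
    Factorizes (D.bondWeight η) where
  empty := by simp [bondWeight, sum_refMeasure hD hη]
  union A B hAB := by
    classical
    have hdep : ∀ A : Finset (Bond m), DependsOn (fun σ => ∏ b ∈ A, D.bondFactor η σ b)
        ((A.biUnion bondSupport : Finset (ZMod m)) : Set (ZMod m)) := by
      intro A σ τ h
      refine Finset.prod_congr rfl fun b hb => dependsOn_bondFactor D η b fun i hi => ?_
      exact h i (Finset.mem_biUnion.2 ⟨b, hb, hi⟩)
    have hcl : ∀ A : Finset (Bond m), ∀ k ∈ A.biUnion bondSupport,
        corridor k ⊆ A.biUnion bondSupport := by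
      intro A k hk
      obtain ⟨b, hb, hkb⟩ := Finset.mem_biUnion.1 hk
      exact (corridor_subset_bondSupport hD hkb).trans (Finset.subset_biUnion_of_mem _ hb)
    have hd : Disjoint A B :=
      Finset.disjoint_left.2 fun x hx hx' => hAB x hx x hx' (bondAdj_refl x)
    rw [bondWeight_eq, bondWeight_eq, bondWeight_eq,
      ← (isLayered_stepDensity hD hη).layeredE_mul (hdep A) (hdep B) (hcl A) (hcl B)]
    · simp only [Finset.prod_union hd]
    · rw [Finset.disjoint_biUnion_left]
      intro a ha
      rw [Finset.disjoint_biUnion_right]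
      intro b hb
      exact not_not.1 (hAB a ha b hb)

theorem abs_bondWeight_le (hD : D.Admissible) {η : ZMod m → ℤ} (hη : η ∈ coarseConfigs m q)
    {y : Bond m → ℝ} (hy : ∀ b σ, |D.bondFactor η σ b| ≤ y b) (B : Finset (Bond m)) :
    |D.bondWeight η B| ≤ ∏ b ∈ B, y b := by
  unfold bondWeight
  refine (Finset.abs_sum_le_sum_abs _ _).trans ?_
  calc ∑ σ, |D.refMeasure η σ * ∏ b ∈ B, D.bondFactor η σ b|
      ≤ ∑ σ, D.refMeasure η σ * ∏ b ∈ B, y b := by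
        refine Finset.sum_le_sum fun σ _ => ?_
        rw [abs_mul, abs_of_nonneg (refMeasure_nonneg hD hη σ), Finset.abs_prod]
        exact mul_le_mul_of_nonneg_left
          (Finset.prod_le_prod (fun _ _ => abs_nonneg _) fun b _ => hy b σ)
          (refMeasure_nonneg hD hη σ)
    _ = _ := by rw [← Finset.sum_mul, sum_refMeasure hD hη, one_mul]

end Model

end Cells

/-! ### Cell decomposition of the short-range energy and size of the short-range factor. -/

section ShortRange

set_option linter.unusedSectionVars false

namespace Model

variable {m q : ℕ} [NeZero m] [NeZero q] {D : Model m q}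

theorem periodicExt_add (σ : Config m q) (k : ZMod m) {z : ℤ} (h0 : 0 ≤ z) (h1 : z < 2 * q) :
    periodicExt σ (z + (k.val * q : ℕ)) = paste (σ k) (σ (k + 1)) z := by
  have hq : (0 : ℤ) < q := by exact_mod_cast NeZero.pos q
  unfold periodicExt paste
  push_cast
  rw [Int.add_mul_ediv_right _ _ hq.ne', Int.add_mul_emod_self_right]
  split_ifs with h
  · rw [Int.ediv_eq_zero_of_lt h0 h]; simp
  · have : z / q = 1 := by
      rw [Int.ediv_eq_iff_of_pos hq]; constructor <;> linarith
    rw [this]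
    simp [add_comm]

/-- The sets of diameter at most `S` whose leftmost point is `x`. -/
noncomputable def rightSets (S : ℕ) (x : ℤ) : Finset (Finset ℤ) :=
  (Finset.Icc x (x + S)).powerset.filter fun X => x ∈ X

theorem mem_rightSets {S : ℕ} {x : ℤ} {X : Finset ℤ} :
    X ∈ rightSets S x ↔ X ⊆ Finset.Icc x (x + S) ∧ x ∈ X := by
  simp [rightSets]

/-- The translate of a set. -/
def shift (y : ℤ) (X : Finset ℤ) : Finset ℤ := X.image fun x => x + y

theorem mem_shift {y z : ℤ} {X : Finset ℤ} : z ∈ shift y X ↔ z - y ∈ X := by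
  unfold shift
  rw [Finset.mem_image]
  constructor
  · rintro ⟨x, hx, rfl⟩; simpa using hx
  · exact fun h => ⟨_, h, by ring⟩

theorem shift_shift (y : ℤ) (X : Finset ℤ) : shift y (shift (-y) X) = X := by
  ext z; rw [mem_shift, mem_shift]; simp

theorem sum_rightSets_shift (hD : D.Admissible) (x y : ℤ) (ω : ℤ → Spin) :
    ∑ X ∈ rightSets D.S (x + y), D.U X ω
      = ∑ X ∈ rightSets D.S x, D.U X fun z => ω (z + y) := by
  refine Finset.sum_nbij' (shift (-y)) (shift y) ?_ ?_ ?_ ?_ ?_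
  · intro X hX
    rw [mem_rightSets] at hX ⊢
    refine ⟨fun z hz => ?_, ?_⟩
    · have := Finset.mem_Icc.1 (hX.1 (mem_shift.1 hz))
      rw [Finset.mem_Icc]; constructor <;> linarith
    · rw [mem_shift, sub_neg_eq_add]; exact hX.2
  · intro X hX
    rw [mem_rightSets] at hX ⊢
    refine ⟨fun z hz => ?_, ?_⟩
    · have := Finset.mem_Icc.1 (hX.1 (mem_shift.1 hz))
      rw [Finset.mem_Icc]; constructor <;> linarith
    · rw [mem_shift, add_sub_cancel_right]; exact hX.2
  · intro X _; exact shift_shift y X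
  · intro X _; simpa using shift_shift (-y) X
  · intro X _
    rw [← hD.U_translation]
    exact congrArg (fun Y => D.U Y ω) (shift_shift y X).symm

/-- The sets that meet the cell `[0, q)` and extend to the right, inside `[0, 2q)`. -/
noncomputable def cellSets (q : ℕ) : Finset (Finset ℤ) :=
  (Finset.Ico (0 : ℤ) (2 * q)).powerset.filter fun X => ∃ x ∈ X, x < (q : ℤ)

/-- Sets are sorted by their leftmost site. Since `S < q`, those starting in `[0, q)` end before `2
q`; the remaining members of `cellSets` have diameter above `S` and zero potential. -/
theorem sum_rightSets_cell (hD : D.Admissible) (ω : ℤ → Spin) :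
    ∑ i ∈ Finset.range q, ∑ X ∈ rightSets D.S i, D.U X ω = ∑ X ∈ cellSets q, D.U X ω := by
  classical
  have hS := hD.S_lt_q
  have hdisj : (Finset.range q : Set ℕ).PairwiseDisjoint fun i : ℕ => rightSets D.S (i : ℤ) := by
    intro i _ j _ hij
    refine Finset.disjoint_left.2 fun X hX hX' => hij ?_
    rw [mem_rightSets] at hX hX'
    have h1 := Finset.mem_Icc.1 (hX.1 hX'.2)
    have h2 := Finset.mem_Icc.1 (hX'.1 hX.2)
    omega
  rw [← Finset.sum_biUnion hdisj]
  refine Finset.sum_subset ?_ ?_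
  · intro X hX
    obtain ⟨i, hi, hX⟩ := Finset.mem_biUnion.1 hX
    rw [mem_rightSets] at hX
    rw [Finset.mem_range] at hi
    refine Finset.mem_filter.2 ⟨Finset.mem_powerset.2 fun z hz => ?_, i, hX.2, by omega⟩
    have := Finset.mem_Icc.1 (hX.1 hz)
    rw [Finset.mem_Ico]; omega
  · intro X hX hX'
    obtain ⟨hX1, x, hx, hxq⟩ := Finset.mem_filter.1 hX
    rw [Finset.mem_powerset] at hX1
    have hne : X.Nonempty := ⟨x, hx⟩
    by_contra h0
    apply hX'
    have hmin := X.min'_mem hne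
    have hm0 := Finset.mem_Ico.1 (hX1 hmin)
    have hmx := X.min'_le x hx
    rw [Finset.mem_biUnion]
    refine ⟨(X.min' hne).toNat, Finset.mem_range.2 (by omega), ?_⟩
    rw [Int.toNat_of_nonneg hm0.1, mem_rightSets]
    refine ⟨fun z hz => ?_, hmin⟩
    rw [Finset.mem_Icc]
    refine ⟨X.min'_le z hz, ?_⟩
    by_contra hlt
    exact h0 (hD.U_range X ⟨_, hmin, z, hz, by omega⟩ ω)

theorem sum_cellSets (hD : D.Admissible) (τ τ' : Cell q) :
    ∑ X ∈ cellSets q, D.U X (paste τ τ') = D.cellEnergy τ + D.pairEnergy τ τ' := by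
  classical
  unfold cellSets cellEnergy pairEnergy
  rw [← Finset.sum_filter_add_sum_filter_not _ (fun X : Finset ℤ => ∀ x ∈ X, x < (q : ℤ)),
    Finset.filter_filter, Finset.filter_filter]
  congr 1
  · refine Finset.sum_congr ?_ ?_
    · ext X
      simp only [Finset.mem_filter, Finset.mem_powerset]
      constructor
      · rintro ⟨h1, ⟨x, hx, _⟩, h3⟩
        refine ⟨fun z hz => ?_, x, hx⟩
        have := Finset.mem_Ico.1 (h1 hz)
        exact Finset.mem_Ico.2 ⟨this.1, h3 z hz⟩
      · rintro ⟨h1, x, hx⟩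
        refine ⟨fun z hz => ?_, ⟨x, hx, (Finset.mem_Ico.1 (h1 hx)).2⟩,
          fun z hz => (Finset.mem_Ico.1 (h1 hz)).2⟩
        have := Finset.mem_Ico.1 (h1 hz)
        exact Finset.mem_Ico.2 ⟨this.1, by omega⟩
    · intro X hX
      refine hD.U_local X _ _ fun x hx => ?_
      have := Finset.mem_Ico.1 (Finset.mem_powerset.1 (Finset.mem_filter.1 hX).1 hx)
      simp [paste, this.2]
  · refine Finset.sum_congr ?_ fun _ _ => rfl
    ext X
    simp

theorem sum_Ico_mul (h : ℤ → ℝ) :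
    ∑ x ∈ Finset.Ico (0 : ℤ) (m * q), h x
      = ∑ k : ZMod m, ∑ i ∈ Finset.range q, h (i + (k.val * q : ℕ)) := by
  have hq : 0 < q := NeZero.pos q
  rw [← Finset.sum_product']
  symm
  refine Finset.sum_bij (fun p _ => (p.2 : ℤ) + (p.1.val * q : ℕ)) ?_ ?_ ?_ ?_
  · rintro ⟨k, i⟩ hp
    have hi : i < q := by simpa using hp
    have hk := ZMod.val_lt k
    have : k.val * q + q ≤ m * q := by nlinarith
    simp only [Finset.mem_Ico]
    refine ⟨by positivity, ?_⟩
    exact_mod_cast (by omega : i + k.val * q < m * q)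
  · rintro ⟨k, i⟩ hp ⟨k', i'⟩ hp' h
    have hi : i < q := by simpa using hp
    have hi' : i' < q := by simpa using hp'
    have h : i + k.val * q = i' + k'.val * q := by exact_mod_cast h
    have h1 := congrArg (· / q) h
    have h2 := congrArg (· % q) h
    simp only [Nat.add_mul_div_right _ _ hq, Nat.div_eq_of_lt hi, Nat.div_eq_of_lt hi',
      Nat.add_mul_mod_self_right, Nat.mod_eq_of_lt hi, Nat.mod_eq_of_lt hi', zero_add] at h1 h2
    rw [Prod.mk.injEq]
    exact ⟨ZMod.val_injective m h1, h2⟩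
  · intro x hx
    obtain ⟨hx0, hx1⟩ := Finset.mem_Ico.1 hx
    obtain ⟨n, rfl⟩ := Int.eq_ofNat_of_zero_le hx0
    have hn : n < m * q := by exact_mod_cast hx1
    refine ⟨(((n / q : ℕ) : ZMod m), n % q), by simpa using Nat.mod_lt n hq, ?_⟩
    have hv : ((n / q : ℕ) : ZMod m).val = n / q := by
      rw [ZMod.val_natCast, Nat.mod_eq_of_lt]
      exact Nat.div_lt_of_lt_mul (by rwa [mul_comm])
    simp only [hv]
    exact_mod_cast Nat.mod_add_div' n q
  · intro _ _; rfl

/-- The short-range Hamiltonian is a sum of cell energies and interactions of adjacent cells. -/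
theorem Hs_eq (hD : D.Admissible) (σ : Config m q) :
    D.Hs σ = ∑ k : ZMod m, (D.cellEnergy (σ k) + D.pairEnergy (σ k) (σ (k + 1))) := by
  have h1 : D.Hs σ = ∑ x ∈ Finset.Ico (0 : ℤ) (m * q),
      ∑ X ∈ rightSets D.S x, D.U X (periodicExt σ) := rfl
  rw [h1, sum_Ico_mul]
  refine Finset.sum_congr rfl fun k _ => ?_
  rw [← sum_cellSets hD, ← sum_rightSets_cell hD]
  refine Finset.sum_congr rfl fun i hi => ?_
  rw [sum_rightSets_shift hD]
  refine Finset.sum_congr rfl fun X hX => ?_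
  rw [mem_rightSets] at hX
  refine hD.U_local X _ _ fun x hx => ?_
  have := Finset.mem_Icc.1 (hX.1 hx)
  have hi' := Finset.mem_range.1 hi
  have hS := hD.S_lt_q
  exact periodicExt_add σ k (by omega) (by omega)

/-- The real supremum is meaningful only for a bounded family; locality leaves finitely many values,
one for each configuration on `X`. -/
theorem abs_le_potentialSup (hD : D.Admissible) (X : Finset ℤ) (ω : ℤ → Spin) :
    |D.U X ω| ≤ potentialSup (D.U X) := by
  classical
  refine le_ciSup (f := fun σ : ℤ → Spin => |D.U X σ|) (Set.Finite.bddAbove ?_) ω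
  let ext : (X → Spin) → ℤ → Spin := fun ρ x => if h : x ∈ X then ρ ⟨x, h⟩ else 1
  refine (Set.finite_range fun ρ : X → Spin => |D.U X (ext ρ)|).subset ?_
  rintro _ ⟨σ, rfl⟩
  refine ⟨fun x => σ x, ?_⟩
  simp only
  rw [hD.U_local X (ext fun x => σ x) σ fun x hx => by simp [ext, hx]]

theorem potentialSup_nonneg (X : Finset ℤ) : 0 ≤ potentialSup (D.U X) :=
  Real.iSup_nonneg fun _ => abs_nonneg _

theorem potentialSup_shift (hD : D.Admissible) (y : ℤ) (X : Finset ℤ) :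
    potentialSup (D.U (shift y X)) = potentialSup (D.U X) := by
  unfold potentialSup
  have h : ∀ σ, |D.U (shift y X) σ| = |D.U X fun x => σ (x + y)| := fun σ => by
    rw [← hD.U_translation]; rfl
  simp only [h]
  exact Equiv.iSup_comp (g := fun σ : ℤ → Spin => |D.U X σ|)
    (Equiv.arrowCongr (Equiv.addRight y).symm (Equiv.refl Spin))

theorem normU_nonneg : 0 ≤ D.normU := Finset.sum_nonneg fun X _ => potentialSup_nonneg X

theorem sum_potentialSup_le (hD : D.Admissible) (x : ℤ) (T : Finset (Finset ℤ))
    (hT : ∀ X ∈ T, x ∈ X ∧ ∀ y ∈ X, y - x ≤ D.S ∧ x - y ≤ D.S) :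
    ∑ X ∈ T, potentialSup (D.U X) ≤ D.normU := by
  unfold normU
  have hinj : Set.InjOn (shift (-x)) (T : Set (Finset ℤ)) := by
    intro X _ Y _ h
    rw [← shift_shift x X, h, shift_shift]
  have h1 : ∑ X ∈ T, potentialSup (D.U X) = ∑ X ∈ T.image (shift (-x)), potentialSup (D.U X) := by
    rw [Finset.sum_image hinj]
    exact Finset.sum_congr rfl fun X _ => (potentialSup_shift hD _ X).symm
  rw [h1]
  refine Finset.sum_le_sum_of_subset_of_nonneg ?_ fun X _ _ => potentialSup_nonneg X
  intro Y hY
  obtain ⟨X, hX, rfl⟩ := Finset.mem_image.1 hY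
  obtain ⟨hx, hX⟩ := hT X hX
  refine Finset.mem_filter.2 ⟨Finset.mem_powerset.2 fun z hz => ?_, ?_⟩
  · have := hX _ (mem_shift.1 hz)
    rw [Finset.mem_Icc]; constructor <;> linarith [this.1, this.2]
  · rw [mem_shift]; simpa using hx

/-- The interaction of adjacent cells is a boundary term. -/
theorem abs_pairEnergy_le (hD : D.Admissible) (τ τ' : Cell q) :
    |D.pairEnergy τ τ'| ≤ D.S * D.normU := by
  classical
  unfold pairEnergy
  set T := (Finset.Ico (0 : ℤ) (2 * q)).powerset.filter fun X =>
      ((∃ x ∈ X, x < (q : ℤ)) ∧ ∃ x ∈ X, (q : ℤ) ≤ x)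
  -- A set of diameter at most `S` that crosses the boundary contains one of the last `S` sites of
  -- the left cell. Summing over that site gives `S` times `normU`.
  set B := Finset.Ico ((q : ℤ) - D.S) q
  have hbound : ∀ X ∈ T, |D.U X (paste τ τ')| ≤
      ∑ x ∈ B, if x ∈ X ∧ ∀ y ∈ X, y - x ≤ D.S ∧ x - y ≤ D.S then potentialSup (D.U X) else 0 := by
    intro X hX
    have hnn : ∀ x ∈ B, (0 : ℝ) ≤ if x ∈ X ∧ ∀ y ∈ X, y - x ≤ D.S ∧ x - y ≤ D.S
        then potentialSup (D.U X) else 0 := fun x _ => by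
      split_ifs; exacts [potentialSup_nonneg X, le_rfl]
    by_cases hr : ∃ x ∈ X, ∃ y ∈ X, (D.S : ℤ) < y - x
    · rw [hD.U_range X hr, abs_zero]
      exact Finset.sum_nonneg hnn
    · push Not at hr
      obtain ⟨_, ⟨x, hx, hxq⟩, y, hy, hyq⟩ := Finset.mem_filter.1 hX
      have hxB : x ∈ B := Finset.mem_Ico.2 ⟨by linarith [hr x hx y hy], hxq⟩
      refine le_trans ?_ (Finset.single_le_sum hnn hxB)
      rw [if_pos ⟨hx, fun z hz => ⟨hr x hx z hz, hr z hz x hx⟩⟩]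
      exact abs_le_potentialSup hD X _
  refine (Finset.abs_sum_le_sum_abs _ _).trans ((Finset.sum_le_sum hbound).trans ?_)
  rw [Finset.sum_comm]
  have hx : ∀ x ∈ B, ∑ X ∈ T, (if x ∈ X ∧ ∀ y ∈ X, y - x ≤ D.S ∧ x - y ≤ D.S
      then potentialSup (D.U X) else 0) ≤ D.normU := by
    intro x _
    rw [← Finset.sum_filter]
    exact sum_potentialSup_le hD x _ fun X hX => (Finset.mem_filter.1 hX).2
  refine (Finset.sum_le_sum hx).trans (le_of_eq ?_)
  simp [B]

/-- Changing the boundary conditions changes a one-cell partition function by a bounded factor. -/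
theorem Z1_le (hD : D.Admissible) (k : ZMod m) (s : ℤ) {a b a' b' : Option (Cell q)} {c : ℝ}
    (h : ∀ τ, -D.β * (D.leftEnergy a τ + D.rightEnergy τ b)
      ≤ -D.β * (D.leftEnergy a' τ + D.rightEnergy τ b') + c) :
    D.Z1 k s a b ≤ Real.exp c * D.Z1 k s a' b' := by
  refine sum_mul_exp_le (fun τ => cellCond_nonneg (hD.prior_pos k) (hD.prior_lt_one k) s τ) ?_
  intro τ
  have := h τ
  linarith

/-- The short-range factor is close to `1`. -/
theorem fs_add_one_bounds (hD : D.Admissible) (k : ZMod m) {s : ℤ} (hs : s ∈ coarseSpins q)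
    (a b : Cell q) :
    0 < D.fs k s a b + 1 ∧ |Real.log (D.fs k s a b + 1)| ≤ 2 * (D.β * (D.S * D.normU)) := by
  have hβ := hD.beta_pos
  set w := D.β * (D.S * D.normU) with hw
  have hE : ∀ τ τ' : Cell q, |D.β * D.pairEnergy τ τ'| ≤ w := fun τ τ' => by
    rw [abs_mul, abs_of_pos hβ]
    exact mul_le_mul_of_nonneg_left (abs_pairEnergy_le hD τ τ') hβ.le
  have e1 := Z1_pos hD k hs (some a) (some b)
  have e2 := Z1_pos hD k hs none (some b)
  have e3 := Z1_pos hD k hs (some a) none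
  have e4 := Z1_pos hD k hs none none
  have hlog : ∀ {x y : ℝ}, 0 < x → 0 < y → x ≤ Real.exp w * y → Real.log x ≤ w + Real.log y := by
    intro x y hx hy h
    have := Real.log_le_log hx h
    rwa [Real.log_mul (Real.exp_pos _).ne' hy.ne', Real.log_exp] at this
  -- Only the left boundary condition is released, once in the presence of `b` and once without it.
  -- Each comparison costs `w`, hence the factor `2`.
  have l1 := hlog e1 e2 (Z1_le hD k s fun τ => by
    simp only [leftEnergy, rightEnergy, Option.elim]; linarith [(abs_le.1 (hE a τ)).1])
  have l2 := hlog e2 e1 (Z1_le hD k s fun τ => by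
    simp only [leftEnergy, rightEnergy, Option.elim]; linarith [(abs_le.1 (hE a τ)).2])
  have l3 := hlog e3 e4 (Z1_le hD k s fun τ => by
    simp only [leftEnergy, rightEnergy, Option.elim]; linarith [(abs_le.1 (hE a τ)).1])
  have l4 := hlog e4 e3 (Z1_le hD k s fun τ => by
    simp only [leftEnergy, rightEnergy, Option.elim]; linarith [(abs_le.1 (hE a τ)).2])
  have hfs : D.fs k s a b + 1 = D.Z1 k s (some a) (some b) * D.Z1 k s none none /
      (D.Z1 k s none (some b) * D.Z1 k s (some a) none) := by rw [fs, sub_add_cancel]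
  rw [hfs]
  refine ⟨by positivity, ?_⟩
  rw [Real.log_div (by positivity) (by positivity), Real.log_mul e1.ne' e4.ne',
    Real.log_mul e2.ne' e3.ne', abs_le]
  constructor <;> linarith

end Model

end ShortRange

/-! ### Oscillation and range of the long-range interaction; mean-field part and fluctuations. -/

section LongRange

set_option linter.unusedSectionVars false

namespace Model

variable {m q : ℕ} [NeZero m] [NeZero q] {D : Model m q}

theorem L_pos (hD : D.Admissible) : 0 < D.L := lt_of_le_of_lt (Nat.cast_nonneg q) hD.q_lt_L

/-- The derivative is continuous on `[0, 2]` and vanishes beyond, so `gradV` is a genuine supremum.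
-/
theorem bddAbove_derivWithin (hD : D.Admissible) :
    BddAbove (Set.range fun r : Set.Ici (0 : ℝ) => |derivWithin D.V (Set.Ici 0) r|) := by
  have hc : ContinuousOn (fun r => |derivWithin D.V (Set.Ici 0) r|) (Set.Icc 0 2) :=
    ((hD.V_contDiff.continuousOn_derivWithin (uniqueDiffOn_Ici 0) le_rfl).mono
      Set.Icc_subset_Ici_self).abs
  obtain ⟨C, hC⟩ := isCompact_Icc.bddAbove_image hc
  refine ⟨max C 0, ?_⟩
  rintro _ ⟨⟨r, hr⟩, rfl⟩
  rcases le_or_gt r 2 with h | h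
  · exact (hC ⟨r, ⟨hr, h⟩, rfl⟩).trans (le_max_left _ _)
  · have hev : D.V =ᶠ[nhdsWithin r (Set.Ici 0)] fun _ => (0 : ℝ) := by
      refine Filter.Eventually.filter_mono nhdsWithin_le_nhds ?_
      filter_upwards [lt_mem_nhds (show (1 : ℝ) < r by linarith)] with x hx
      exact hD.V_support x hx
    have : derivWithin D.V (Set.Ici 0) r = 0 := by
      rw [hev.derivWithin_eq (hD.V_support r (by linarith))]
      simp
    simp [this]

theorem gradV_nonneg : 0 ≤ D.gradV := Real.iSup_nonneg fun _ => abs_nonneg _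

theorem abs_V_sub_le (hD : D.Admissible) {a b : ℝ} (ha : 0 ≤ a) (hb : 0 ≤ b) :
    |D.V a - D.V b| ≤ D.gradV * |a - b| := by
  refine (convex_Ici (0 : ℝ)).norm_image_sub_le_of_norm_derivWithin_le
    (hD.V_contDiff.differentiableOn (by norm_num)) (fun x hx => ?_) hb ha
  exact le_ciSup (bddAbove_derivWithin hD) ⟨x, hx⟩

theorem siteDist_comm (x y : ZMod m × Fin q) : siteDist x y = siteDist y x := by
  unfold siteDist
  rw [← ZMod.natAbs_valMinAbs_neg, neg_sub]

theorem J_comm (D : Model m q) (x y : ZMod m × Fin q) : D.J x y = D.J y x := by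
  unfold J; rw [siteDist_comm]

theorem natAbs_valMinAbs_intCast_le {n : ℕ} [NeZero n] (t : ℤ) :
    (t : ZMod n).valMinAbs.natAbs ≤ t.natAbs :=
  ZMod.natAbs_min_of_le_div_two n _ _ (by simp) (ZMod.natAbs_valMinAbs_le _)

theorem siteDist_le (j k : ZMod m) (i i' a b : Fin q) :
    siteDist (j, i) (k, i') ≤ siteDist (j, a) (k, b) + 2 * q := by
  have : NeZero (m * q) := ⟨mul_ne_zero (NeZero.ne m) (NeZero.ne q)⟩
  unfold siteDist
  simp only
  set t : ℤ := (i.val : ℤ) - a.val - (i'.val - b.val) with ht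
  have h1 : (((j.val * q + i.val : ℕ) : ZMod (m * q)) - ((k.val * q + i'.val : ℕ) : ZMod (m * q)))
      = (((j.val * q + a.val : ℕ) : ZMod (m * q)) - ((k.val * q + b.val : ℕ) : ZMod (m * q)))
        + (t : ZMod (m * q)) := by
    rw [ht]; push_cast; ring
  rw [h1]
  refine (ZMod.natAbs_valMinAbs_add_le _ _).trans ((Int.natAbs_add_le _ _).trans ?_)
  refine Nat.add_le_add_left ((natAbs_valMinAbs_intCast_le t).trans ?_) _
  have := i.2; have := i'.2; have := a.2; have := b.2
  omega

/-- The oscillation of the two-body potential over a pair of cells. -/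
noncomputable def oscJ (D : Model m q) : ℝ := 2 * q * D.gradV / D.L ^ 2

theorem oscJ_nonneg (D : Model m q) : 0 ≤ D.oscJ := by
  have := gradV_nonneg (D := D)
  unfold oscJ; positivity

theorem abs_J_sub_le (hD : D.Admissible) (j k : ZMod m) (i i' a b : Fin q) :
    |D.J (j, i) (k, i') - D.J (j, a) (k, b)| ≤ D.oscJ := by
  have hL := L_pos hD
  unfold J oscJ
  rw [← mul_sub, abs_mul, abs_of_pos (by positivity : 0 < 1 / D.L)]
  have h1 := abs_V_sub_le hD (a := 1 / D.L * (siteDist (j, i) (k, i') : ℝ))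
    (b := 1 / D.L * (siteDist (j, a) (k, b) : ℝ)) (by positivity) (by positivity)
  have h2 : |(siteDist (j, i) (k, i') : ℝ) - siteDist (j, a) (k, b)| ≤ 2 * q := by
    have e1 : (siteDist (j, i) (k, i') : ℝ) ≤ siteDist (j, a) (k, b) + 2 * q := by
      exact_mod_cast siteDist_le j k i i' a b
    have e2 : (siteDist (j, a) (k, b) : ℝ) ≤ siteDist (j, i) (k, i') + 2 * q := by
      exact_mod_cast siteDist_le j k a b i i'
    rw [abs_le]; constructor <;> linarith
  rw [← mul_sub, abs_mul, abs_of_pos (by positivity : 0 < 1 / D.L)] at h1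
  have hg := gradV_nonneg (D := D)
  calc 1 / D.L * |D.V _ - D.V _|
      ≤ 1 / D.L * (D.gradV * (1 / D.L * (2 * q))) := by
        refine mul_le_mul_of_nonneg_left (h1.trans ?_) (by positivity)
        gcongr
    _ = _ := by field_simp

theorem abs_sub_average_le {ι κ : Type*} [Fintype ι] (s : ι → Finset κ) (f : ι → κ → ℝ)
    {a c M : ℝ} (hc : 0 < c) (hcard : ∑ i, ((s i).card : ℝ) = c)
    (h : ∀ i, ∀ j ∈ s i, |a - f i j| ≤ M) : |a - 1 / c * ∑ i, ∑ j ∈ s i, f i j| ≤ M := by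
  have h1 : a - 1 / c * ∑ i, ∑ j ∈ s i, f i j = 1 / c * ∑ i, ∑ j ∈ s i, (a - f i j) := by
    simp only [Finset.sum_sub_distrib, Finset.sum_const, nsmul_eq_mul, ← Finset.sum_mul, hcard]
    field_simp
  rw [h1, abs_mul, abs_of_pos (by positivity), one_div, inv_mul_le_iff₀ hc, ← hcard,
    Finset.sum_mul]
  refine (Finset.abs_sum_le_sum_abs _ _).trans (Finset.sum_le_sum fun i _ => ?_)
  refine (Finset.abs_sum_le_sum_abs _ _).trans ((Finset.sum_le_sum (h i)).trans (le_of_eq ?_))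
  simp

theorem abs_J_sub_barJ_le (hD : D.Admissible) (j k : ZMod m) (x y : Fin q)
    (hxy : (k, y) ≠ (j, x)) : |D.J (j, x) (k, y) - D.barJ j k| ≤ D.oscJ := by
  have hq : (0 : ℝ) < q := by exact_mod_cast NeZero.pos q
  unfold barJ
  split_ifs with h
  · subst h
    have hyx : y ≠ x := fun h => hxy (by rw [h])
    -- Two distinct sites in one cell force `q ≥ 2`, so the normalization of the diagonal average is
    -- not a division by zero.
    have hq2 : 1 < q := by
      have := x.2; have := y.2
      by_contra h
      exact hyx (Fin.ext (by omega))
    have hq2' : (1 : ℝ) < q := by exact_mod_cast hq2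
    refine abs_sub_average_le (fun i : Fin q => Finset.univ.filter fun j => j ≠ i)
      (fun i i' => D.J (j, i) (j, i')) (mul_pos hq (by linarith)) ?_
      fun i i' _ => abs_J_sub_le hD j j x y i i'
    simp only [Finset.filter_ne', Finset.mem_univ, Finset.card_erase_of_mem, Finset.card_univ,
      Fintype.card_fin, Finset.sum_const, nsmul_eq_mul, Nat.cast_sub hq2.le, Nat.cast_one]
  · refine abs_sub_average_le (fun _ : Fin q => Finset.univ)
      (fun i i' => D.J (j, i) (k, i')) (by positivity) ?_
      fun i i' _ => abs_J_sub_le hD j k x y i i'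
    simp [sq]

/-- The number of cells in the range of the long-range interaction, in one direction. -/
noncomputable def nearRadius (D : Model m q) : ℕ := ⌊1 + D.L / q⌋₊

/-- The cells in the range of the long-range interaction with the cell `j`. -/
noncomputable def nearCells (D : Model m q) (j : ZMod m) : Finset (ZMod m) :=
  (Finset.Icc (-(D.nearRadius : ℤ)) D.nearRadius).image fun s : ℤ => j + (s : ZMod m)

/-- The count is at most `2 (1 + L / q) + 1`, and `L / q ≥ 1` absorbs the constants. -/
theorem card_nearCells_le (hD : D.Admissible) (j : ZMod m) :
    ((D.nearCells j).card : ℝ) ≤ 5 * (D.L / q) := by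
  have hq : (0 : ℝ) < q := by exact_mod_cast NeZero.pos q
  have h1 : 1 ≤ D.L / q := by rw [one_le_div hq]; exact hD.q_lt_L.le
  have h2 : (D.nearCells j).card ≤ 2 * D.nearRadius + 1 := by
    refine Finset.card_image_le.trans ?_
    rw [Int.card_Icc]; omega
  have h3 : (D.nearRadius : ℝ) ≤ 1 + D.L / q := Nat.floor_le (by positivity)
  have h4 : ((D.nearCells j).card : ℝ) ≤ 2 * D.nearRadius + 1 := by exact_mod_cast h2
  linarith

theorem mem_nearCells_symm {j k : ZMod m} (h : k ∈ D.nearCells j) : j ∈ D.nearCells k := by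
  obtain ⟨s, hs, rfl⟩ := Finset.mem_image.1 h
  refine Finset.mem_image.2 ⟨-s, ?_, by push_cast; ring⟩
  rw [Finset.mem_Icc] at hs ⊢
  omega

theorem mem_nearCells_of_siteDist {j k : ZMod m} {x y : Fin q}
    (h : (siteDist (j, x) (k, y) : ℝ) ≤ D.L) : k ∈ D.nearCells j := by
  have hq : (0 : ℝ) < q := by exact_mod_cast NeZero.pos q
  have : NeZero (m * q) := ⟨mul_ne_zero (NeZero.ne m) (NeZero.ne q)⟩
  unfold siteDist at h
  simp only at h
  set z : ZMod (m * q) := ((j.val * q + x.val : ℕ) : ZMod (m * q))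
    - ((k.val * q + y.val : ℕ) : ZMod (m * q)) with hz
  set t := z.valMinAbs with ht
  have hzt : (((j.val * q + x.val : ℕ) : ℤ) - ((k.val * q + y.val : ℕ) : ℤ) - t : ℤ)
      ≡ 0 [ZMOD (m * q : ℕ)] := by
    rw [← ZMod.intCast_eq_intCast_iff]
    push_cast
    rw [ht, ZMod.coe_valMinAbs, hz]
    push_cast
    ring
  obtain ⟨c, hc⟩ := Int.modEq_zero_iff_dvd.1 hzt
  -- The cell offset along the shorter way round: the multiple of `m` undoes the wrap-around
  -- implicit in `valMinAbs`. It satisfies `|s| q ≤ L + q`, which explains `nearRadius`.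
  set s : ℤ := k.val - j.val + m * c with hs
  have hsq : s * q = x.val - y.val - t := by
    rw [hs]; push_cast at hc; linarith
  have habs : |(s : ℝ)| * q ≤ D.L + q := by
    have h1 : |(s : ℝ)| * q = |((x.val - y.val - t : ℤ) : ℝ)| := by
      rw [← hsq]; push_cast; rw [abs_mul, abs_of_pos hq]
    have h2 : |(t : ℝ)| ≤ D.L := by
      rw [← Int.cast_abs, Int.abs_eq_natAbs, Int.cast_natCast]; exact h
    have hx : (x.val : ℝ) ≤ q := by exact_mod_cast x.2.le
    have hy : (y.val : ℝ) ≤ q := by exact_mod_cast y.2.le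
    have hx0 : (0 : ℝ) ≤ x.val := Nat.cast_nonneg _
    have hy0 : (0 : ℝ) ≤ y.val := Nat.cast_nonneg _
    rw [h1]
    push_cast
    rw [abs_le] at h2 ⊢
    constructor <;> linarith [h2.1, h2.2]
  have hnat : s.natAbs ≤ D.nearRadius := by
    refine Nat.le_floor ?_
    rw [Nat.cast_natAbs, Int.cast_abs]
    rw [← le_div_iff₀ hq, add_div, div_self hq.ne'] at habs
    linarith
  refine Finset.mem_image.2 ⟨s, by rw [Finset.mem_Icc]; omega, ?_⟩
  rw [hs]
  push_cast
  simp

theorem J_eq_zero_of_far (hD : D.Admissible) {j k : ZMod m} (h : k ∉ D.nearCells j)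
    (x y : Fin q) : D.J (j, x) (k, y) = 0 := by
  have hL := L_pos hD
  unfold J
  rw [hD.V_support, mul_zero]
  have : ¬ (siteDist (j, x) (k, y) : ℝ) ≤ D.L := fun h' => h (mem_nearCells_of_siteDist h')
  rw [one_div, inv_mul_eq_div, one_lt_div hL]
  linarith

theorem barJ_eq_zero_of_far (hD : D.Admissible) {j k : ZMod m} (h : k ∉ D.nearCells j) :
    D.barJ j k = 0 := by
  unfold barJ
  split_ifs with hjk
  · subst hjk; simp [J_eq_zero_of_far hD h]
  · simp [J_eq_zero_of_far hD h]

theorem barJ_comm (D : Model m q) (j k : ZMod m) : D.barJ j k = D.barJ k j := by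
  by_cases h : j = k
  · rw [h]
  · unfold barJ
    rw [if_neg h, if_neg (Ne.symm h), Finset.sum_comm]
    simp only [D.J_comm (j, _)]

/-- The fluctuation of the interaction of two cells around its mean-field value. -/
noncomputable def fluct (D : Model m q) (σ : Config m q) (j k : ZMod m) : ℝ :=
  ∑ x : Fin q, ∑ y : Fin q with (k, y) ≠ (j, x),
    (D.J (j, x) (k, y) - D.barJ j k) * (σ j x : ℤ) * (σ k y : ℤ)

theorem fl_eq (D : Model m q) (j k : ZMod m) (σ : Config m q) :
    D.fl j k σ = Real.exp (D.β / 2 * (D.fluct σ j k * (2 - if j = k then 1 else 0))) - 1 := by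
  unfold fl fluct
  simp only [Finset.sum_mul]

theorem fluct_comm (D : Model m q) (σ : Config m q) (j k : ZMod m) :
    D.fluct σ j k = D.fluct σ k j := by
  unfold fluct
  simp only [Finset.sum_filter]
  rw [Finset.sum_comm]
  refine Finset.sum_congr rfl fun y _ => Finset.sum_congr rfl fun x _ => ?_
  rw [D.J_comm (j, x), D.barJ_comm j]
  by_cases h : (k, y) = (j, x)
  · rw [if_neg (not_not.2 h), if_neg (not_not.2 h.symm)]
  · rw [if_pos h, if_pos (Ne.symm h)]; ring

theorem abs_spin (s : Spin) : |(((s : ℤˣ) : ℤ) : ℝ)| = 1 := by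
  rcases Int.units_eq_one_or s with h | h <;> simp [h]

theorem abs_fluct_le (hD : D.Admissible) (σ : Config m q) (j k : ZMod m) :
    |D.fluct σ j k| ≤ if k ∈ D.nearCells j then q ^ 2 * D.oscJ else 0 := by
  unfold fluct
  split_ifs with h
  · have hx : ∀ x : Fin q, |∑ y : Fin q with (k, y) ≠ (j, x),
        (D.J (j, x) (k, y) - D.barJ j k) * (σ j x : ℤ) * (σ k y : ℤ)| ≤ q * D.oscJ := by
      intro x
      refine (Finset.abs_sum_le_sum_abs _ _).trans ?_
      calc _ ≤ ∑ y : Fin q with (k, y) ≠ (j, x), D.oscJ := by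
            refine Finset.sum_le_sum fun y hy => ?_
            rw [abs_mul, abs_mul, abs_spin, abs_spin, mul_one, mul_one]
            exact abs_J_sub_barJ_le hD j k x y (Finset.mem_filter.1 hy).2
        _ ≤ ∑ y : Fin q, D.oscJ := Finset.sum_le_sum_of_subset_of_nonneg
            (Finset.filter_subset _ _) fun _ _ _ => oscJ_nonneg D
        _ = _ := by simp
    refine (Finset.abs_sum_le_sum_abs _ _).trans
      ((Finset.sum_le_sum fun x _ => hx x).trans (le_of_eq ?_))
    simp; ring
  · simp [J_eq_zero_of_far hD h, barJ_eq_zero_of_far hD h]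

/-- The sum of products of spins over pairs of different sites in two cells. -/
theorem sum_spin_mul_spin (σ : Config m q) (j k : ZMod m) :
    ∑ x : Fin q, ∑ y : Fin q with (k, y) ≠ (j, x), ((σ j x : ℤ) : ℝ) * (σ k y : ℤ)
      = (coarsen σ j : ℝ) * coarsen σ k - if j = k then (q : ℝ) else 0 := by
  have h0 : (coarsen σ j : ℝ) * coarsen σ k
      = ∑ x : Fin q, ∑ y : Fin q, ((σ j x : ℤ) : ℝ) * (σ k y : ℤ) := by
    simp only [coarsen, cellSum, Int.cast_sum, Finset.sum_mul_sum]
  rw [h0, eq_sub_iff_add_eq]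
  have h1 : (if j = k then (q : ℝ) else 0) = ∑ x : Fin q, if j = k then (1 : ℝ) else 0 := by
    split_ifs <;> simp
  rw [h1, ← Finset.sum_add_distrib]
  refine Finset.sum_congr rfl fun x _ => ?_
  rw [← Finset.sum_filter_add_sum_filter_not Finset.univ (fun y : Fin q => (k, y) ≠ (j, x))]
  congr 1
  split_ifs with h
  · subst h
    have : (Finset.univ.filter fun y : Fin q => ¬ (j, y) ≠ (j, x)) = {x} := by ext y; simp
    rw [this, Finset.sum_singleton]
    rcases Int.units_eq_one_or (σ j x) with h | h <;> simp [h]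
  · have : (Finset.univ.filter fun y : Fin q => ¬ (k, y) ≠ (j, x)) = ∅ := by
      ext y; simp [Ne.symm h]
    rw [this, Finset.sum_empty]

/-- The mean-field form of the long-range energy. -/
noncomputable def meanHl (D : Model m q) (η : ZMod m → ℤ) : ℝ :=
  -(1 / 2) * ∑ j : ZMod m, ∑ k : ZMod m,
    D.barJ j k * ((η j : ℝ) * η k - if j = k then (q : ℝ) else 0)

theorem sum_sites (f : ZMod m × Fin q → ZMod m × Fin q → ℝ) :
    ∑ x : ZMod m × Fin q, ∑ y : ZMod m × Fin q with y ≠ x, f x y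
      = ∑ j : ZMod m, ∑ k : ZMod m, ∑ x : Fin q, ∑ y : Fin q with (k, y) ≠ (j, x),
        f (j, x) (k, y) := by
  simp only [Finset.sum_filter, Fintype.sum_prod_type]
  exact Finset.sum_congr rfl fun j _ => Finset.sum_comm

/-- Replacing `J` by its cell average leaves a function of `η` only, since products of spins over
distinct sites sum to products of cell sums, less `q` on the diagonal. -/
theorem Hl_eq (D : Model m q) (σ : Config m q) :
    D.Hl σ = D.meanHl (coarsen σ) - 1 / 2 * ∑ j : ZMod m, ∑ k : ZMod m, D.fluct σ j k := by
  unfold Hl meanHl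
  rw [sum_sites, neg_mul, neg_mul, ← neg_add', ← mul_add, ← Finset.sum_add_distrib]
  congr 2
  refine Finset.sum_congr rfl fun j _ => ?_
  rw [← Finset.sum_add_distrib]
  refine Finset.sum_congr rfl fun k _ => ?_
  rw [← sum_spin_mul_spin, Finset.mul_sum, fluct, ← Finset.sum_add_distrib]
  refine Finset.sum_congr rfl fun x _ => ?_
  rw [Finset.mul_sum, ← Finset.sum_add_distrib]
  exact Finset.sum_congr rfl fun y _ => by ring

theorem sum_abs_fluct_le (hD : D.Admissible) (σ : Config m q) :
    |∑ j : ZMod m, ∑ k : ZMod m, D.fluct σ j k| ≤ m * (10 * q ^ 2 * D.gradV / D.L) := by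
  have hq : (0 : ℝ) < q := by exact_mod_cast NeZero.pos q
  have hL := L_pos hD
  have hj : ∀ j : ZMod m, |∑ k : ZMod m, D.fluct σ j k| ≤ 10 * q ^ 2 * D.gradV / D.L := by
    intro j
    refine (Finset.abs_sum_le_sum_abs _ _).trans
      ((Finset.sum_le_sum fun k _ => abs_fluct_le hD σ j k).trans ?_)
    rw [← Finset.sum_filter, Finset.sum_const, nsmul_eq_mul]
    have h1 : ((Finset.univ.filter fun k => k ∈ D.nearCells j).card : ℝ) ≤ 5 * (D.L / q) := by
      rw [Finset.filter_univ_mem]; exact card_nearCells_le hD j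
    have h2 := oscJ_nonneg D
    -- At most `5 L / q` cells in range, each contributing at most `q ^ 2` pairs of oscillation `2 q
    -- * gradV / L ^ 2`.
    refine (mul_le_mul_of_nonneg_right h1 (by positivity)).trans (le_of_eq ?_)
    unfold oscJ
    field_simp
    ring
  refine (Finset.abs_sum_le_sum_abs _ _).trans
    ((Finset.sum_le_sum fun j _ => hj j).trans (le_of_eq ?_))
  simp [ZMod.card]

end Model

end LongRange

/-! ### The exact density identity, zeroth-order error and relative entropy. -/

section ExactIdentity

set_option linter.unusedSectionVars false

theorem cellCond_comp_perm {q : ℕ} (r : ℝ) (s : ℤ) (τ : Cell q) (π : Equiv.Perm (Fin q)) :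
    cellCond r s (fun i => τ (π i)) = cellCond r s τ := by
  have h1 : cellSum (fun i => τ (π i)) = cellSum τ :=
    Equiv.sum_comp π fun i => ((τ i : Spin) : ℤ)
  have h2 : cellPrior r (fun i => τ (π i)) = cellPrior r τ :=
    Equiv.prod_comp π fun i => if τ i = 1 then r else 1 - r
  unfold cellCond
  rw [h1, h2]

theorem exists_perm_pair {q : ℕ} {x y x' y' : Fin q} (h : y ≠ x) (h' : y' ≠ x') :
    ∃ π : Equiv.Perm (Fin q), π x = x' ∧ π y = y' := by
  refine ⟨Equiv.swap (Equiv.swap x x' y) y' * Equiv.swap x x', ?_, ?_⟩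
  · rw [Equiv.Perm.mul_apply, Equiv.swap_apply_left]
    refine Equiv.swap_apply_of_ne_of_ne (fun h1 => h ?_) h'.symm
    have : Equiv.swap x x' x = Equiv.swap x x' y := by rw [Equiv.swap_apply_left]; exact h1
    exact ((Equiv.swap x x').injective this).symm
  · rw [Equiv.Perm.mul_apply, Equiv.swap_apply_left]

namespace Model

variable {m q : ℕ} [NeZero m] [NeZero q] {D : Model m q}

theorem sum_condPrior_perm (D : Model m q) (η : ZMod m → ℤ) (π : ZMod m → Equiv.Perm (Fin q))
    (g : Config m q → ℝ) :
    ∑ σ, D.condPrior η σ * g (fun k i => σ k (π k i)) = ∑ σ, D.condPrior η σ * g σ := by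
  let e : Config m q ≃ Config m q :=
    Equiv.piCongrRight fun k => Equiv.arrowCongr (π k).symm (Equiv.refl Spin)
  have he : ∀ σ, e σ = fun k i => σ k (π k i) := fun σ => rfl
  rw [← Equiv.sum_comp e fun σ => D.condPrior η σ * g σ]
  refine Finset.sum_congr rfl fun σ _ => ?_
  rw [he]
  congr 1
  exact Finset.prod_congr rfl fun k _ => (cellCond_comp_perm _ _ (σ k) (π k)).symm

/-- The two-point function of the conditional prior is the same for all pairs of different sites of
two given cells. -/
theorem twoPoint_eq (D : Model m q) (η : ZMod m → ℤ) {j k : ZMod m} {x y x' y' : Fin q}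
    (h : (k, y) ≠ (j, x)) (h' : (k, y') ≠ (j, x')) :
    ∑ σ, D.condPrior η σ * (((σ j x : ℤ) : ℝ) * (σ k y : ℤ))
      = ∑ σ, D.condPrior η σ * (((σ j x' : ℤ) : ℝ) * (σ k y' : ℤ)) := by
  obtain ⟨π, h1, h2⟩ : ∃ π : ZMod m → Equiv.Perm (Fin q), π j x = x' ∧ π k y = y' := by
    by_cases hjk : k = j
    · subst hjk
      obtain ⟨π, h1, h2⟩ := exists_perm_pair (x := x) (y := y) (x' := x') (y' := y')
        (fun e => h (by rw [e])) (fun e => h' (by rw [e]))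
      exact ⟨fun _ => π, h1, h2⟩
    · refine ⟨Function.update (fun _ => Equiv.swap x x') k (Equiv.swap y y'), ?_, ?_⟩
      · rw [Function.update_of_ne (Ne.symm hjk), Equiv.swap_apply_left]
      · rw [Function.update_self, Equiv.swap_apply_left]
  rw [← sum_condPrior_perm D η π fun σ => ((σ j x : ℤ) : ℝ) * (σ k y : ℤ)]
  simp only [h1, h2]

theorem sum_J_sub_barJ (D : Model m q) (j k : ZMod m) :
    ∑ x : Fin q, ∑ y : Fin q with (k, y) ≠ (j, x), (D.J (j, x) (k, y) - D.barJ j k) = 0 := by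
  have hq : (0 : ℝ) < q := by exact_mod_cast NeZero.pos q
  simp only [Finset.sum_sub_distrib, Finset.sum_const, nsmul_eq_mul]
  unfold barJ
  split_ifs with h
  · subst h
    have hf : ∀ x : Fin q, (Finset.univ.filter fun y : Fin q => (j, y) ≠ (j, x))
        = Finset.univ.filter fun y => y ≠ x := fun x => by ext y; simp
    simp only [hf]
    -- For `q = 1` the diagonal has no pairs, and the division by zero in `barJ` is harmless.
    rcases (Nat.one_le_iff_ne_zero.2 (NeZero.ne q)).eq_or_lt with h1 | h1
    · subst h1
      simp [Subsingleton.elim _ (0 : Fin 1)]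
    · have hq2 : (0 : ℝ) < (q : ℝ) - 1 := by
        have : (1 : ℝ) < q := by exact_mod_cast h1
        linarith
      simp only [Finset.filter_ne', Finset.mem_univ, Finset.card_erase_of_mem, Finset.card_univ,
        Fintype.card_fin, Finset.sum_const, nsmul_eq_mul, Nat.cast_sub h1.le, Nat.cast_one]
      field_simp
      ring
  · have hf : ∀ x : Fin q, (Finset.univ.filter fun y : Fin q => (k, y) ≠ (j, x))
        = Finset.univ := fun x => by ext y; simp [Ne.symm h]
    simp only [hf, Finset.card_univ, Fintype.card_fin, Finset.sum_const, nsmul_eq_mul]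
    field_simp
    ring

/-- Exchangeability pulls one common two-point function out of the sum, and what remains is the sum
of `J - barJ`, which vanishes. -/
theorem sum_condPrior_fluct (D : Model m q) (η : ZMod m → ℤ) (j k : ZMod m) :
    ∑ σ, D.condPrior η σ * D.fluct σ j k = 0 := by
  unfold fluct
  have h1 : ∑ σ, D.condPrior η σ * ∑ x : Fin q, ∑ y : Fin q with (k, y) ≠ (j, x),
      (D.J (j, x) (k, y) - D.barJ j k) * (σ j x : ℤ) * (σ k y : ℤ)
      = ∑ x : Fin q, ∑ y : Fin q with (k, y) ≠ (j, x), (D.J (j, x) (k, y) - D.barJ j k) *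
        ∑ σ, D.condPrior η σ * (((σ j x : ℤ) : ℝ) * (σ k y : ℤ)) := by
    simp only [Finset.mul_sum]
    rw [Finset.sum_comm]
    refine Finset.sum_congr rfl fun x _ => ?_
    rw [Finset.sum_comm]
    exact Finset.sum_congr rfl fun y _ => Finset.sum_congr rfl fun σ _ => by ring
  rw [h1]
  by_cases hex : ∃ x y : Fin q, (k, y) ≠ (j, x)
  · obtain ⟨x₀, y₀, h₀⟩ := hex
    have h2 : ∀ x : Fin q, ∑ y : Fin q with (k, y) ≠ (j, x), (D.J (j, x) (k, y) - D.barJ j k) *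
        ∑ σ, D.condPrior η σ * (((σ j x : ℤ) : ℝ) * (σ k y : ℤ))
        = (∑ y : Fin q with (k, y) ≠ (j, x), (D.J (j, x) (k, y) - D.barJ j k)) *
          ∑ σ, D.condPrior η σ * (((σ j x₀ : ℤ) : ℝ) * (σ k y₀ : ℤ)) := by
      intro x
      rw [Finset.sum_mul]
      refine Finset.sum_congr rfl fun y hy => ?_
      rw [twoPoint_eq D η (Finset.mem_filter.1 hy).2 h₀]
    simp only [h2]
    rw [← Finset.sum_mul, sum_J_sub_barJ, zero_mul]
  · push Not at hex
    refine Finset.sum_eq_zero fun x _ => Finset.sum_eq_zero fun y hy => ?_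
    exact absurd (hex x y) (Finset.mem_filter.1 hy).2

theorem condE_of_coarsen (hD : D.Admissible) {η : ZMod m → ℤ} (hη : η ∈ coarseConfigs m q)
    (g : (ZMod m → ℤ) → ℝ) : ∑ σ, D.condPrior η σ * g (coarsen σ) = g η := by
  have : ∀ σ, D.condPrior η σ * g (coarsen σ) = D.condPrior η σ * g η := by
    intro σ
    by_cases h : coarsen σ = η
    · rw [h]
    · rw [condPrior_of_ne h, zero_mul, zero_mul]
  simp only [this]
  rw [← Finset.sum_mul, sum_condPrior hD hη, one_mul]

theorem barHl0_eq (hD : D.Admissible) {η : ZMod m → ℤ} (hη : η ∈ coarseConfigs m q) :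
    D.barHl0 η = D.meanHl η := by
  unfold barHl0
  rw [condE_eq]
  simp only [Hl_eq, mul_sub, Finset.sum_sub_distrib]
  rw [condE_of_coarsen hD hη]
  have : ∑ σ, D.condPrior η σ * (1 / 2 * ∑ j : ZMod m, ∑ k : ZMod m, D.fluct σ j k)
      = 1 / 2 * ∑ j : ZMod m, ∑ k : ZMod m, ∑ σ, D.condPrior η σ * D.fluct σ j k := by
    simp only [Finset.mul_sum]
    rw [Finset.sum_comm]
    refine Finset.sum_congr rfl fun j _ => ?_
    rw [Finset.sum_comm]
    exact Finset.sum_congr rfl fun k _ => Finset.sum_congr rfl fun σ _ => by ring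
  rw [this]
  simp [sum_condPrior_fluct]

theorem meanHl_eq (D : Model m q) (η : ZMod m → ℤ) :
    D.meanHl η =
      -(1 / 2) * ∑ k : ZMod m, ∑ l : ZMod m with l ≠ k, D.barJ k l * (η k : ℝ) * (η l : ℝ)
      - (1 / 2) * ∑ k : ZMod m, D.barJ k k * ((η k : ℝ) ^ 2 - (q : ℝ)) := by
  unfold meanHl
  rw [neg_mul, neg_mul, ← neg_add', ← mul_add, ← Finset.sum_add_distrib]
  congr 2
  refine Finset.sum_congr rfl fun j _ => ?_
  rw [Finset.filter_ne', ← Finset.sum_erase_add _ _ (Finset.mem_univ j)]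
  congr 1
  · refine Finset.sum_congr rfl fun l hl => ?_
    rw [if_neg (Finset.ne_of_mem_erase hl).symm, sub_zero, mul_assoc]
  · rw [if_pos rfl, sq]

theorem prod_even_succ (hD : D.Admissible) (f : ZMod m → ℝ) :
    ∏ k : ZMod m with Even k.val, f (k + 1) = ∏ k : ZMod m with Odd k.val, f k := by
  refine Finset.prod_nbij' (fun k => k + 1) (fun k => k - 1) ?_ ?_ ?_ ?_ ?_
  · intro k hk
    have := (Finset.mem_filter.1 hk).2
    simp only [Finset.mem_filter, Finset.mem_univ, true_and]
    rw [odd_val_add_one hD.even_m hD.four_le_m, Nat.not_odd_iff_even]; exact this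
  · intro k hk
    have := (Finset.mem_filter.1 hk).2
    simp only [Finset.mem_filter, Finset.mem_univ, true_and]
    rw [← Nat.not_odd_iff_even, odd_val_sub_one hD.even_m hD.four_le_m, not_not]; exact this
  · intro k _; ring
  · intro k _; ring
  · intro k _; rfl

theorem prod_even_pred (hD : D.Admissible) (f : ZMod m → ℝ) :
    ∏ k : ZMod m with Even k.val, f (k - 1) = ∏ k : ZMod m with Odd k.val, f k := by
  refine Finset.prod_nbij' (fun k => k - 1) (fun k => k + 1) ?_ ?_ ?_ ?_ ?_
  · intro k hk
    have := (Finset.mem_filter.1 hk).2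
    simp only [Finset.mem_filter, Finset.mem_univ, true_and]
    rw [odd_val_sub_one hD.even_m hD.four_le_m, Nat.not_odd_iff_even]; exact this
  · intro k hk
    have := (Finset.mem_filter.1 hk).2
    simp only [Finset.mem_filter, Finset.mem_univ, true_and]
    rw [← Nat.not_odd_iff_even, odd_val_add_one hD.even_m hD.four_le_m, not_not]; exact this
  · intro k _; ring
  · intro k _; ring
  · intro k _; rfl

theorem prod_odd_mul_prod_even (f : ZMod m → ℝ) :
    (∏ k : ZMod m with Odd k.val, f k) * ∏ k : ZMod m with Even k.val, f k = ∏ k, f k := by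
  rw [← Finset.prod_filter_mul_prod_filter_not Finset.univ (fun k : ZMod m => Odd k.val)]
  congr 1
  exact Finset.prod_congr (by ext k; simp) fun _ _ => rfl

/-- Explains the weight `2 - δ_{jk}` in the long-range factors: an off-diagonal pair stands for both
of its orderings. -/
theorem sum_pairs_of_symm (F : ZMod m → ZMod m → ℝ) (hF : ∀ j k, F j k = F k j) :
    ∑ e : {e : ZMod m × ZMod m // e.1.val ≤ e.2.val},
        F e.1.1 e.1.2 * (2 - if e.1.1 = e.1.2 then 1 else 0) = ∑ j, ∑ k, F j k := by
  have h1 : ∑ e : {e : ZMod m × ZMod m // e.1.val ≤ e.2.val},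
        F e.1.1 e.1.2 * (2 - if e.1.1 = e.1.2 then 1 else 0)
      = ∑ e : ZMod m × ZMod m with e.1.val ≤ e.2.val,
        F e.1 e.2 * (2 - if e.1 = e.2 then 1 else 0) :=
    (Finset.sum_subtype _ (by simp) fun e : ZMod m × ZMod m =>
      F e.1 e.2 * (2 - if e.1 = e.2 then 1 else 0)).symm
  have h2 : ∑ e : ZMod m × ZMod m with ¬ e.1.val ≤ e.2.val, F e.1 e.2
      = ∑ e : ZMod m × ZMod m with e.1.val ≤ e.2.val, F e.1 e.2 * (1 - if e.1 = e.2 then 1 else 0) := by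
    have h3 : ∑ e : ZMod m × ZMod m with e.1.val ≤ e.2.val,
        F e.1 e.2 * (1 - if e.1 = e.2 then 1 else 0)
        = ∑ e : ZMod m × ZMod m with e.1.val ≤ e.2.val, if ¬ e.1 = e.2 then F e.1 e.2 else 0 :=
      Finset.sum_congr rfl fun e _ => by split_ifs <;> simp
    rw [h3, ← Finset.sum_filter, Finset.filter_filter]
    refine Finset.sum_nbij' Prod.swap Prod.swap ?_ ?_ ?_ ?_ ?_
    · rintro ⟨j, k⟩ h
      simp only [Finset.mem_filter, Finset.mem_univ, true_and, not_le, Prod.swap] at h ⊢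
      exact ⟨h.le, fun e => by rw [e] at h; exact lt_irrefl _ h⟩
    · rintro ⟨j, k⟩ h
      simp only [Finset.mem_filter, Finset.mem_univ, true_and, not_le, Prod.swap] at h ⊢
      exact lt_of_le_of_ne h.1 fun e => h.2 (ZMod.val_injective m e)
    · intro _ _; rfl
    · intro _ _; rfl
    · rintro ⟨j, k⟩ _; exact hF j k
  rw [h1, ← Fintype.sum_prod_type', ← Finset.sum_filter_add_sum_filter_not Finset.univ
    (fun e : ZMod m × ZMod m => e.1.val ≤ e.2.val), h2, ← Finset.sum_add_distrib]
  exact Finset.sum_congr rfl fun e _ => by ring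

/-- The product of all bond factors. -/
theorem prod_one_add_bondFactor (D : Model m q) (η : ZMod m → ℤ) (σ : Config m q) :
    ∏ b : Bond m, (1 + D.bondFactor η σ b)
      = (∏ k : ZMod m with Odd k.val, (D.fs k (η k) (σ (k - 1)) (σ (k + 1)) + 1)) *
        Real.exp (D.β / 2 * ∑ j : ZMod m, ∑ k : ZMod m, D.fluct σ j k) := by
  rw [Fintype.prod_sum_type]
  congr 1
  · rw [Finset.prod_subtype (p := fun k : ZMod m => Odd k.val) _ (by simp)
      fun k : ZMod m => (D.fs k (η k) (σ (k - 1)) (σ (k + 1)) + 1)]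
    exact Finset.prod_congr rfl fun k _ => add_comm _ _
  · rw [← sum_pairs_of_symm (fun j k => D.fluct σ j k) (D.fluct_comm σ), Finset.mul_sum,
      Real.exp_sum]
    refine Finset.prod_congr rfl fun e _ => ?_
    simp only [bondFactor]
    rw [fl_eq, add_sub_cancel]

/-- The energy of an odd cell, with its interactions with the neighbouring cells. -/
noncomputable def oddEnergy (D : Model m q) (σ : Config m q) (k : ZMod m) : ℝ :=
  D.cellEnergy (σ k) + D.pairEnergy (σ (k - 1)) (σ k) + D.pairEnergy (σ k) (σ (k + 1))

/-- Of two adjacent cells exactly one is odd, and their interaction is charged to it; interactions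
indexed by an even left cell are reindexed by its right neighbour. -/
theorem exp_Hs (hD : D.Admissible) (σ : Config m q) :
    Real.exp (-D.β * D.Hs σ)
      = (∏ k : ZMod m with Odd k.val, Real.exp (-D.β * D.oddEnergy σ k)) *
        ∏ k : ZMod m with Even k.val, Real.exp (-D.β * D.cellEnergy (σ k)) := by
  have h := prod_even_succ hD fun k => Real.exp (-D.β * D.pairEnergy (σ (k - 1)) (σ k))
  simp only [add_sub_cancel_right] at h
  rw [Hs_eq hD, Finset.mul_sum, Real.exp_sum, ← prod_odd_mul_prod_even]
  simp only [mul_add, Real.exp_add, oddEnergy, Finset.prod_mul_distrib]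
  rw [h]
  ring

theorem exp_barHs0 (hD : D.Admissible) {η : ZMod m → ℤ} (hη : η ∈ coarseConfigs m q) :
    Real.exp (-D.β * D.barHs0 η)
      = (∏ k : ZMod m with Even k.val, D.Z3 k (η (k - 1)) (η k) (η (k + 1))) /
        ∏ k : ZMod m with Odd k.val, D.Z1 k (η k) none none := by
  have hβ := hD.beta_pos.ne'
  unfold barHs0 U3 U1
  rw [← Finset.mul_sum, ← Finset.mul_sum, ← mul_sub, ← mul_assoc,
    show -D.β * -(1 / D.β) = 1 by field_simp, one_mul, Real.exp_sub, Real.exp_sum, Real.exp_sum]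
  congr 1
  · exact Finset.prod_congr rfl fun k _ => Real.exp_log (Z3_pos hD k (mem_coarseSpins hη (k - 1))
      (mem_coarseSpins hη k) (mem_coarseSpins hη (k + 1)))
  · exact Finset.prod_congr rfl fun k _ => Real.exp_log (Z1_pos hD k (mem_coarseSpins hη k) _ _)

/-- The one-sided `Z1` attached to even cells are moved to the odd cells they refer to, where they
match the denominators of `fs`. -/
theorem refMeasure_eq (hD : D.Admissible) (η : ZMod m → ℤ) (σ : Config m q) :
    D.refMeasure η σ = (∏ k : ZMod m with Odd k.val, Real.exp (-D.β * D.oddEnergy σ k)) /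
        (∏ k : ZMod m with Odd k.val, D.Z1 k (η k) (some (σ (k - 1))) (some (σ (k + 1)))) *
      ((∏ k : ZMod m with Even k.val, Real.exp (-D.β * D.cellEnergy (σ k))) *
        (∏ k : ZMod m with Odd k.val, D.Z1 k (η k) (some (σ (k - 1))) none) *
        (∏ k : ZMod m with Odd k.val, D.Z1 k (η k) none (some (σ (k + 1)))) /
        ∏ k : ZMod m with Even k.val, D.Z3 k (η (k - 1)) (η k) (η (k + 1))) *
      D.condPrior η σ := by
  have h1 := prod_even_succ hD fun k => D.Z1 k (η k) (some (σ (k - 1))) none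
  have h2 := prod_even_pred hD fun k => D.Z1 k (η k) none (some (σ (k + 1)))
  simp only [add_sub_cancel_right] at h1
  simp only [sub_add_cancel] at h2
  unfold refMeasure condPrior
  rw [← h1, ← h2, ← prod_odd_mul_prod_even]
  simp only [Finset.prod_mul_distrib, Finset.prod_div_distrib, oddEnergy]
  ring

/-- Off the fibre of `η` both sides vanish. On it, all partition functions cancel between `ν`, the
short-range factors and `exp (-β * barHs0)`. -/
theorem density_identity (hD : D.Admissible) {η : ZMod m → ℤ} (hη : η ∈ coarseConfigs m q)
    (σ : Config m q) :
    D.condPrior η σ * Real.exp (-D.β * D.H σ)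
      = Real.exp (-D.β * D.barH0 η) *
        (D.refMeasure η σ * ∏ b : Bond m, (1 + D.bondFactor η σ b)) := by
  by_cases hσ : coarsen σ = η
  swap
  · rw [refMeasure_eq hD, condPrior_of_ne hσ]; ring
  have hH : Real.exp (-D.β * D.H σ) = Real.exp (-D.β * D.Hs σ) *
      (Real.exp (-D.β * D.meanHl η) *
        Real.exp (D.β / 2 * ∑ j : ZMod m, ∑ k : ZMod m, D.fluct σ j k)) := by
    rw [← Real.exp_add, ← Real.exp_add, H, Hl_eq, hσ]
    congr 1; ring
  have hH0 : Real.exp (-D.β * D.barH0 η)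
      = Real.exp (-D.β * D.meanHl η) * Real.exp (-D.β * D.barHs0 η) := by
    rw [← Real.exp_add, barH0, barHl0_eq hD hη]
    congr 1; ring
  have hfs : ∏ k : ZMod m with Odd k.val, (D.fs k (η k) (σ (k - 1)) (σ (k + 1)) + 1)
      = (∏ k : ZMod m with Odd k.val, D.Z1 k (η k) (some (σ (k - 1))) (some (σ (k + 1)))) *
        (∏ k : ZMod m with Odd k.val, D.Z1 k (η k) none none) /
        ((∏ k : ZMod m with Odd k.val, D.Z1 k (η k) none (some (σ (k + 1)))) *
          ∏ k : ZMod m with Odd k.val, D.Z1 k (η k) (some (σ (k - 1))) none) := by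
    simp only [fs, sub_add_cancel, Finset.prod_mul_distrib, Finset.prod_div_distrib]
  have hZ : ∀ a b : ZMod m → Option (Cell q),
      ∏ k : ZMod m with Odd k.val, D.Z1 k (η k) (a k) (b k) ≠ 0 := fun a b =>
    (Finset.prod_pos fun k _ => Z1_pos hD k (mem_coarseSpins hη k) _ _).ne'
  have z1 := hZ (fun k => some (σ (k - 1))) (fun k => some (σ (k + 1)))
  have z2 := hZ (fun k => some (σ (k - 1))) (fun _ => none)
  have z3 := hZ (fun _ => none) (fun k => some (σ (k + 1)))
  have z4 := hZ (fun _ => none) (fun _ => none)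
  have z5 : ∏ k : ZMod m with Even k.val, D.Z3 k (η (k - 1)) (η k) (η (k + 1)) ≠ 0 :=
    (Finset.prod_pos fun k _ => Z3_pos hD k (mem_coarseSpins hη (k - 1))
      (mem_coarseSpins hη k) (mem_coarseSpins hη (k + 1))).ne'
  rw [hH, hH0, prod_one_add_bondFactor, hfs, exp_Hs hD, exp_barHs0 hD hη, refMeasure_eq hD]
  field_simp

/-- The correction factor: the mean of the product of all factors `1 + f`. -/
noncomputable def corrFactor (D : Model m q) (η : ZMod m → ℤ) : ℝ :=
  ∑ σ, D.refMeasure η σ * ∏ b : Bond m, (1 + D.bondFactor η σ b)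

theorem condE_exp (hD : D.Admissible) {η : ZMod m → ℤ} (hη : η ∈ coarseConfigs m q) :
    D.condE (fun σ => Real.exp (-D.β * D.H σ)) η
      = Real.exp (-D.β * D.barH0 η) * D.corrFactor η := by
  rw [condE_eq, corrFactor, Finset.mul_sum]
  exact Finset.sum_congr rfl fun σ _ => density_identity hD hη σ

theorem corrFactor_bounds (hD : D.Admissible) {η : ZMod m → ℤ} (hη : η ∈ coarseConfigs m q) :
    0 < D.corrFactor η ∧ |Real.log (D.corrFactor η)| ≤ ((m * q : ℕ) : ℝ) * (5 * D.delta) := by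
  have hβ := hD.beta_pos
  have hq : (0 : ℝ) < q := by exact_mod_cast NeZero.pos q
  have hL := L_pos hD
  set t := ((m * q : ℕ) : ℝ) * (5 * D.delta) with ht
  have hU := normU_nonneg (D := D)
  have hV := gradV_nonneg (D := D)
  have hkey : ∀ σ, ∃ x : ℝ, ∏ b : Bond m, (1 + D.bondFactor η σ b) = Real.exp x ∧ |x| ≤ t := by
    intro σ
    have hb := fun k : ZMod m => fs_add_one_bounds hD k (mem_coarseSpins hη k) (σ (k - 1))
      (σ (k + 1))
    refine ⟨(∑ k : ZMod m with Odd k.val, Real.log (D.fs k (η k) (σ (k - 1)) (σ (k + 1)) + 1)) +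
      D.β / 2 * ∑ j : ZMod m, ∑ k : ZMod m, D.fluct σ j k, ?_, ?_⟩
    · rw [prod_one_add_bondFactor, Real.exp_add, Real.exp_sum]
      congr 1
      exact Finset.prod_congr rfl fun k _ => (Real.exp_log (hb k).1).symm
    · have h1 : |∑ k : ZMod m with Odd k.val, Real.log (D.fs k (η k) (σ (k - 1)) (σ (k + 1)) + 1)|
          ≤ m * (2 * (D.β * (D.S * D.normU))) := by
        refine (Finset.abs_sum_le_sum_abs _ _).trans
          ((Finset.sum_le_sum fun k _ => (hb k).2).trans ?_)
        rw [Finset.sum_const, nsmul_eq_mul]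
        refine mul_le_mul_of_nonneg_right ?_ (by positivity)
        exact_mod_cast (Finset.card_le_univ _).trans (by rw [ZMod.card])
      have h2 : |D.β / 2 * ∑ j : ZMod m, ∑ k : ZMod m, D.fluct σ j k|
          ≤ D.β / 2 * (m * (10 * q ^ 2 * D.gradV / D.L)) := by
        rw [abs_mul, abs_of_pos (by positivity : 0 < D.β / 2)]
        exact mul_le_mul_of_nonneg_left (sum_abs_fluct_le hD σ) (by positivity)
      refine (abs_add_le _ _).trans ((add_le_add h1 h2).trans ?_)
      -- The long-range term needs exactly the constant `5 = 10 / 2`; the short-range term would do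
      -- with `2`.
      have h3 : t = m * (5 * (D.β * (D.S * D.normU)))
          + D.β / 2 * (m * (10 * q ^ 2 * D.gradV / D.L)) := by
        rw [ht, delta]; push_cast; field_simp; ring
      rw [h3]
      have : 0 ≤ D.β * (D.S * D.normU) := by positivity
      gcongr
      norm_num
  have hup : D.corrFactor η ≤ Real.exp t := by
    rw [← mul_one (Real.exp t), ← sum_refMeasure hD hη, Finset.mul_sum]
    refine Finset.sum_le_sum fun σ _ => ?_
    obtain ⟨x, hx, hxt⟩ := hkey σ
    rw [hx, mul_comm]
    exact mul_le_mul_of_nonneg_right (Real.exp_le_exp.2 (abs_le.1 hxt).2)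
      (refMeasure_nonneg hD hη σ)
  have hlow : Real.exp (-t) ≤ D.corrFactor η := by
    rw [← mul_one (Real.exp (-t)), ← sum_refMeasure hD hη, Finset.mul_sum]
    refine Finset.sum_le_sum fun σ _ => ?_
    obtain ⟨x, hx, hxt⟩ := hkey σ
    rw [hx, mul_comm (D.refMeasure η σ)]
    exact mul_le_mul_of_nonneg_right (Real.exp_le_exp.2 (abs_le.1 hxt).1)
      (refMeasure_nonneg hD hη σ)
  have hpos := (Real.exp_pos (-t)).trans_le hlow
  refine ⟨hpos, abs_le.2 ⟨?_, ?_⟩⟩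
  · rw [Real.le_log_iff_exp_le hpos]; exact hlow
  · rw [Real.log_le_iff_le_exp hpos]; exact hup

theorem barH_sub_barH0 (hD : D.Admissible) {η : ZMod m → ℤ} (hη : η ∈ coarseConfigs m q) :
    D.barH η - D.barH0 η = -(1 / D.β) * Real.log (D.corrFactor η) := by
  have hβ := hD.beta_pos.ne'
  rw [barH, condE_exp hD hη, Real.log_mul (Real.exp_pos _).ne' (corrFactor_bounds hD hη).1.ne',
    Real.log_exp]
  field_simp
  ring

theorem abs_barH_sub_barH0_le (hD : D.Admissible) {η : ZMod m → ℤ}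
    (hη : η ∈ coarseConfigs m q) :
    D.β * |D.barH η - D.barH0 η| ≤ ((m * q : ℕ) : ℝ) * (5 * D.delta) := by
  have hβ := hD.beta_pos
  rw [barH_sub_barH0 hD hη, abs_mul, abs_neg, abs_of_pos (by positivity : 0 < 1 / D.β),
    ← mul_assoc, mul_one_div_cancel hβ.ne', one_mul]
  exact (corrFactor_bounds hD hη).2

end Model

/-- Each logarithm of the density ratio is bounded by `2 t`: one `t` for the weights and one for the
normalizations, which inherit the comparison by summation. -/
theorem abs_relEntropy_le {α : Type*} {s : Finset α} (hs : s.Nonempty) {a b : α → ℝ} {t : ℝ}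
    (ha : ∀ x ∈ s, 0 < a x) (hb : ∀ x ∈ s, 0 < b x) (hab : ∀ x ∈ s, a x ≤ Real.exp t * b x)
    (hba : ∀ x ∈ s, b x ≤ Real.exp t * a x) :
    |relEntropy s (fun x => a x / ∑ y ∈ s, a y) (fun x => b x / ∑ y ∈ s, b y)| ≤ 2 * t := by
  have hA : 0 < ∑ y ∈ s, a y := Finset.sum_pos ha hs
  have hB : 0 < ∑ y ∈ s, b y := Finset.sum_pos hb hs
  have hAB : ∑ y ∈ s, a y ≤ Real.exp t * ∑ y ∈ s, b y := by
    rw [Finset.mul_sum]; exact Finset.sum_le_sum hab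
  have hBA : ∑ y ∈ s, b y ≤ Real.exp t * ∑ y ∈ s, a y := by
    rw [Finset.mul_sum]; exact Finset.sum_le_sum hba
  have hlog : ∀ {x y : ℝ}, 0 < x → 0 < y → x ≤ Real.exp t * y → Real.log x ≤ t + Real.log y := by
    intro x y hx hy h
    have := Real.log_le_log hx h
    rwa [Real.log_mul (Real.exp_pos _).ne' hy.ne', Real.log_exp] at this
  have l1 := hlog hA hB hAB
  have l2 := hlog hB hA hBA
  unfold relEntropy
  calc |∑ x ∈ s, a x / (∑ y ∈ s, a y) *
        Real.log (a x / (∑ y ∈ s, a y) / (b x / ∑ y ∈ s, b y))|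
      ≤ ∑ x ∈ s, a x / (∑ y ∈ s, a y) * (2 * t) := by
        refine (Finset.abs_sum_le_sum_abs _ _).trans (Finset.sum_le_sum fun x hx => ?_)
        have hax := ha x hx
        have hbx := hb x hx
        rw [abs_mul, abs_of_pos (by positivity)]
        refine mul_le_mul_of_nonneg_left ?_ (by positivity)
        rw [Real.log_div (by positivity) (by positivity), Real.log_div hax.ne' hA.ne',
          Real.log_div hbx.ne' hB.ne', abs_le]
        have l3 := hlog hax hbx (hab x hx)
        have l4 := hlog hbx hax (hba x hx)
        constructor <;> linarith
    _ = 2 * t := by rw [← Finset.sum_mul, ← Finset.sum_div, div_self hA.ne', one_mul]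

namespace Model

variable {m q : ℕ} [NeZero m] [NeZero q] {D : Model m q}

theorem sum_fiber (D : Model m q) (hD : D.Admissible) {η : ZMod m → ℤ}
    (hη : η ∈ coarseConfigs m q) :
    ∑ σ : Config m q with coarsen σ = η, Real.exp (-D.β * D.H σ) * D.P σ
      = Real.exp (-D.β * D.barH η) * D.coarseP η := by
  have hP := coarseP_pos hD hη
  have hc := condE_exp hD hη
  have hpos : 0 < D.condE (fun σ => Real.exp (-D.β * D.H σ)) η := by
    rw [hc]; exact mul_pos (Real.exp_pos _) (corrFactor_bounds hD hη).1
  have hβ := hD.beta_pos.ne'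
  rw [barH, ← mul_assoc, show -D.β * -(1 / D.β) = 1 by field_simp, one_mul, Real.exp_log hpos,
    condE, div_mul_cancel₀ _ hP.ne']
  exact Finset.sum_congr rfl fun σ _ => mul_comm _ _

theorem coarseGibbs_eq (hD : D.Admissible) {η : ZMod m → ℤ} (hη : η ∈ coarseConfigs m q) :
    D.coarseGibbs η = Real.exp (-D.β * D.barH η) * D.coarseP η /
      ∑ η' ∈ coarseConfigs m q, Real.exp (-D.β * D.barH η') * D.coarseP η' := by
  unfold coarseGibbs gibbs
  rw [← Finset.sum_div, sum_fiber D hD hη]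
  congr 1
  rw [← Finset.sum_fiberwise_of_maps_to (s := Finset.univ) (t := coarseConfigs m q)
    (g := coarsen) fun σ _ => coarsen_mem σ]
  exact Finset.sum_congr rfl fun η' hη' => sum_fiber D hD hη'

theorem abs_relEntropy_coarseGibbs_le (hD : D.Admissible) :
    |relEntropy (coarseConfigs m q) D.coarseGibbs0 D.coarseGibbs|
      ≤ 2 * (((m * q : ℕ) : ℝ) * (5 * D.delta)) := by
  have h1 : relEntropy (coarseConfigs m q) D.coarseGibbs0 D.coarseGibbs
      = relEntropy (coarseConfigs m q)
        (fun η => Real.exp (-D.β * D.barH0 η) * D.coarseP η /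
          ∑ η' ∈ coarseConfigs m q, Real.exp (-D.β * D.barH0 η') * D.coarseP η')
        (fun η => Real.exp (-D.β * D.barH η) * D.coarseP η /
          ∑ η' ∈ coarseConfigs m q, Real.exp (-D.β * D.barH η') * D.coarseP η') := by
    unfold relEntropy
    refine Finset.sum_congr rfl fun η hη => ?_
    rw [coarseGibbs_eq hD hη]
    rfl
  rw [h1]
  have hβ := hD.beta_pos
  have hle : ∀ η ∈ coarseConfigs m q,
      |D.β * D.barH η - D.β * D.barH0 η| ≤ ((m * q : ℕ) : ℝ) * (5 * D.delta) := by
    intro η hη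
    rw [← mul_sub, abs_mul, abs_of_pos hβ]
    exact abs_barH_sub_barH0_le hD hη
  refine abs_relEntropy_le ⟨_, coarsen_mem (fun _ _ => 1)⟩
    (fun η hη => mul_pos (Real.exp_pos _) (coarseP_pos hD hη))
    (fun η hη => mul_pos (Real.exp_pos _) (coarseP_pos hD hη)) (fun η hη => ?_) fun η hη => ?_
  all_goals
    rw [← mul_assoc, ← Real.exp_add]
    refine mul_le_mul_of_nonneg_right (Real.exp_le_exp.2 ?_) (coarseP_pos hD hη).le
    have := abs_le.1 (hle η hη)
    linarith [this.1, this.2]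

end Model

end ExactIdentity

/-! ### Smallness of the bond weights and convergence of the cluster expansion. -/

section ClusterExpansion

set_option linter.unusedSectionVars false

namespace Model

variable {m q : ℕ} [NeZero m] [NeZero q] {D : Model m q}

open Classical in
/-- Uniform bounds for the bond factors: `ε` for a short-range bond, and `ε q / L` for a long-range
bond between cells in the range of the interaction. -/
noncomputable def bondBound (D : Model m q) (ε : ℝ) : Bond m → ℝ
  | Sum.inl _ => ε
  | Sum.inr e => if e.1.2 ∈ D.nearCells e.1.1 then ε * (q / D.L) else 0

theorem bondBound_nonneg (hD : D.Admissible) {ε : ℝ} (hε : 0 ≤ ε) (b : Bond m) :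
    0 ≤ D.bondBound ε b := by
  have := L_pos hD
  rcases b with k | e
  · exact hε
  · simp only [bondBound]; split_ifs <;> positivity

theorem sum_nearCells_le (hD : D.Admissible) {ε : ℝ} (hε : 0 ≤ ε) (j : ZMod m) :
    ∑ k : ZMod m, (if k ∈ D.nearCells j then ε * (q / D.L) else 0) ≤ 5 * ε := by
  have hL := L_pos hD
  have hq : (0 : ℝ) < q := by exact_mod_cast NeZero.pos q
  rw [← Finset.sum_filter, Finset.filter_univ_mem, Finset.sum_const, nsmul_eq_mul]
  refine (mul_le_mul_of_nonneg_right (card_nearCells_le hD j) (by positivity)).trans (le_of_eq ?_)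
  field_simp

theorem mem_corridor_imp {c j : ZMod m} (h : c ∈ corridor j) : j ∈ ({c - 1, c, c + 1} : Finset _) := by
  unfold corridor at h
  simp only [Finset.mem_insert, Finset.mem_singleton]
  split_ifs at h
  · simp only [Finset.mem_insert, Finset.mem_singleton] at h
    rcases h with rfl | rfl | rfl
    · right; right; ring
    · right; left; rfl
    · left; ring
  · right; left; exact (Finset.mem_singleton.1 h).symm

-- Two short-range bonds at most touch `c`, giving `2 ε`. A long-range bond through `c` has an
-- endpoint among three cells, and each endpoint carries total weight at most `5 ε`; the two
-- possible endpoints give `30 ε`.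
open Classical in
theorem sum_bondBound_through_le (hD : D.Admissible) {ε : ℝ} (hε : 0 ≤ ε) (c : ZMod m) :
    ∑ b : Bond m with c ∈ bondSupport b, D.bondBound ε b ≤ 32 * ε := by
  have hL := L_pos hD
  have hw : ∀ j k : ZMod m, (0 : ℝ) ≤ if k ∈ D.nearCells j then ε * (q / D.L) else 0 := fun j k => by
    split_ifs <;> positivity
  have hcard : (({c - 1, c, c + 1} : Finset (ZMod m)).card : ℝ) ≤ 3 := by
    exact_mod_cast Finset.card_le_three
  have hcard2 : (({c - 1, c + 1} : Finset (ZMod m)).card : ℝ) ≤ 2 := by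
    exact_mod_cast Finset.card_le_two
  rw [Finset.sum_filter, Fintype.sum_sum_type]
  have h1 : ∑ k : {k : ZMod m // Odd k.val}, (if c ∈ bondSupport (Sum.inl k : Bond m)
      then D.bondBound ε (Sum.inl k) else 0) ≤ 2 * ε := by
    have e1 : ∑ k : {k : ZMod m // Odd k.val}, (if c ∈ bondSupport (Sum.inl k : Bond m)
        then D.bondBound ε (Sum.inl k) else 0)
        ≤ ∑ k : {k : ZMod m // Odd k.val}, (if k.1 ∈ ({c - 1, c + 1} : Finset (ZMod m))
          then ε else 0) := by
      refine Finset.sum_le_sum fun k _ => ?_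
      by_cases h : c ∈ bondSupport (Sum.inl k : Bond m)
      · rw [if_pos h, if_pos]
        · exact le_rfl
        · simp only [bondSupport, Finset.mem_insert, Finset.mem_singleton] at h ⊢
          rcases h with rfl | rfl
          · right; ring
          · left; ring
      · rw [if_neg h]
        split_ifs
        exacts [hε, le_rfl]
    have e2 : ∑ k : {k : ZMod m // Odd k.val}, (if k.1 ∈ ({c - 1, c + 1} : Finset (ZMod m))
          then ε else 0) ≤ ∑ k : ZMod m, (if k ∈ ({c - 1, c + 1} : Finset (ZMod m))
          then ε else 0) := by
      rw [← Finset.sum_subtype (Finset.univ.filter fun k : ZMod m => Odd k.val) (by simp)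
        fun k : ZMod m => if k ∈ ({c - 1, c + 1} : Finset (ZMod m)) then ε else 0]
      refine Finset.sum_le_sum_of_subset_of_nonneg (Finset.filter_subset _ _) fun k _ _ => ?_
      split_ifs
      exacts [hε, le_rfl]
    refine e1.trans (e2.trans ?_)
    rw [← Finset.sum_filter, Finset.filter_univ_mem, Finset.sum_const, nsmul_eq_mul]
    exact mul_le_mul_of_nonneg_right hcard2 hε
  have h2 : ∑ e : {e : ZMod m × ZMod m // e.1.val ≤ e.2.val},
      (if c ∈ bondSupport (Sum.inr e : Bond m) then D.bondBound ε (Sum.inr e) else 0)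
      ≤ 30 * ε := by
    set T : Finset (ZMod m) := {c - 1, c, c + 1} with hT
    let f : ZMod m × ZMod m → ℝ := fun e =>
      (if e.1 ∈ T then if e.2 ∈ D.nearCells e.1 then ε * (q / D.L) else 0 else 0) +
      if e.2 ∈ T then if e.1 ∈ D.nearCells e.2 then ε * (q / D.L) else 0 else 0
    have hf : ∀ e, 0 ≤ f e := fun e => by
      have a1 := hw e.1 e.2
      have a2 := hw e.2 e.1
      refine add_nonneg ?_ ?_
      · split_ifs <;> positivity
      · split_ifs <;> positivity
    have e1 : ∑ e : {e : ZMod m × ZMod m // e.1.val ≤ e.2.val},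
        (if c ∈ bondSupport (Sum.inr e : Bond m) then D.bondBound ε (Sum.inr e) else 0)
        ≤ ∑ e : {e : ZMod m × ZMod m // e.1.val ≤ e.2.val}, f e.1 := by
      refine Finset.sum_le_sum fun e _ => ?_
      split_ifs with h
      · simp only [bondSupport, Finset.mem_union] at h
        simp only [bondBound, f]
        rcases h with h | h
        · rw [if_pos (mem_corridor_imp h)]
          refine le_add_of_nonneg_right ?_
          split_ifs <;> positivity
        · rw [if_pos (mem_corridor_imp h)]
          refine le_add_of_nonneg_of_le ?_ ?_
          · split_ifs <;> positivity
          · split_ifs with h3 h4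
            · exact le_rfl
            · exact absurd (mem_nearCells_symm h3) h4
            · positivity
            · exact le_rfl
      · exact hf e.1
    have e2 : ∑ e : {e : ZMod m × ZMod m // e.1.val ≤ e.2.val}, f e.1
        ≤ ∑ e : ZMod m × ZMod m, f e := by
      rw [← Finset.sum_subtype (Finset.univ.filter fun e : ZMod m × ZMod m => e.1.val ≤ e.2.val)
        (by simp) f]
      exact Finset.sum_le_sum_of_subset_of_nonneg (Finset.filter_subset _ _) fun e _ _ => hf e
    have e3 : ∑ j : ZMod m, ∑ k : ZMod m,
        (if j ∈ T then if k ∈ D.nearCells j then ε * (q / D.L) else 0 else 0) ≤ 15 * ε := by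
      have : ∀ j : ZMod m, ∑ k : ZMod m,
          (if j ∈ T then if k ∈ D.nearCells j then ε * (q / D.L) else 0 else 0)
          ≤ if j ∈ T then 5 * ε else 0 := by
        intro j
        split_ifs
        · exact sum_nearCells_le hD hε j
        · simp
      refine (Finset.sum_le_sum fun j _ => this j).trans ?_
      rw [← Finset.sum_filter, Finset.filter_univ_mem, Finset.sum_const, nsmul_eq_mul]
      nlinarith
    have e4 : ∑ e : ZMod m × ZMod m, f e ≤ 30 * ε := by
      rw [Finset.sum_add_distrib, Fintype.sum_prod_type, Fintype.sum_prod_type_right]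
      linarith
    linarith
  linarith

theorem card_bondSupport_le (b : Bond m) : (bondSupport b).card ≤ 6 := by
  have hc : ∀ k : ZMod m, (corridor k).card ≤ 3 := fun k => by
    unfold corridor
    split_ifs
    · exact Finset.card_le_three
    · simp
  rcases b with k | e
  · exact Finset.card_le_two.trans (by norm_num)
  · exact (Finset.card_union_le _ _).trans (by linarith [hc e.1.1, hc e.1.2])

/-- A support has at most six cells, each crossed by weight at most `32 ε`, and `192 / 2000 ≤ 1 /
9`. -/
theorem adjWeight_bondBound_le (hD : D.Admissible) {ε r : ℝ} (hε : 0 ≤ ε) (hr : 0 ≤ r)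
    (h : r * ε ≤ 1 / 2000) (b : Bond m) (Λ : Finset (Bond m)) :
    adjWeight bondAdj (fun b => r * D.bondBound ε b) Λ {b} ≤ 1 / 9 := by
  classical
  unfold adjWeight
  rw [← Finset.mul_sum]
  have hnn := bondBound_nonneg hD hε
  have h1 : ∑ b' ∈ Λ with ∃ a ∈ ({b} : Finset (Bond m)), bondAdj a b', D.bondBound ε b'
      ≤ ∑ c ∈ bondSupport b, ∑ b' : Bond m with c ∈ bondSupport b', D.bondBound ε b' := by
    simp only [Finset.sum_filter]
    rw [Finset.sum_comm]
    refine (Finset.sum_le_sum_of_subset_of_nonneg (Finset.subset_univ Λ) fun b' _ _ => ?_).trans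
      (Finset.sum_le_sum fun b' _ => ?_)
    · split_ifs; exacts [hnn b', le_rfl]
    · have hnn' : ∀ c ∈ bondSupport b, 0 ≤ if c ∈ bondSupport b' then D.bondBound ε b' else 0 :=
        fun c _ => by split_ifs; exacts [hnn b', le_rfl]
      split_ifs with hadj
      · simp only [Finset.mem_singleton, exists_eq_left] at hadj
        obtain ⟨c, hc, hc'⟩ := Finset.not_disjoint_iff.1 hadj
        refine le_trans ?_ (Finset.single_le_sum hnn' hc)
        rw [if_pos hc']
      · exact Finset.sum_nonneg hnn'
  have h2 : ∑ c ∈ bondSupport b, ∑ b' : Bond m with c ∈ bondSupport b', D.bondBound ε b'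
      ≤ 192 * ε := by
    refine (Finset.sum_le_sum fun c _ => sum_bondBound_through_le hD hε c).trans ?_
    rw [Finset.sum_const, nsmul_eq_mul]
    have : ((bondSupport b).card : ℝ) ≤ 6 := by exact_mod_cast card_bondSupport_le b
    nlinarith
  nlinarith [mul_le_mul_of_nonneg_left (h1.trans h2) hr]

theorem sum_bondBound_le (hD : D.Admissible) {ε : ℝ} (hε : 0 ≤ ε) :
    ∑ b : Bond m, D.bondBound ε b ≤ m * (32 * ε) := by
  classical
  have hnn := bondBound_nonneg hD hε
  calc ∑ b : Bond m, D.bondBound ε b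
      ≤ ∑ b : Bond m, ∑ c : ZMod m, if c ∈ bondSupport b then D.bondBound ε b else 0 := by
        refine Finset.sum_le_sum fun b _ => ?_
        obtain ⟨c, hc⟩ := bondSupport_nonempty b
        refine le_trans ?_ (Finset.single_le_sum (fun c _ => ?_) (Finset.mem_univ c))
        · rw [if_pos hc]
        · split_ifs; exacts [hnn b, le_rfl]
    _ = ∑ c : ZMod m, ∑ b : Bond m with c ∈ bondSupport b, D.bondBound ε b := by
        simp only [Finset.sum_filter]
        exact Finset.sum_comm
    _ ≤ ∑ c : ZMod m, 32 * ε := Finset.sum_le_sum fun c _ => sum_bondBound_through_le hD hε c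
    _ = m * (32 * ε) := by simp [ZMod.card]

/-- Outside the range of the interaction the fluctuation, and with it the factor, vanishes exactly.
This keeps the total weight through a cell bounded uniformly in `m`. -/
theorem abs_bondFactor_le (hD : D.Admissible) {η : ZMod m → ℤ} {ε : ℝ}
    (hs : ∀ k : ZMod m, Odd k.val → ∀ a b, |D.fs k (η k) a b| ≤ ε)
    (hl : ∀ (j k : ZMod m) (σ : Config m q), |D.fl j k σ| ≤ ε * (q / D.L)) (b : Bond m)
    (σ : Config m q) : |D.bondFactor η σ b| ≤ D.bondBound ε b := by
  rcases b with k | e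
  · exact hs k.1 k.2 _ _
  · simp only [bondFactor, bondBound]
    split_ifs with h
    · exact hl _ _ _
    · have h1 := abs_fluct_le hD σ e.1.1 e.1.2
      rw [if_neg h] at h1
      rw [fl_eq, abs_nonpos_iff.1 h1]
      simp

theorem corrFactor_eq (hD : D.Admissible) {η : ZMod m → ℤ} (hη : η ∈ coarseConfigs m q) :
    D.corrFactor η = (polymerPoly (D.bondWeight η)).eval 1 := by
  rw [polymerPoly_eq (factorizes_bondWeight hD hη), Polynomial.eval_finsetSum, corrFactor]
  simp only [Polynomial.eval_mul, Polynomial.eval_C, Polynomial.eval_pow, Polynomial.eval_X,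
    one_pow, mul_one, bondWeight]
  rw [Finset.sum_comm]
  refine Finset.sum_congr rfl fun σ _ => ?_
  rw [Finset.prod_one_add, Finset.mul_sum, Finset.powerset_univ]

theorem correction_eq (D : Model m q) (j : ℕ) (η : ZMod m → ℤ) :
    D.correction j η = -(1 / D.β) * logCoeff (polymerPoly (D.bondWeight η)) j := by
  rw [← sum_clusterCoeff]
  rfl

/-- Convergence of the cluster expansion of the correction factor. -/
theorem cluster_expansion (hD : D.Admissible) {η : ZMod m → ℤ} (hη : η ∈ coarseConfigs m q)
    {ε : ℝ} (hε : 0 < ε) (hε' : ε ≤ 1 / 4000)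
    (hs : ∀ k : ZMod m, Odd k.val → ∀ a b, |D.fs k (η k) a b| ≤ ε)
    (hl : ∀ (j k : ZMod m) (σ : Config m q), |D.fl j k σ| ≤ ε * (q / D.L)) :
    HasSum (fun j => logCoeff (polymerPoly (D.bondWeight η)) (j + 1))
        (Real.log (D.corrFactor η)) ∧
      ∀ p : ℕ, |Real.log (D.corrFactor η)
          - ∑ j ∈ Finset.Icc 1 p, logCoeff (polymerPoly (D.bondWeight η)) j|
        ≤ m * (4000 * ε) ^ (p + 1) := by
  set φ := D.bondWeight η with hφ
  have hfac : Factorizes φ := factorizes_bondWeight hD hη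
  have hloc : IsLocalWeight bondAdj (D.bondBound ε) fun B => ((φ B : ℝ) : ℂ) :=
    { empty := by rw [hfac.empty]; simp
      union := fun A B h => by rw [hfac.union A B h]; push_cast; rfl
      norm_le := fun A => by
        rw [Complex.norm_real, Real.norm_eq_abs]
        exact abs_bondWeight_le hD hη (abs_bondFactor_le hD hs hl) A
      refl := bondAdj_refl
      nonneg := bondBound_nonneg hD hε.le }
  -- The largest radius allowed by `adjWeight_bondBound_le`; `ε ≤ 1 / 4000` makes it at least `2`,
  -- as `tail_bound` requires.
  set r : ℝ := 1 / (2000 * ε) with hr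
  have hr0 : 0 < r := by positivity
  have hrε : r * ε = 1 / 2000 := by rw [hr]; field_simp
  have hr2 : 2 ≤ r := by rw [hr, le_div_iff₀ (by positivity)]; linarith
  obtain ⟨F, hF, hF0, hFz⟩ := hloc.exists_log hr0
    (adjWeight_bondBound_le hD hε.le hr0.le hrε.le) Finset.univ
  have hpoly : ∀ z : ℂ, Polynomial.aeval z (polymerPoly φ)
      = setSum (scaleWeight (fun B => ((φ B : ℝ) : ℂ)) z) Finset.univ ∅ := by
    intro z
    rw [polymerPoly_eq hfac, setSum, Finset.powerset_univ]
    simp only [map_sum, map_mul, map_pow, Polynomial.aeval_C, Polynomial.aeval_X,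
      Finset.empty_union, scaleWeight, Complex.coe_algebraMap]
    exact Finset.sum_congr rfl fun B _ => mul_comm _ _
  -- The total bond weight is at most `32 ε m`, and `9 / 2 * 32 / 2000 < 1`.
  have hK : ∀ z ∈ Metric.ball (0 : ℂ) r, ‖F z‖ ≤ m := by
    intro z hz
    refine (hFz z hz).2.trans ?_
    rw [← Finset.mul_sum, ← Finset.mul_sum]
    have h1 := mul_le_mul_of_nonneg_left (sum_bondBound_le hD hε.le) hr0.le
    have h2 : r * (m * (32 * ε)) = m * (32 / 2000) := by
      rw [show r * (m * (32 * ε)) = m * 32 * (r * ε) by ring, hrε]; ring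
    have h3 : (0 : ℝ) ≤ m := Nat.cast_nonneg m
    linarith
  obtain ⟨hbound, hsum⟩ := logCoeff_bound_and_hasSum (by linarith) hF hF0
    (fun z hz => by rw [(hFz z hz).1, hpoly]) hK
  rw [corrFactor_eq hD hη]
  refine ⟨hsum, fun p => ?_⟩
  have := tail_bound hr2 (Nat.cast_nonneg m) hbound hsum p
  rwa [show 2 / r = 4000 * ε by rw [hr]; field_simp; norm_num] at this

theorem delta_nonneg (hD : D.Admissible) : 0 ≤ D.delta := by
  have := L_pos hD
  have := hD.beta_pos
  have := normU_nonneg (D := D)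
  have := gradV_nonneg (D := D)
  unfold delta
  positivity

theorem q_mul_delta (D : Model m q) :
    q * D.delta = D.β * (D.S * D.normU) + q ^ 2 * D.β * D.gradV / D.L := by
  have hq : (0 : ℝ) < q := by exact_mod_cast NeZero.pos q
  unfold delta
  field_simp

/-- The logarithm of `1 + fs` is at most `2 q δ ≤ 1` in absolute value, and `|exp x - 1| ≤ 2 |x|`
for `|x| ≤ 1`. -/
theorem abs_fs_le (hD : D.Admissible) (k : ZMod m) {s : ℤ} (hs : s ∈ coarseSpins q)
    (a b : Cell q) (hsmall : q * D.delta ≤ 1 / 2) : |D.fs k s a b| ≤ 4 * (q * D.delta) := by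
  have hL := L_pos hD
  have hβ := hD.beta_pos
  have hV := gradV_nonneg (D := D)
  obtain ⟨h1, h2⟩ := fs_add_one_bounds hD k hs a b
  have h3 : D.β * (D.S * D.normU) ≤ q * D.delta := by
    rw [q_mul_delta D]
    exact le_add_of_nonneg_right (by positivity)
  have h4 := Real.abs_exp_sub_one_le (x := Real.log (D.fs k s a b + 1)) (by linarith)
  rw [Real.exp_log h1, add_sub_cancel_right] at h4
  linarith

theorem abs_fl_le (hD : D.Admissible) (j k : ZMod m) (σ : Config m q)
    (hsmall : q * D.delta ≤ 1 / 2) : |D.fl j k σ| ≤ 4 * (q * D.delta) * (q / D.L) := by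
  have hL := L_pos hD
  have hβ := hD.beta_pos
  have hV := gradV_nonneg (D := D)
  have hU := normU_nonneg (D := D)
  have hq : (0 : ℝ) < q := by exact_mod_cast NeZero.pos q
  have hqL : q / D.L ≤ 1 := by rw [div_le_one hL]; exact hD.q_lt_L.le
  have h1 : |D.fluct σ j k| ≤ q ^ 2 * D.oscJ := by
    refine (abs_fluct_le hD σ j k).trans ?_
    have := oscJ_nonneg D
    split_ifs
    · exact le_rfl
    · positivity
  have h2 : q ^ 2 * D.β * D.gradV / D.L ≤ q * D.delta := by
    rw [q_mul_delta D]
    exact le_add_of_nonneg_left (by positivity)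
  have h3 : |(2 : ℝ) - if j = k then 1 else 0| ≤ 2 := by split_ifs <;> norm_num
  set x := D.β / 2 * (D.fluct σ j k * (2 - if j = k then 1 else 0)) with hx
  have h4 : |x| ≤ 2 * (q * D.delta) * (q / D.L) := by
    rw [hx, abs_mul, abs_mul, abs_of_pos (by positivity : 0 < D.β / 2)]
    have h5 : |D.fluct σ j k| * |(2 : ℝ) - if j = k then 1 else 0| ≤ q ^ 2 * D.oscJ * 2 :=
      mul_le_mul h1 h3 (abs_nonneg _) ((abs_nonneg _).trans h1)
    calc _ ≤ D.β / 2 * (q ^ 2 * D.oscJ * 2) := mul_le_mul_of_nonneg_left h5 (by positivity)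
      _ = 2 * (q ^ 2 * D.β * D.gradV / D.L) * (q / D.L) := by unfold oscJ; field_simp
      _ ≤ _ := by gcongr
  have h0 : 0 ≤ q * D.delta := mul_nonneg hq.le (delta_nonneg hD)
  have h5 : |x| ≤ 1 := by
    refine h4.trans ?_
    have : 2 * (q * D.delta) * (q / D.L) ≤ 2 * (q * D.delta) * 1 := by gcongr
    linarith
  have h6 := Real.abs_exp_sub_one_le h5
  rw [fl_eq]
  linarith

/-- Expansion of the exact coarse-grained Hamiltonian, with remainder estimates. -/
theorem expansion_of_small (hD : D.Admissible)
    (hs : ∀ k : ZMod m, Odd k.val → ∀ s ∈ coarseSpins q, ∀ a b : Cell q,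
      |D.fs k s a b| ≤ 1 / 4000)
    (hl : ∀ (j k : ZMod m) (σ : Config m q), |D.fl j k σ| ≤ 1 / 4000 * (q / D.L))
    {η : ZMod m → ℤ} (hη : η ∈ coarseConfigs m q) :
    HasSum (fun j : ℕ => D.correction (j + 1) η) (D.barH η - D.barH0 η) ∧
      ∀ p : ℕ, D.β * |D.barH η - (D.barH0 η + ∑ j ∈ Finset.Icc 1 p, D.correction j η)|
        ≤ (m : ℝ) * (16000 * (q * D.delta)) ^ (p + 1) := by
  have hL := L_pos hD
  have hβ := hD.beta_pos
  have hq : (0 : ℝ) < q := by exact_mod_cast NeZero.pos q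
  have hqL : 0 < q / D.L := by positivity
  set t := q * D.delta with ht
  have ht0 : 0 ≤ t := mul_nonneg hq.le (delta_nonneg hD)
  -- The hypothesis gives convergence; the a priori bound `4 t` gives the powers of `q δ`. When `t >
  -- 1 / 2` the second bound follows from the first.
  have hs' : ∀ k : ZMod m, Odd k.val → ∀ a b, |D.fs k (η k) a b| ≤ min (1 / 4000) (4 * t) := by
    intro k hk a b
    refine le_min (hs k hk _ (mem_coarseSpins hη k) a b) ?_
    rcases le_or_gt t (1 / 2) with h | h
    · exact abs_fs_le hD k (mem_coarseSpins hη k) a b h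
    · linarith [hs k hk _ (mem_coarseSpins hη k) a b]
  have hl' : ∀ (j k : ZMod m) (σ : Config m q),
      |D.fl j k σ| ≤ min (1 / 4000) (4 * t) * (q / D.L) := by
    intro j k σ
    rw [min_mul_of_nonneg _ _ hqL.le]
    refine le_min (hl j k σ) ?_
    rcases le_or_gt t (1 / 2) with h | h
    · exact abs_fl_le hD j k σ h
    · exact (hl j k σ).trans (by gcongr; linarith)
  have hexp := fun (ε : ℝ) (h0 : 0 < ε) (h1 : ε ≤ 1 / 4000) (h2 : min (1 / 4000) (4 * t) ≤ ε) =>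
    cluster_expansion hD hη h0 h1 (fun k hk a b => (hs' k hk a b).trans h2)
      fun j k σ => (hl' j k σ).trans (mul_le_mul_of_nonneg_right h2 hqL.le)
  constructor
  · rw [barH_sub_barH0 hD hη]
    simp only [correction_eq]
    exact (hexp (1 / 4000) (by norm_num) le_rfl (min_le_left _ _)).1.mul_left _
  · intro p
    have heq : D.β * |D.barH η - (D.barH0 η + ∑ j ∈ Finset.Icc 1 p, D.correction j η)|
        = |Real.log (D.corrFactor η)
          - ∑ j ∈ Finset.Icc 1 p, logCoeff (polymerPoly (D.bondWeight η)) j| := by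
      simp only [correction_eq]
      rw [← sub_sub, barH_sub_barH0 hD hη, ← Finset.mul_sum, ← mul_sub, abs_mul, abs_neg,
        abs_of_pos (by positivity : 0 < 1 / D.β), ← mul_assoc, mul_one_div_cancel hβ.ne', one_mul]
    rw [heq]
    have hm : (0 : ℝ) ≤ m := Nat.cast_nonneg m
    have hbd : ∀ ε : ℝ, 0 < ε → 4 * t ≤ ε → ε ≤ 1 / 4000 → |Real.log (D.corrFactor η)
          - ∑ j ∈ Finset.Icc 1 p, logCoeff (polymerPoly (D.bondWeight η)) j|
        ≤ m * (4000 * ε) ^ (p + 1) := fun ε h0 h2 h1 =>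
      (hexp ε h0 h1 ((min_le_right _ _).trans h2)).2 p
    -- The choice is `ε = 4 t` whenever admissible, so `4000 ε = 16000 t`. For `t = 0` one lets `ε`
    -- tend to `0`, since `r` requires `ε > 0`; for `4 t > 1 / 4000` one takes `ε = 1 / 4000`, with
    -- bound `m`, which suffices as `16000 t > 1`.
    rcases ht0.eq_or_lt with h | h
    · have hlim : Filter.Tendsto (fun ε : ℝ => m * (4000 * ε) ^ (p + 1)) (nhdsWithin 0 (Set.Ioi 0))
          (nhds (m * (4000 * 0) ^ (p + 1))) :=
        (Continuous.tendsto (by fun_prop) 0).mono_left nhdsWithin_le_nhds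
      rw [← h, show (16000 : ℝ) * 0 = 4000 * 0 by norm_num]
      refine ge_of_tendsto hlim ?_
      filter_upwards [Ioo_mem_nhdsGT (show (0 : ℝ) < 1 / 4000 by norm_num)] with ε hε
      exact hbd ε hε.1 (by rw [← h]; linarith [hε.1]) hε.2.le
    · rcases le_or_gt (4 * t) (1 / 4000) with h1 | h1
      · refine (hbd (4 * t) (by linarith) le_rfl h1).trans (le_of_eq ?_)
        ring
      · refine ((hexp (1 / 4000) (by norm_num) le_rfl (min_le_left _ _)).2 p).trans ?_
        exact mul_le_mul_of_nonneg_left (pow_le_pow_left₀ (by norm_num) (by linarith) _) hm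

end Model

end ClusterExpansion

end CoarseGrain

theorem theorem3p1 :
    -- explicit form of the long-range part
    (∀ (m q : ℕ) [NeZero m] [NeZero q] (D : CoarseGrain.Model m q), D.Admissible →
      ∀ η ∈ CoarseGrain.coarseConfigs m q,
        D.barHl0 η =
          -(1 / 2) * ∑ k : ZMod m, ∑ l : ZMod m with l ≠ k, D.barJ k l * (η k : ℝ) * (η l : ℝ)
          - (1 / 2) * ∑ k : ZMod m, D.barJ k k * ((η k : ℝ) ^ 2 - (q : ℝ))) ∧
    -- error bounds for the zeroth-order approximation
    (∃ C : ℝ, 0 < C ∧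
      ∀ (m q : ℕ) [NeZero m] [NeZero q] (D : CoarseGrain.Model m q), D.Admissible →
        (∀ η ∈ CoarseGrain.coarseConfigs m q,
          D.β * |D.barH η - D.barH0 η| ≤ ((m * q : ℕ) : ℝ) * (C * D.delta)) ∧
        |1 / ((m * q : ℕ) : ℝ) * CoarseGrain.relEntropy (CoarseGrain.coarseConfigs m q)
            D.coarseGibbs0 D.coarseGibbs| ≤ C * D.delta) ∧
    -- convergent cluster expansion, uniformly in the number of cells
    (∃ δ₀ δ₁ C : ℝ, 0 < δ₀ ∧ 0 < δ₁ ∧ 0 < C ∧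
      ∀ (m q : ℕ) [NeZero m] [NeZero q] (D : CoarseGrain.Model m q), D.Admissible →
        (∀ k : ZMod m, Odd k.val → ∀ s ∈ CoarseGrain.coarseSpins q,
          ∀ a b : CoarseGrain.Cell q, |D.fs k s a b| ≤ δ₀) →
        (∀ (j k : ZMod m) (σ : CoarseGrain.Config m q), |D.fl j k σ| ≤ δ₁ * (q / D.L)) →
        ∀ η ∈ CoarseGrain.coarseConfigs m q,
          HasSum (fun j : ℕ => D.correction (j + 1) η) (D.barH η - D.barH0 η) ∧
          ∀ p : ℕ,
            D.β * |D.barH η - (D.barH0 η + ∑ j ∈ Finset.Icc 1 p, D.correction j η)|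
              ≤ (m : ℝ) * (C * (q * D.delta)) ^ (p + 1)) := by
  -- The constant `10` is dictated by the relative entropy, twice the `5` of the energy estimate.
  refine ⟨fun m q _ _ D hD η hη => ?_, ⟨10, by norm_num, fun m q _ _ D hD => ⟨fun η hη => ?_, ?_⟩⟩,
    ⟨1 / 4000, 1 / 4000, 16000, by norm_num, by norm_num, by norm_num,
      fun m q _ _ D hD hs hl η hη => CoarseGrain.Model.expansion_of_small hD hs hl hη⟩⟩
  · rw [CoarseGrain.Model.barHl0_eq hD hη, CoarseGrain.Model.meanHl_eq]
  · refine (CoarseGrain.Model.abs_barH_sub_barH0_le hD hη).trans ?_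
    have := CoarseGrain.Model.delta_nonneg hD
    gcongr
    norm_num
  · have hN : (0 : ℝ) < ((m * q : ℕ) : ℝ) := by
      exact_mod_cast Nat.mul_pos (NeZero.pos m) (NeZero.pos q)
    rw [abs_mul, abs_of_pos (by positivity), one_div, inv_mul_le_iff₀ hN]
    refine (CoarseGrain.Model.abs_relEntropy_coarseGibbs_le hD).trans (le_of_eq ?_)
    ring
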